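/- Let $d\ge 2$, let $\mathcal U\subseteq\mathbb R^n$ be open, and consider the system $$u_t+\sum_{j=1}^d f^j(u)_{x_j}=\sum_{j,k=1}^d\bigl(B^{jk}(u)u_{x_k}\bigr)_{x_j},\qquad u\in\mathcal U,\ x\in\mathbb R^d,\ f^j(u)\in\mathbb R^n,\ B^{jk}(u)\in\mathbb R^{n\times n}.$$ For $a\in\mathcal U$, $s\in\mathbb R$, $\nu\in S^{d-1}$, $q\in\mathbb R^n$ let $u(\cdot;a,s,\nu,q)$ be the solution with $u(0)=a$ of the profile equation $$\sum_{j,k}\nu_j\nu_kB^{jk}(u)u'=\sum_j\nu_jf^j(u)-su-q .\qquad(\ast)$$ Let $\bar u$ be a nonconstant periodic solution of $(\ast)$, with values in $\mathcal U$ and period $\bar X>0$, for $s=0$, $\nu=e_1$, $q=\bar q$ (a normalization without loss of generality), and put $\bar a=\bar u(0)$. Assume: (H0) $f^j,B^{jk}\in C^2(\mathcal U)$. (H1) There is $\theta>0$ such that every eigenvalue $\mu$ of $\sum_{j,k}\nu_j\nu_kB^{jk}(u)$ satisfies $\operatorname{Re}\mu\ge\theta$, for all $u\in\mathcal U$ and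 $\nu\in S^{d-1}$. (H2) The map $H(X;a,s,\nu,q)=u(X;a,s,\nu,q)-a\in\mathbb R^n$ is a submersion at $(\bar X;\bar a,0,e_1,\bar q)$. *Averaged system.* Let $\mathcal P$ be the set of periodic solutions of $(\ast)$ near $\bar u$ (over all $s,\nu,q$) modulo translation in $y$, and write $X,S,N,Q$ for the period, speed, direction $\nu$ and constant $q$ of $\dot u\in\mathcal P$, $\Omega=1/X$, and $$M=\frac1X\int_0^Xu\,dy,\qquad F^j=\frac1X\int_0^X\Bigl(f^j(u)-\sum_kB^{jk}(u)N_k\,u'\Bigr)dy .$$ By a local parametrization of $\mathcal P$ at $\dot{\bar u}$ we mean a $C^1$ map $\psi$ from a neighbourhood of $0$ in $\mathbb R^{n+d}$ to parameters $(X,a,s,\nu,q)$ of periodic solutions, with $\psi(0)=(\bar X,\bar a,0,e_1,\bar q)$, whose derivative at $0$ is injective modulo the direction $(0,\bar u'(0),0,0,0)$ of translations. In such coordinates $\dot u$, let $$\hat\Delta(\xi,\lambda)=\det\Bigl(\lambda\,\frac{\partial(M,\Omega N)}{\partial\dot u}(\dot{\bar u})+\sum_{j=1}^d i\xi_j\,\frac{\partial(F^j,S\Omega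 e_j)}{\partial\dot u}(\dot{\bar u})\Bigr),\qquad \xi\in\mathbb R^d,\ \lambda\in\mathbb C,$$ the linearized dispersion relation of $\partial_tM+\sum_j\partial_{x_j}F^j=0$, $\partial_t(\Omega N)+\nabla_x(\Omega S)=0$ (changing the coordinates multiplies it by a nonzero constant). *Evans function.* Put $B^{jk}=B^{jk}(\bar u(x_1))$ and $A^jv=Df^j(\bar u)v-(DB^{j1}(\bar u)v)\bar u'$. For $\xi=(\xi_1,\tilde\xi)\in\mathbb R\times\mathbb R^{d-1}$ and $\lambda\in\mathbb C$ let $w^1,\dots,w^{2n}$, analytic in $(\tilde\xi,\lambda)$ together with their $x_1$-derivatives, be a basis of the space of solutions of $$(B^{11}w')'-(A^1w)'+i\sum_{j\ne1}\xi_jB^{j1}w'+i\Bigl(\sum_{k\ne1}\xi_kB^{1k}w\Bigr)'-i\sum_{j\ne1}\xi_jA^jw-\sum_{j,k\ne1}\xi_j\xi_kB^{jk}w-\lambda w=0,$$ and let $$D(\xi,\lambda)=\det\begin{pmatrix}w^l(\bar X)-e^{i\bar X\xi_1}w^l(0)\\(w^l)'(\bar X)-e^{i\bar X\xi_1}(w^l)'(0)\end{pmatrix}_{1\le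 l\le 2n}.$$ **Theorem.** Local parametrizations of $\mathcal P$ at $\dot{\bar u}$ (by $n+d$ coordinates) and analytic bases $(w^l)$ exist. For every local parametrization, $\Delta(\xi,\lambda):=\lambda^{1-d}\hat\Delta(\xi,\lambda)$ is a homogeneous polynomial of degree $n+1$ in $(\xi,\lambda)$ (that is, there is such a polynomial $\Delta$ with $\lambda^{d-1}\Delta=\hat\Delta$), and for every analytic basis there is a constant $\Gamma_0\ne0$ with $$D(\xi,\lambda)=\Gamma_0\,\Delta(\xi,\lambda)+O\bigl(|\xi,\lambda|^{n+2}\bigr)\qquad\text{as }(\xi,\lambda)\to(0,0).$$ -/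

import Mathlib

open Filter Topology
open scoped Matrix

noncomputable section

namespace PeriodicWave

/-- The data of the system of viscous conservation laws
`u_t + ∑ⱼ f^j(u)_{x_j} = ∑_{j,k} (B^{jk}(u) u_{x_k})_{x_j}`, with `u ∈ U ⊆ ℝⁿ` open and
`x ∈ ℝᵈ`, `d = m + 1`.  The direction `x₁` of the text is index `0`, and the transverse
directions `x₂, …, x_d` are the indices `j.succ`, `j : Fin m`. -/
structure System (n m : ℕ) where
  U : Set (Fin n → ℝ)
  isOpen_U : IsOpen U
  f : Fin (m + 1) → (Fin n → ℝ) → (Fin n → ℝ)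
  B : Fin (m + 1) → Fin (m + 1) → (Fin n → ℝ) → Matrix (Fin n) (Fin n) ℝ

/-- Parameters `θ = (X, a, s, δ, q)`: period, initial value, speed, direction, constant of
integration.  The unit vector `ν` near `e₁` is `direction δ`. -/
abbrev Params (n m : ℕ) : Type :=
  ℝ × (Fin n → ℝ) × ℝ × (Fin m → ℝ) × (Fin n → ℝ)

/-- The coordinates `ν = (1, δ) / √(1 + |δ|²)` on the unit sphere of `ℝᵈ` near `e₁`. -/
def direction {m : ℕ} (δ : Fin m → ℝ) : Fin (m + 1) → ℝ :=
  (Real.sqrt (1 + ∑ j, δ j ^ 2))⁻¹ • (Fin.cons 1 δ : Fin (m + 1) → ℝ)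

/-- The period `X`. -/
def period {n m : ℕ} (θ : Params n m) : ℝ := θ.1

/-- The initial value `a`. -/
def start {n m : ℕ} (θ : Params n m) : Fin n → ℝ := θ.2.1

/-- The speed `S`. -/
def speed {n m : ℕ} (θ : Params n m) : ℝ := θ.2.2.1

/-- The unit normal `N`. -/
def normal {n m : ℕ} (θ : Params n m) : Fin (m + 1) → ℝ := direction θ.2.2.2.1

/-- The constant of integration `Q`. -/
def constant {n m : ℕ} (θ : Params n m) : Fin n → ℝ := θ.2.2.2.2

/-- The frequency `Ω = 1 / X`. -/
def frequency {n m : ℕ} (θ : Params n m) : ℝ := 1 / period θ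

namespace System

variable {n m : ℕ} (P : System n m)

/-- `f^j` and `B^{jk}` are `C²` on `U`. -/
def H0 : Prop :=
  (∀ j, ContDiffOn ℝ 2 (P.f j) P.U) ∧
    ∀ j k a b, ContDiffOn ℝ 2 (fun u => P.B j k u a b) P.U

/-- Parabolicity: `Re σ(∑ ν_j ν_k B^{jk}(u)) ≥ θ > 0`, uniformly in `u ∈ U` and unit `ν`. -/
def H1 : Prop :=
  ∃ θ : ℝ, 0 < θ ∧ ∀ u ∈ P.U, ∀ ν : Fin (m + 1) → ℝ, ∑ j, ν j ^ 2 = 1 →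
    ∀ μ ∈ spectrum ℂ ((∑ j, ∑ k, (ν j * ν k) • P.B j k u).map (Complex.ofReal)), θ ≤ μ.re

/-- `v` takes values in `U` and solves on `I` the profile equation
`∑ ν_j ν_k B^{jk}(v) v' = ∑ ν_j f^j(v) - s v - q`. -/
def IsProfileOn (s : ℝ) (ν : Fin (m + 1) → ℝ) (q : Fin n → ℝ) (v : ℝ → Fin n → ℝ)
    (I : Set ℝ) : Prop :=
  ∀ y ∈ I, v y ∈ P.U ∧ ∃ v' : Fin n → ℝ, HasDerivWithinAt v v' I y ∧
    (∑ j, ∑ k, (ν j * ν k) • P.B j k (v y)) *ᵥ v' = ∑ j, ν j • P.f j (v y) - s • v y - q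

open Classical in
/-- The value at `y` of the (unique) solution `u(y; a, s, ν, q)` of the profile equation with
`u(0) = a`, if that solution exists on the whole interval between `0` and `y`. -/
def profile (θ : Params n m) (y : ℝ) : Fin n → ℝ :=
  if h : ∃ v : ℝ → Fin n → ℝ, v 0 = start θ ∧
      P.IsProfileOn (speed θ) (normal θ) (constant θ) v (Set.uIcc 0 y)
  then h.choose y else 0

/-- The map `H(X; a, s, ν, q) = u(X; a, s, ν, q) - a`. -/
def H (θ : Params n m) : Fin n → ℝ := P.profile θ (period θ) - start θ

/-- The average `M` over a period. -/
def M (θ : Params n m) : Fin n → ℝ :=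
  (1 / period θ) • ∫ y in (0 : ℝ)..period θ, P.profile θ y

/-- The averaged flux `F^j = X⁻¹ ∫₀^X (f^j(u) - ∑ₖ B^{jk}(u) ν_k u') dy`. -/
def F (j : Fin (m + 1)) (θ : Params n m) : Fin n → ℝ :=
  (1 / period θ) • ∫ y in (0 : ℝ)..period θ,
    (P.f j (P.profile θ y) -
      ∑ k, normal θ k • (P.B j k (P.profile θ y) *ᵥ deriv (P.profile θ) y))

/-- `ubar` is a nonconstant periodic solution, of period `X`, of the profile equation with
speed `0`, direction `e₁` and constant of integration `q`. -/
structure IsPeriodicWave (ubar : ℝ → Fin n → ℝ) (X : ℝ) (q : Fin n → ℝ) : Prop where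
  period_pos : 0 < X
  periodic : Function.Periodic ubar X
  profile : P.IsProfileOn 0 (Pi.single 0 1) q ubar Set.univ
  nonconstant : ¬ ∃ c, ∀ y, ubar y = c

end System

/-- The parameter point `(X; ubar(0), 0, e₁, q)` of the wave `ubar`. -/
def basePoint {n : ℕ} (m : ℕ) (ubar : ℝ → Fin n → ℝ) (X : ℝ) (q : Fin n → ℝ) : Params n m :=
  (X, ubar 0, 0, 0, q)

namespace System

variable {n m : ℕ} (P : System n m)

/-- `H` is a submersion at the parameter point of the wave.  (The derivative of a map that is not
differentiable is `0` in Lean, which is not onto, so differentiability is included.) -/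
def H2 (ubar : ℝ → Fin n → ℝ) (X : ℝ) (q : Fin n → ℝ) : Prop :=
  Function.Surjective (fderiv ℝ P.H (basePoint m ubar X q))

/-- `ψ` is a `C¹` local parametrization, near the class of `ubar`, of the `(n+d)`-dimensional
manifold of periodic solutions of profile equations modulo translation: `ψ p` is the parameter
of a periodic solution, `ψ 0` is that of `ubar`, and the derivative at `0` is injective modulo the
tangent `(0, ubar'(0), 0, 0, 0)` to the translates of `ubar`. -/
structure IsLocalParametrization (ubar : ℝ → Fin n → ℝ) (X : ℝ) (q : Fin n → ℝ)
    (ψ : (Fin n ⊕ Fin (m + 1) → ℝ) → Params n m) : Prop where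
  contDiffAt : ContDiffAt ℝ 1 ψ 0
  base : ψ 0 = basePoint m ubar X q
  periodic : ∀ᶠ p in 𝓝 0, ∃ v : ℝ → Fin n → ℝ, v 0 = start (ψ p) ∧
    P.IsProfileOn (speed (ψ p)) (normal (ψ p)) (constant (ψ p)) v Set.univ ∧
    Function.Periodic v (period (ψ p))
  transversal : ∀ (h : Fin n ⊕ Fin (m + 1) → ℝ) (τ : ℝ),
    fderiv ℝ ψ 0 h = τ • ((0, deriv ubar 0, 0, 0, 0) : Params n m) → h = 0

/-- The matrix `λ ∂(M, ΩN)/∂u̇ + ∑ⱼ i ξ_j ∂(F^j, S Ω e_j)/∂u̇` in the coordinates `ψ`. -/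
def whithamMatrix (ψ : (Fin n ⊕ Fin (m + 1) → ℝ) → Params n m)
    (ξ : Fin (m + 1) → ℝ) (lam : ℂ) :
    Matrix (Fin n ⊕ Fin (m + 1)) (Fin n ⊕ Fin (m + 1)) ℂ :=
  Matrix.of fun r c => Sum.elim
    (fun a : Fin n =>
      lam * (fderiv ℝ (fun p => P.M (ψ p)) 0 (Pi.single c 1) a : ℝ) +
        ∑ j, Complex.I * (ξ j : ℂ) *
          (fderiv ℝ (fun p => P.F j (ψ p)) 0 (Pi.single c 1) a : ℝ))
    (fun k : Fin (m + 1) =>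
      lam * (fderiv ℝ (fun p => frequency (ψ p) • normal (ψ p)) 0 (Pi.single c 1) k : ℝ) +
        ∑ j, Complex.I * (ξ j : ℂ) *
          (fderiv ℝ (fun p => (speed (ψ p) * frequency (ψ p)) •
            (Pi.single j 1 : Fin (m + 1) → ℝ)) 0 (Pi.single c 1) k : ℝ))
    r

/-- The linearized dispersion relation `Δ̂(ξ, λ)` of the averaged system. -/
def deltaHat (ψ : (Fin n ⊕ Fin (m + 1) → ℝ) → Params n m)
    (ξ : Fin (m + 1) → ℝ) (lam : ℂ) : ℂ :=
  (P.whithamMatrix ψ ξ lam).det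

/-- `B^{jk}(ubar(x))`, as a complex matrix. -/
def coeffB (ubar : ℝ → Fin n → ℝ) (j k : Fin (m + 1)) (x : ℝ) : Matrix (Fin n) (Fin n) ℂ :=
  (P.B j k (ubar x)).map Complex.ofReal

/-- The matrix of `v ↦ Df^j(ubar) v - (DB^{j1}(ubar) v) ubar'` at `x`, as a complex matrix. -/
def coeffA (ubar : ℝ → Fin n → ℝ) (j : Fin (m + 1)) (x : ℝ) : Matrix (Fin n) (Fin n) ℂ :=
  Matrix.of fun a b =>
    ((fderiv ℝ (P.f j) (ubar x) (Pi.single b 1) a -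
      ∑ c, fderiv ℝ (fun u => P.B j 0 u a c) (ubar x) (Pi.single b 1) * deriv ubar x c : ℝ) : ℂ)

/-- `w` is a (`C²`) solution on `ℝ` of the eigenvalue equation `(L_ξ̃ - λ) w = 0` of the
linearization about `ubar`, at transverse frequency `ξ̃ ∈ ℝ^{d-1}`. -/
def IsEigensolution (ubar : ℝ → Fin n → ℝ) (ξt : Fin m → ℝ) (lam : ℂ)
    (w : ℝ → Fin n → ℂ) : Prop :=
  ContDiff ℝ 2 w ∧ ∀ x : ℝ,
    deriv (fun y => P.coeffB ubar 0 0 y *ᵥ deriv w y) x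
      - deriv (fun y => P.coeffA ubar 0 y *ᵥ w y) x
      + Complex.I • ∑ j : Fin m, (ξt j : ℂ) • (P.coeffB ubar j.succ 0 x *ᵥ deriv w x)
      + Complex.I • deriv (fun y => ∑ k : Fin m,
          (ξt k : ℂ) • (P.coeffB ubar 0 k.succ y *ᵥ w y)) x
      - Complex.I • ∑ j : Fin m, (ξt j : ℂ) • (P.coeffA ubar j.succ x *ᵥ w x)
      - ∑ j : Fin m, ∑ k : Fin m,
          ((ξt k : ℂ) * (ξt j : ℂ)) • (P.coeffB ubar j.succ k.succ x *ᵥ w x)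
      - lam • w x = 0

/-- `w¹, …, w²ⁿ` (indexed by `Fin n ⊕ Fin n`) is, for each `(ξ̃, λ)`, a basis of the
`2n`-dimensional kernel of `L_ξ̃ - λ`, analytic in `(ξ̃, λ) ∈ ℝ^{d-1} × ℂ`. -/
structure IsKernelBasis (ubar : ℝ → Fin n → ℝ)
    (w : Fin n ⊕ Fin n → (Fin m → ℝ) → ℂ → ℝ → Fin n → ℂ) : Prop where
  solution : ∀ l ξt lam, P.IsEigensolution ubar ξt lam (w l ξt lam)
  linearIndependent : ∀ ξt lam, LinearIndependent ℂ (fun l => w l ξt lam)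
  analytic : ∀ l x, AnalyticOnNhd ℝ (fun p : (Fin m → ℝ) × ℂ => w l p.1 p.2 x) Set.univ
  analytic_deriv : ∀ l x,
    AnalyticOnNhd ℝ (fun p : (Fin m → ℝ) × ℂ => deriv (w l p.1 p.2) x) Set.univ

end System

/-- The periodic Evans function: the determinant of the `2n × 2n` matrix with columns
`w^l(X) - e^{iXξ₁} w^l(0)` over `(w^l)'(X) - e^{iXξ₁} (w^l)'(0)`, where `ξ = (ξ₁, ξ̃)`. -/
def evans {n m : ℕ} (w : Fin n ⊕ Fin n → (Fin m → ℝ) → ℂ → ℝ → Fin n → ℂ) (X : ℝ)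
    (ξ : Fin (m + 1) → ℝ) (lam : ℂ) : ℂ :=
  (Matrix.of fun r l : Fin n ⊕ Fin n => Sum.elim
    (fun a : Fin n => w l (Fin.tail ξ) lam X a -
      Complex.exp (Complex.I * X * ξ 0) * w l (Fin.tail ξ) lam 0 a)
    (fun a : Fin n => deriv (w l (Fin.tail ξ) lam) X a -
      Complex.exp (Complex.I * X * ξ 0) * deriv (w l (Fin.tail ξ) lam) 0 a)
    r).det

end PeriodicWave

end

noncomputable section

namespace PeriodicWave

open scoped unitInterval

section Volterra

section Extension

variable {E : Type*} [NormedAddCommGroup E]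

/-- The extension of a continuous function on `[0, 1]` to the real line, constant on both sides. -/
def extendI (v : C(I, E)) (τ : ℝ) : E := v (Set.projIcc 0 1 zero_le_one τ)

theorem continuous_extendI (v : C(I, E)) : Continuous (extendI v) :=
  v.continuous.comp continuous_projIcc

theorem extendI_of_mem (v : C(I, E)) {t : ℝ} (ht : t ∈ Set.Icc (0 : ℝ) 1) :
    extendI v t = v ⟨t, ht⟩ := by
  simp [extendI, Set.projIcc_of_mem _ ht]

theorem norm_extendI_le (v : C(I, E)) (τ : ℝ) : ‖extendI v τ‖ ≤ ‖v‖ := v.norm_coe_le_norm _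

end Extension

variable {E F : Type*} [NormedAddCommGroup E] [NormedSpace ℝ E]
  [NormedAddCommGroup F] [NormedSpace ℝ F]

/-- The operator `v ↦ ∫₀ᵗ v` on `C([0, 1], E)`. -/
def primitive : C(I, E) →L[ℝ] C(I, E) :=
  LinearMap.mkContinuous
    { toFun := fun v => ⟨fun t => ∫ τ in (0 : ℝ)..t, extendI v τ,
        (intervalIntegral.continuous_primitive
          (fun a b => (continuous_extendI v).intervalIntegrable a b) 0).comp continuous_subtype_val⟩
      map_add' := fun v w => by
        ext t
        exact intervalIntegral.integral_add ((continuous_extendI v).intervalIntegrable _ _)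
          ((continuous_extendI w).intervalIntegrable _ _)
      map_smul' := fun c v => by
        ext t
        exact intervalIntegral.integral_smul c _ } 1 (by
    intro v
    rw [ContinuousMap.norm_le _ (by positivity)]
    intro t
    refine (intervalIntegral.norm_integral_le_of_norm_le_const
      (fun τ _ => norm_extendI_le v τ)).trans ?_
    have h0 := t.2.1
    have h1 := t.2.2
    rw [sub_zero, abs_of_nonneg h0, one_mul]
    exact mul_le_of_le_one_right (norm_nonneg v) h1)

theorem primitive_apply (v : C(I, E)) (t : I) :
    primitive v t = ∫ τ in (0 : ℝ)..t, extendI v τ := rfl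

/-- Pointwise application of a continuous family of operators. -/
def mulOp : C(I, E →L[ℝ] F) →L[ℝ] C(I, E) →L[ℝ] C(I, F) :=
  LinearMap.mkContinuous₂
    (LinearMap.mk₂ ℝ (fun (A : C(I, E →L[ℝ] F)) (v : C(I, E)) =>
        (⟨fun t => A t (v t), A.continuous.clm_apply v.continuous⟩ : C(I, F)))
      (fun _ _ _ => by ext; simp) (fun _ _ _ => by ext; simp)
      (fun _ _ _ => by ext; simp) (fun _ _ _ => by ext; simp)) 1 (by
    intro A v
    rw [ContinuousMap.norm_le _ (by positivity)]
    intro t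
    rw [one_mul]
    exact (A t).le_of_opNorm_le_of_le (A.norm_coe_le_norm t) (v.norm_coe_le_norm t))

/-- The Volterra operator `v ↦ ∫₀ᵗ A v`. -/
def volterra (A : C(I, E →L[ℝ] E)) : C(I, E) →L[ℝ] C(I, E) := primitive ∘L mulOp A

theorem volterra_apply (A : C(I, E →L[ℝ] E)) (v : C(I, E)) (t : I) :
    volterra A v t = ∫ τ in (0 : ℝ)..t, extendI A τ (extendI v τ) := rfl

theorem norm_volterra_pow_apply_le (A : C(I, E →L[ℝ] E)) (v : C(I, E)) (k : ℕ) (t : I) :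
    ‖(volterra A ^ k) v t‖ ≤ (‖A‖ * t) ^ k / k.factorial * ‖v‖ := by
  induction k generalizing t with
  | zero => simpa using v.norm_coe_le_norm t
  | succ k ih =>
    rw [pow_succ', mul_apply_eq_comp, volterra_apply]
    have hb : ∀ τ ∈ Set.Ioc (0 : ℝ) t, ‖extendI A τ (extendI ((volterra A ^ k) v) τ)‖ ≤
        ‖A‖ ^ (k + 1) / k.factorial * ‖v‖ * τ ^ k := by
      intro τ hτ
      have hmem : τ ∈ Set.Icc (0 : ℝ) 1 := ⟨hτ.1.le, hτ.2.trans t.2.2⟩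
      refine ((extendI A τ).le_of_opNorm_le_of_le (norm_extendI_le A τ)
        (b := (‖A‖ * τ) ^ k / k.factorial * ‖v‖) ?_).trans (le_of_eq ?_)
      · rw [extendI_of_mem _ hmem]
        exact ih _
      · rw [mul_pow]; ring
    refine (intervalIntegral.norm_integral_le_of_norm_le t.2.1 (MeasureTheory.ae_of_all _ hb)
      ((continuous_const.mul (continuous_pow k)).intervalIntegrable _ _)).trans (le_of_eq ?_)
    rw [intervalIntegral.integral_const_mul, integral_pow]
    rw [Nat.factorial_succ, mul_pow]
    have : (k.factorial : ℝ) ≠ 0 := by positivity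
    push_cast
    field_simp
    rw [zero_pow (Nat.succ_ne_zero k), sub_zero]

theorem isUnit_one_sub_volterra [CompleteSpace E] (A : C(I, E →L[ℝ] E)) :
    IsUnit (1 - volterra A) := by
  obtain ⟨k, hk⟩ := ((FloorSemiring.tendsto_pow_div_factorial_atTop ‖A‖).eventually
    (gt_mem_nhds (zero_lt_one (α := ℝ)))).exists
  have hnorm : ‖volterra A ^ k‖ < 1 := by
    refine lt_of_le_of_lt (ContinuousLinearMap.opNorm_le_bound _ (by positivity) fun v => ?_) hk
    rw [ContinuousMap.norm_le _ (by positivity)]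
    intro t
    refine (norm_volterra_pow_apply_le A v k t).trans ?_
    gcongr
    · exact mul_nonneg (norm_nonneg A) t.2.1
    · exact mul_le_of_le_one_right (norm_nonneg A) t.2.2
  have hu : IsUnit (1 - volterra A ^ k) :=
    isUnit_one_sub_of_norm_lt_one (R := C(I, E) →L[ℝ] C(I, E)) hnorm
  have h1 := mul_neg_geom_sum (volterra A) k
  have h2 := geom_sum_mul_neg (volterra A) k
  have hl : IsUnit ((1 - volterra A) * ∑ i ∈ Finset.range k, volterra A ^ i) := by
    rw [h1]; exact hu
  have hcomm : Commute (1 - volterra A) (∑ i ∈ Finset.range k, volterra A ^ i) := by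
    rw [Commute, SemiconjBy, h1, h2]
  exact (hcomm.isUnit_mul_iff.1 hl).1

/-- The constant functions, as an operator. -/
def constOp : E →L[ℝ] C(I, E) :=
  LinearMap.mkContinuous
    { toFun := fun a => ContinuousMap.const I a
      map_add' := fun _ _ => by ext; simp
      map_smul' := fun _ _ => by ext; simp } 1 (by
    intro a
    rw [ContinuousMap.norm_le _ (by positivity)]
    intro t
    simp)

theorem constOp_apply (a : E) (t : I) : constOp a t = a := rfl

/-- The solution of `v = a + ∫₀ᵗ A v`. -/
def volterraSol (A : C(I, E →L[ℝ] E)) (a : E) : C(I, E) :=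
  Ring.inverse (1 - volterra A) (constOp a)

theorem volterraSol_eq_iff [CompleteSpace E] (A : C(I, E →L[ℝ] E)) (a : E) (v : C(I, E)) :
    v = volterraSol A a ↔ v = constOp a + volterra A v := by
  have hu := isUnit_one_sub_volterra A
  constructor
  · rintro rfl
    have := congrArg (fun T : C(I, E) →L[ℝ] C(I, E) => T (constOp a))
      (Ring.mul_inverse_cancel _ hu)
    simp only [mul_apply_eq_comp, sub_apply,
      one_apply_eq_self, sub_eq_iff_eq_add] at this
    exact this
  · intro h
    have h' : (1 - volterra A) v = constOp a := by
      rw [sub_apply, one_apply_eq_self, sub_eq_iff_eq_add]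
      exact h
    rw [volterraSol, ← h', ← mul_apply_eq_comp, Ring.inverse_mul_cancel _ hu,
      one_apply_eq_self]

theorem analyticAt_volterraSol [CompleteSpace E] {Q : Type*} [NormedAddCommGroup Q]
    [NormedSpace ℝ Q] {A : Q → C(I, E →L[ℝ] E)} {p : Q} (hA : AnalyticAt ℝ A p) (a : E) :
    AnalyticAt ℝ (fun p => volterraSol (A p) a) p := by
  obtain ⟨u, hu⟩ := isUnit_one_sub_volterra (A p)
  have h1 : AnalyticAt ℝ (fun p => 1 - volterra (A p)) p := by
    let T : C(I, E →L[ℝ] E) →L[ℝ] C(I, E) →L[ℝ] C(I, E) :=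
      (ContinuousLinearMap.compL ℝ C(I, E) C(I, E) C(I, E) primitive).comp mulOp
    have hT : AnalyticAt ℝ T (A p) := by apply ContinuousLinearMap.analyticAt
    have : AnalyticAt ℝ (fun p => volterra (A p)) p := hT.comp hA
    exact analyticAt_const.sub this
  have h2 : AnalyticAt ℝ (Ring.inverse : (C(I, E) →L[ℝ] C(I, E)) → _) (1 - volterra (A p)) := by
    rw [← hu]
    exact analyticAt_inverse (𝕜 := ℝ) (A := C(I, E) →L[ℝ] C(I, E)) u
  have h3 := h2.comp (f := fun p => 1 - volterra (A p)) h1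
  exact ((ContinuousLinearMap.apply ℝ C(I, E) (constOp a)).analyticAt _).comp h3

/-- The rescaling `t ↦ x A(x t)` of a family of operators from `[0, x]` to `[0, 1]`. -/
def rescale (A : ℝ → E →L[ℝ] E) (hA : Continuous A) (x : ℝ) : C(I, E →L[ℝ] E) :=
  ⟨fun t => x • A (x * t), by fun_prop⟩

/-- The solution of `y' = A y`, `y 0 = a`. -/
def linearFlow (A : ℝ → E →L[ℝ] E) (hA : Continuous A) (a : E) (x : ℝ) : E :=
  volterraSol (rescale A hA x) a 1

theorem continuous_volterraSol [CompleteSpace E] (a : E) :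
    Continuous (fun A : C(I, E →L[ℝ] E) => volterraSol A a) :=
  continuous_iff_continuousAt.2 fun _ =>
    (analyticAt_volterraSol (A := fun A => A) analyticAt_id a).continuousAt

theorem continuous_linearFlow [CompleteSpace E] (A : ℝ → E →L[ℝ] E) (hA : Continuous A) (a : E) :
    Continuous (linearFlow A hA a) := by
  have h1 : Continuous (rescale A hA) :=
    ContinuousMap.continuous_of_continuous_uncurry _ (by
      simp only [Function.uncurry_def, rescale, ContinuousMap.coe_mk]
      fun_prop)
  exact (continuous_eval_const (1 : I)).comp ((continuous_volterraSol a).comp h1)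

theorem linearFlow_mul [CompleteSpace E] (A : ℝ → E →L[ℝ] E) (hA : Continuous A) (a : E) (x : ℝ)
    (t : I) : linearFlow A hA a (x * t) = volterraSol (rescale A hA x) a t := by
  set v := volterraSol (rescale A hA x) a with hv
  have hveq := (volterraSol_eq_iff (rescale A hA x) a v).1 hv
  let R : C(I, E) := ⟨fun t' => v (t * t'), by fun_prop⟩
  have hR : R = volterraSol (rescale A hA (x * t)) a := by
    rw [volterraSol_eq_iff]
    ext t'
    change v (t * t') = a + volterra _ R t'
    have hv' : v (t * t') = a + volterra (rescale A hA x) v (t * t') :=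
      congrArg (fun r : C(I, E) => r (t * t')) hveq
    rw [hv', volterra_apply, volterra_apply]
    congr 1
    have hsub : ∫ τ in (0 : ℝ)..t', (t : ℝ) • (extendI (rescale A hA x) (t * τ)
        (extendI v (t * τ))) = ∫ τ in (0 : ℝ)..((t * t' : I) : ℝ),
          extendI (rescale A hA x) τ (extendI v τ) := by
      rw [intervalIntegral.integral_smul,
        intervalIntegral.smul_integral_comp_mul_left
          (fun τ => extendI (rescale A hA x) τ (extendI v τ))]
      simp
    rw [← hsub]
    refine intervalIntegral.integral_congr fun τ hτ => ?_
    rw [Set.uIcc_of_le t'.2.1] at hτ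
    have hτ' : τ ∈ Set.Icc (0 : ℝ) 1 := ⟨hτ.1, hτ.2.trans t'.2.2⟩
    have hmem : (t : ℝ) * τ ∈ Set.Icc (0 : ℝ) 1 := (t * ⟨τ, hτ'⟩ : I).2
    simp only [extendI_of_mem _ hτ', extendI_of_mem _ hmem]
    simp only [rescale, ContinuousMap.coe_mk, smul_apply, smul_smul, R]
    rw [mul_comm x (t : ℝ), mul_assoc, mul_left_comm x (t : ℝ) τ]
    rfl
  have := congrArg (fun r : C(I, E) => r 1) hR
  simp only [R, ContinuousMap.coe_mk, mul_one] at this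
  rw [this, linearFlow]

theorem linearFlow_eq_integral [CompleteSpace E] (A : ℝ → E →L[ℝ] E) (hA : Continuous A) (a : E)
    (x : ℝ) : linearFlow A hA a x = a + ∫ τ in (0 : ℝ)..x, A τ (linearFlow A hA a τ) := by
  set v := volterraSol (rescale A hA x) a with hv
  have hveq := (volterraSol_eq_iff (rescale A hA x) a v).1 hv
  have h1 : linearFlow A hA a x = v 1 := rfl
  rw [h1, hveq, ContinuousMap.add_apply, constOp_apply, volterra_apply]
  congr 1
  have hsub := intervalIntegral.smul_integral_comp_mul_left (a := (0 : ℝ)) (b := 1)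
    (fun τ => A τ (linearFlow A hA a τ)) x
  rw [mul_zero, mul_one] at hsub
  rw [← hsub, ← intervalIntegral.integral_smul]
  refine intervalIntegral.integral_congr fun τ hτ => ?_
  simp only [Set.Icc.coe_one, Set.uIcc_of_le zero_le_one] at hτ
  simp only [extendI_of_mem _ hτ]
  have := linearFlow_mul A hA a x ⟨τ, hτ⟩
  simp only at this
  rw [this]
  simp [rescale, v]

theorem linearFlow_zero [CompleteSpace E] (A : ℝ → E →L[ℝ] E) (hA : Continuous A) (a : E) :
    linearFlow A hA a 0 = a := by
  rw [linearFlow_eq_integral]; simp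

theorem hasDerivAt_linearFlow [CompleteSpace E] (A : ℝ → E →L[ℝ] E) (hA : Continuous A) (a : E)
    (x : ℝ) : HasDerivAt (linearFlow A hA a) (A x (linearFlow A hA a x)) x := by
  have hc : Continuous fun τ => A τ (linearFlow A hA a τ) :=
    hA.clm_apply (continuous_linearFlow A hA a)
  have := (intervalIntegral.integral_hasDerivAt_right (hc.intervalIntegrable 0 x)
    hc.aestronglyMeasurable.stronglyMeasurableAtFilter hc.continuousAt).const_add a
  exact this.congr_of_eventuallyEq (Eventually.of_forall (linearFlow_eq_integral A hA a))

theorem analyticAt_linearFlow [CompleteSpace E] {Q : Type*} [NormedAddCommGroup Q]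
    [NormedSpace ℝ Q] (A : Q → ℝ → E →L[ℝ] E) (hA : ∀ p, Continuous (A p)) (a : E) (x : ℝ) (p : Q)
    (h : AnalyticAt ℝ (fun p => rescale (A p) (hA p) x) p) :
    AnalyticAt ℝ (fun p => linearFlow (A p) (hA p) a x) p := by
  let ev : C(I, E) →L[ℝ] E := ContinuousMap.evalCLM ℝ 1
  exact (ev.analyticAt _).comp (analyticAt_volterraSol h a)

/-- Solutions of linear equations are unique. -/
theorem eq_linearFlow [CompleteSpace E] (A : ℝ → E →L[ℝ] E) (hA : Continuous A) {y : ℝ → E}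
    (hy : ∀ x, HasDerivAt y (A x (y x)) x) (x : ℝ) : y x = linearFlow A hA (y 0) x := by
  have hyc : Continuous y := continuous_iff_continuousAt.2 fun x => (hy x).continuousAt
  let R : C(I, E) := ⟨fun t => y (x * t), by fun_prop⟩
  have hR : R = volterraSol (rescale A hA x) (y 0) := by
    rw [volterraSol_eq_iff]
    ext t
    change y (x * t) = y 0 + volterra _ R t
    rw [volterra_apply, ← sub_eq_iff_eq_add']
    have hd : ∀ s ∈ Set.uIcc (0 : ℝ) t,
        HasDerivAt (fun s : ℝ => y (x * s)) (x • A (x * s) (y (x * s))) s := by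
      intro s _
      have h := (hy (x * s)).scomp s ((hasDerivAt_id s).const_mul x)
      rw [mul_one] at h
      exact h
    have hftc := intervalIntegral.integral_eq_sub_of_hasDerivAt hd
      (Continuous.intervalIntegrable (by fun_prop) _ _)
    rw [mul_zero] at hftc
    rw [← hftc]
    refine intervalIntegral.integral_congr fun s hs => ?_
    rw [Set.uIcc_of_le t.2.1] at hs
    have hs' : s ∈ Set.Icc (0 : ℝ) 1 := ⟨hs.1, hs.2.trans t.2.2⟩
    simp only [extendI_of_mem _ hs']
    rfl
  have := congrArg (fun r : C(I, E) => r 1) hR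
  simpa [R, linearFlow] using this

end Volterra

section SmoothDependence

section Superposition

variable {E F : Type*} [NormedAddCommGroup E] [NormedAddCommGroup F]

/-- The superposition operator `v ↦ G ∘ v` on `C([0, 1], E)`. -/
def superposition (G : E → F) (hG : Continuous G) (v : C(I, E)) : C(I, F) :=
  (⟨G, hG⟩ : C(E, F)).comp v

theorem continuous_superposition (G : E → F) (hG : Continuous G) :
    Continuous (superposition G hG) :=
  ContinuousMap.continuous_postcomp _

end Superposition

variable {E F Λ : Type*} [NormedAddCommGroup E] [NormedSpace ℝ E]
  [NormedAddCommGroup F] [NormedSpace ℝ F] [NormedAddCommGroup Λ] [NormedSpace ℝ Λ]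

theorem hasFDerivAt_superposition (G : E → F) (hG : ContDiff ℝ 1 G) (v : C(I, E)) :
    HasFDerivAt (superposition G hG.continuous)
      (mulOp (superposition (fderiv ℝ G) (hG.continuous_fderiv one_ne_zero) v)) v := by
  have hc := continuous_superposition _ (hG.continuous_fderiv one_ne_zero)
  rw [hasFDerivAt_iff_isLittleO, Asymptotics.isLittleO_iff]
  intro ε hε
  obtain ⟨δ, hδ, hball⟩ := Metric.continuous_iff.1 hc v ε hε
  filter_upwards [Metric.ball_mem_nhds v hδ] with w hw
  rw [ContinuousMap.norm_le _ (by positivity)]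
  intro t
  have key : ∀ z ∈ segment ℝ (v t) (w t),
      ‖fderiv ℝ G z - fderiv ℝ G (v t)‖ ≤ ε := by
    rintro z ⟨a, b, ha, hb, hab, rfl⟩
    have hmem : a • v + b • w ∈ Metric.ball v δ :=
      convex_ball v δ (Metric.mem_ball_self hδ) hw ha hb hab
    have h1 := hball _ hmem
    rw [dist_eq_norm] at h1
    exact (ContinuousMap.norm_coe_le_norm
      (superposition (fderiv ℝ G) (hG.continuous_fderiv one_ne_zero) (a • v + b • w) -
        superposition (fderiv ℝ G) (hG.continuous_fderiv one_ne_zero) v) t).trans h1.le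
  have h2 := (convex_segment (𝕜 := ℝ) (v t) (w t)).norm_image_sub_le_of_norm_fderiv_le'
    (f := G) (φ := fderiv ℝ G (v t)) (𝕜 := ℝ)
    (fun z _ => (hG.differentiable one_ne_zero) z) key (left_mem_segment ℝ _ _)
    (right_mem_segment ℝ _ _)
  refine h2.trans ?_
  gcongr
  exact ContinuousMap.norm_coe_le_norm (w - v) t

theorem contDiff_superposition (G : E → F) (hG : ContDiff ℝ 1 G) :
    ContDiff ℝ 1 (superposition G hG.continuous) := by
  have hd := hasFDerivAt_superposition G hG
  refine contDiff_one_iff_hasFDerivAt.2 ⟨_, ?_, hd⟩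
  exact (mulOp : C(I, E →L[ℝ] F) →L[ℝ] C(I, E) →L[ℝ] C(I, F)).continuous.comp
    (continuous_superposition _ (hG.continuous_fderiv one_ne_zero))

/-- Pairing of a continuous function with a constant. -/
def pairConst : C(I, E) × Λ →L[ℝ] C(I, E × Λ) :=
  LinearMap.mkContinuous
    { toFun := fun p => ⟨fun t => (p.1 t, p.2), by fun_prop⟩
      map_add' := fun _ _ => by ext <;> simp
      map_smul' := fun _ _ => by ext <;> simp } 1 (by
    intro p
    rw [ContinuousMap.norm_le _ (by positivity)]
    intro t
    rw [one_mul]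
    exact max_le ((p.1.norm_coe_le_norm t).trans (le_max_left _ _)) (le_max_right _ _))

/-- The superposition operator `(v, l) ↦ G(v(·), l)`. -/
def paramSuperposition (G : E × Λ → F) (hG : Continuous G) (p : C(I, E) × Λ) : C(I, F) :=
  superposition G hG (pairConst p)

theorem contDiff_paramSuperposition (G : E × Λ → F) (hG : ContDiff ℝ 1 G) :
    ContDiff ℝ 1 (paramSuperposition G hG.continuous) :=
  (contDiff_superposition G hG).comp (ContinuousLinearMap.contDiff _)

theorem hasFDerivAt_paramSuperposition (G : E × Λ → F) (hG : ContDiff ℝ 1 G)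
    (p : C(I, E) × Λ) :
    HasFDerivAt (paramSuperposition G hG.continuous)
      ((mulOp (superposition (fderiv ℝ G) (hG.continuous_fderiv one_ne_zero) (pairConst p))).comp
        pairConst) p :=
  (hasFDerivAt_superposition G hG (pairConst p)).comp p (ContinuousLinearMap.hasFDerivAt _)

/-- The derivative of `G` in its first variable along `v`. -/
def partialFst (G : E × Λ → F) (hG : ContDiff ℝ 1 G) (v : C(I, E)) (l : Λ) : C(I, E →L[ℝ] F) :=
  ⟨fun t => (fderiv ℝ G (v t, l)).comp (ContinuousLinearMap.inl ℝ E Λ), by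
    have := hG.continuous_fderiv one_ne_zero
    fun_prop⟩

/-- `C¹` dependence on the data of the solution of `v(t) = a + ∫₀ᵗ G(v, l)`. -/
theorem exists_contDiffAt_solution [CompleteSpace E] [CompleteSpace Λ]
    (G : E × Λ → E) (hG : ContDiff ℝ 1 G) (a₀ : E) (l₀ : Λ) (v₀ : C(I, E))
    (hv₀ : v₀ = constOp a₀ + primitive (paramSuperposition G hG.continuous (v₀, l₀))) :
    ∃ V : E × Λ → C(I, E), ContDiffAt ℝ 1 V (a₀, l₀) ∧ V (a₀, l₀) = v₀ ∧
      ∀ᶠ p in 𝓝 (a₀, l₀),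
        V p = constOp p.1 + primitive (paramSuperposition G hG.continuous (V p, p.2)) := by
  let N : (E × Λ) × C(I, E) → C(I, E) := fun q =>
    q.2 - constOp q.1.1 - primitive (paramSuperposition G hG.continuous (q.2, q.1.2))
  let Θ : (E × Λ) × C(I, E) → (E × Λ) × C(I, E) := fun q => (q.1, N q)
  have hΘ : ContDiff ℝ 1 Θ := by
    have h1 : ContDiff ℝ 1 fun q : (E × Λ) × C(I, E) =>
        paramSuperposition G hG.continuous (q.2, q.1.2) :=
      (contDiff_paramSuperposition G hG).comp (by fun_prop)
    have h2 : ContDiff ℝ 1 fun q : (E × Λ) × C(I, E) =>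
        primitive (paramSuperposition G hG.continuous (q.2, q.1.2)) :=
      (primitive (E := E)).contDiff.comp h1
    have h3 : ContDiff ℝ 1 fun q : (E × Λ) × C(I, E) => (constOp q.1.1 : C(I, E)) :=
      (constOp (E := E)).contDiff.comp (contDiff_fst.comp contDiff_fst)
    exact contDiff_fst.prodMk ((contDiff_snd.sub h3).sub h2)
  let S := mulOp (superposition (fderiv ℝ G) (hG.continuous_fderiv one_ne_zero)
    (pairConst (v₀, l₀)))
  let L : (E × Λ) →L[ℝ] C(I, E) :=
    -(constOp.comp (ContinuousLinearMap.fst ℝ E Λ)) -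
      primitive.comp (S.comp (pairConst.comp
        ((0 : (E × Λ) →L[ℝ] C(I, E)).prod (ContinuousLinearMap.snd ℝ E Λ))))
  obtain ⟨u, hu⟩ := isUnit_one_sub_volterra (partialFst G hG v₀ l₀)
  let e : C(I, E) ≃L[ℝ] C(I, E) := ContinuousLinearEquiv.ofUnit u
  let e' : ((E × Λ) × C(I, E)) ≃L[ℝ] (E × Λ) × C(I, E) :=
    (ContinuousLinearEquiv.refl ℝ (E × Λ)).skewProd e L
  have hΘ' : HasFDerivAt Θ (e' : ((E × Λ) × C(I, E)) →L[ℝ] (E × Λ) × C(I, E)) ((a₀, l₀), v₀) := by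
    have h1 : HasFDerivAt (fun q : (E × Λ) × C(I, E) =>
        paramSuperposition G hG.continuous (q.2, q.1.2))
        ((S.comp pairConst).comp ((ContinuousLinearMap.snd ℝ (E × Λ) C(I, E)).prod
          ((ContinuousLinearMap.snd ℝ E Λ).comp (ContinuousLinearMap.fst ℝ (E × Λ) C(I, E)))))
        ((a₀, l₀), v₀) :=
      HasFDerivAt.comp (f := fun q : (E × Λ) × C(I, E) => (q.2, q.1.2)) ((a₀, l₀), v₀)
        (hasFDerivAt_paramSuperposition G hG (v₀, l₀))
        (ContinuousLinearMap.hasFDerivAt ((ContinuousLinearMap.snd ℝ (E × Λ) C(I, E)).prod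
          ((ContinuousLinearMap.snd ℝ E Λ).comp (ContinuousLinearMap.fst ℝ (E × Λ) C(I, E)))))
    have h2 := ((ContinuousLinearMap.hasFDerivAt primitive).comp ((a₀, l₀), v₀) h1)
    have h3 : HasFDerivAt (fun q : (E × Λ) × C(I, E) => (constOp q.1.1 : C(I, E)))
        (constOp.comp ((ContinuousLinearMap.fst ℝ E Λ).comp
          (ContinuousLinearMap.fst ℝ (E × Λ) C(I, E)))) ((a₀, l₀), v₀) :=
      ContinuousLinearMap.hasFDerivAt (constOp.comp ((ContinuousLinearMap.fst ℝ E Λ).comp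
          (ContinuousLinearMap.fst ℝ (E × Λ) C(I, E))))
    have h4 := hasFDerivAt_fst (𝕜 := ℝ) (p := ((a₀, l₀), v₀)) |>.prodMk
      (((hasFDerivAt_snd (𝕜 := ℝ) (p := ((a₀, l₀), v₀))).sub h3).sub h2)
    refine h4.congr_fderiv ?_
    refine ContinuousLinearMap.ext fun q => ?_
    obtain ⟨⟨a, l⟩, v⟩ := q
    refine Prod.ext rfl ?_
    have hue : e v = v - volterra (partialFst G hG v₀ l₀) v := by
      have : e v = (u : C(I, E) →L[ℝ] C(I, E)) v := rfl
      rw [this, hu]; rfl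
    change v - constOp a - primitive (S (pairConst (v, l))) = e v + L (a, l)
    rw [hue]
    have hL : L (a, l) = -constOp a - primitive (S (pairConst (0, l))) := rfl
    have hV : volterra (partialFst G hG v₀ l₀) v = primitive (S (pairConst (v, 0))) := rfl
    have hsum : (pairConst (v, l) : C(I, E × Λ)) = pairConst (v, 0) + pairConst (0, l) := by
      rw [← map_add]; simp
    rw [hL, hV, hsum, map_add, map_add]
    abel
  have hbase : Θ ((a₀, l₀), v₀) = ((a₀, l₀), 0) := by
    refine Prod.ext rfl ?_
    change v₀ - constOp a₀ - primitive (paramSuperposition G hG.continuous (v₀, l₀)) = 0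
    rw [sub_sub, sub_eq_zero]
    exact hv₀
  let Φ := hΘ.contDiffAt.toOpenPartialHomeomorph Θ hΘ' one_ne_zero
  have hsrc : ((a₀, l₀), v₀) ∈ Φ.source :=
    hΘ.contDiffAt.mem_toOpenPartialHomeomorph_source hΘ' one_ne_zero
  have hinv : ContDiffAt ℝ 1 Φ.symm (Θ ((a₀, l₀), v₀)) :=
    hΘ.contDiffAt.to_localInverse hΘ' one_ne_zero
  have hsymm : Φ.symm ((a₀, l₀), 0) = ((a₀, l₀), v₀) := by
    rw [← hbase]; exact Φ.left_inv hsrc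
  refine ⟨fun p => (Φ.symm (p, 0)).2, ?_, ?_, ?_⟩
  · rw [hbase] at hinv
    have : ContDiffAt ℝ 1 (fun p : E × Λ => Φ.symm (p, 0)) (a₀, l₀) :=
      ContDiffAt.comp (a₀, l₀) (f := fun p : E × Λ => (p, (0 : C(I, E)))) hinv (by fun_prop)
    exact contDiffAt_snd.comp _ this
  · simp only [hsymm]
  · have htgt : ∀ᶠ q in 𝓝 ((a₀, l₀), (0 : C(I, E))), q ∈ Φ.target := by
      rw [← hbase]
      exact Φ.open_target.mem_nhds (Φ.map_source hsrc)
    have hcont : ContinuousAt (fun p : E × Λ => (p, (0 : C(I, E)))) (a₀, l₀) := by fun_prop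
    filter_upwards [hcont.eventually htgt] with p hp
    have h1 : Θ (Φ.symm (p, 0)) = (p, 0) := Φ.right_inv hp
    have h2 : (Φ.symm (p, 0)).1 = p := congrArg Prod.fst h1
    have h3 : N (Φ.symm (p, 0)) = 0 := congrArg Prod.snd h1
    simp only [N, h2] at h3
    rw [sub_sub, sub_eq_zero] at h3
    exact h3

end SmoothDependence

section MatrixRegularity

variable {V : Type*} [NormedAddCommGroup V] [NormedSpace ℝ V] {ι : Type*} [Fintype ι]
  {k : WithTop ℕ∞} {s : Set V}

theorem contDiffOn_mulVec {𝕂 : Type*} [NormedField 𝕂] [NormedAlgebra ℝ 𝕂] {κ : Type*} [Fintype κ]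
    {A : V → Matrix κ ι 𝕂} {b : V → ι → 𝕂}
    (hA : ∀ i j, ContDiffOn ℝ k (fun x => A x i j) s) (hb : ContDiffOn ℝ k b s) :
    ContDiffOn ℝ k (fun x => A x *ᵥ b x) s := by
  refine contDiffOn_pi.2 fun i => ?_
  simp only [Matrix.mulVec, dotProduct]
  exact ContDiffOn.sum fun j _ => (hA i j).mul (contDiffOn_pi.1 hb j)

variable [DecidableEq ι]

theorem contDiffOn_det {A : V → Matrix ι ι ℝ}
    (hA : ∀ i j, ContDiffOn ℝ k (fun x => A x i j) s) : ContDiffOn ℝ k (fun x => (A x).det) s := by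
  simp only [Matrix.det_apply]
  exact ContDiffOn.sum fun e _ => (contDiffOn_prod fun i _ => hA _ i).const_smul _

theorem contDiffOn_matrix_inv {A : V → Matrix ι ι ℝ}
    (hA : ∀ i j, ContDiffOn ℝ k (fun x => A x i j) s) (hdet : ∀ x ∈ s, (A x).det ≠ 0) (i j : ι) :
    ContDiffOn ℝ k (fun x => (A x)⁻¹ i j) s := by
  have h1 : ContDiffOn ℝ k (fun x => (A x).adjugate i j) s := by
    simp only [Matrix.adjugate_apply]
    refine contDiffOn_det fun a b => ?_
    simp only [Matrix.updateRow_apply]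
    split_ifs
    · exact contDiffOn_const
    · exact hA a b
  simp only [Matrix.inv_def, Ring.inverse_eq_inv', Matrix.smul_apply, smul_eq_mul]
  exact ((contDiffOn_det hA).inv hdet).mul h1

end MatrixRegularity

section Direction

variable {m : ℕ}

theorem one_add_sum_sq_pos (δ : Fin m → ℝ) : 0 < 1 + ∑ j, δ j ^ 2 := by positivity

theorem sum_sq_direction (δ : Fin m → ℝ) : ∑ j, direction δ j ^ 2 = 1 := by
  have h := one_add_sum_sq_pos δ
  simp only [direction, Pi.smul_apply, smul_eq_mul, mul_pow, inv_pow, Real.sq_sqrt h.le]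
  rw [← Finset.mul_sum, Fin.sum_univ_succ]
  simp only [Fin.cons_zero, Fin.cons_succ, one_pow]
  exact inv_mul_cancel₀ h.ne'

theorem direction_zero : direction (0 : Fin m → ℝ) = Pi.single 0 1 := by
  ext j
  refine Fin.cases ?_ (fun j => ?_) j <;> simp [direction]

theorem contDiff_direction {k : WithTop ℕ∞} : ContDiff ℝ k (direction : (Fin m → ℝ) → _) := by
  have h0 : ContDiff ℝ k fun δ : Fin m → ℝ => 1 + ∑ j, δ j ^ 2 := by fun_prop
  have h1 : ContDiff ℝ k fun δ : Fin m → ℝ => (Real.sqrt (1 + ∑ j, δ j ^ 2))⁻¹ :=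
    (h0.sqrt fun δ => (one_add_sum_sq_pos δ).ne').inv
      fun δ => (Real.sqrt_pos.2 (one_add_sum_sq_pos δ)).ne'
  refine contDiff_pi.2 fun j => ?_
  simp only [direction, Pi.smul_apply, smul_eq_mul]
  refine h1.mul ?_
  refine Fin.cases ?_ (fun j => ?_) j
  · simpa using contDiff_const
  · simpa using contDiff_apply ℝ ℝ j

theorem hasFDerivAt_direction_zero :
    HasFDerivAt (direction : (Fin m → ℝ) → _)
      (ContinuousLinearMap.pi (Fin.cons (0 : (Fin m → ℝ) →L[ℝ] ℝ)
        fun j => ContinuousLinearMap.proj j)) 0 := by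
  have h0 : HasFDerivAt (fun δ : Fin m → ℝ => 1 + ∑ j, δ j ^ 2) (0 : (Fin m → ℝ) →L[ℝ] ℝ) 0 := by
    have : HasFDerivAt (fun δ : Fin m → ℝ => ∑ j, δ j ^ 2) (0 : (Fin m → ℝ) →L[ℝ] ℝ) 0 := by
      have h := HasFDerivAt.fun_sum (u := Finset.univ) (x := (0 : Fin m → ℝ))
        fun j _ => (hasFDerivAt_apply (𝕜 := ℝ) j (0 : Fin m → ℝ)).pow 2
      refine h.congr_fderiv ?_
      simp
    exact this.const_add 1
  have h1 : HasFDerivAt (fun δ : Fin m → ℝ => (Real.sqrt (1 + ∑ j, δ j ^ 2))⁻¹)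
      (0 : (Fin m → ℝ) →L[ℝ] ℝ) 0 := by
    have hs := h0.sqrt (one_add_sum_sq_pos (0 : Fin m → ℝ)).ne'
    have hne : Real.sqrt (1 + ∑ j, (0 : Fin m → ℝ) j ^ 2) ≠ 0 := by simp
    have h := (hasDerivAt_inv hne).comp_hasFDerivAt (0 : Fin m → ℝ) hs
    refine h.congr_fderiv ?_
    simp
  refine hasFDerivAt_pi.2 fun j => ?_
  refine Fin.cases ?_ (fun j => ?_) j
  · simpa [direction] using h1
  · have h2 := h1.mul (hasFDerivAt_apply (𝕜 := ℝ) j (0 : Fin m → ℝ))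
    simp only [direction, Pi.smul_apply, smul_eq_mul, Fin.cons_succ]
    refine h2.congr_fderiv ?_
    ext; simp

end Direction

namespace System

variable {n m : ℕ} (P : System n m)

/-- The viscosity matrix `∑ ν_j ν_k B^{jk}(u)` in the direction of the parameter. -/
def viscosity (θ : Params n m) (u : Fin n → ℝ) : Matrix (Fin n) (Fin n) ℝ :=
  ∑ j, ∑ k, (normal θ j * normal θ k) • P.B j k u

/-- The right-hand side `∑ ν_j f^j(u) - s u - q` of the profile equation. -/
def netFlux (θ : Params n m) (u : Fin n → ℝ) : Fin n → ℝ :=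
  ∑ j, normal θ j • P.f j u - speed θ • u - constant θ

/-- The vector field of the profile equation solved for the derivative. -/
def field (p : (Fin n → ℝ) × Params n m) : Fin n → ℝ :=
  (P.viscosity p.2 p.1)⁻¹ *ᵥ P.netFlux p.2 p.1

variable {P}

theorem det_viscosity_ne_zero (h1 : P.H1) (θ : Params n m) {u : Fin n → ℝ} (hu : u ∈ P.U) :
    (P.viscosity θ u).det ≠ 0 := by
  obtain ⟨c, hc, h⟩ := h1
  intro hdet
  have hmem : (0 : ℂ) ∈ spectrum ℂ ((P.viscosity θ u).map Complex.ofReal) := by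
    rw [spectrum.zero_mem_iff, Matrix.isUnit_iff_isUnit_det]
    have : ((P.viscosity θ u).map Complex.ofReal).det = 0 := by
      have := (RingHom.map_det Complex.ofRealHom (P.viscosity θ u)).symm
      rw [hdet, map_zero] at this
      exact this
    rw [this]
    simp
  have := h u hu (normal θ) (sum_sq_direction _) 0 hmem
  simp at this
  linarith

theorem viscosity_mulVec_field (h1 : P.H1) (θ : Params n m) {u : Fin n → ℝ} (hu : u ∈ P.U) :
    P.viscosity θ u *ᵥ P.field (u, θ) = P.netFlux θ u := by
  rw [field, Matrix.mulVec_mulVec, Matrix.mul_nonsing_inv _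
    (isUnit_iff_ne_zero.2 (det_viscosity_ne_zero h1 θ hu)), Matrix.one_mulVec]

theorem eq_field_iff (h1 : P.H1) (θ : Params n m) {u w : Fin n → ℝ} (hu : u ∈ P.U) :
    P.viscosity θ u *ᵥ w = P.netFlux θ u ↔ w = P.field (u, θ) := by
  constructor
  · intro h
    rw [field, ← h, Matrix.mulVec_mulVec, Matrix.nonsing_inv_mul _
      (isUnit_iff_ne_zero.2 (det_viscosity_ne_zero h1 θ hu)), Matrix.one_mulVec]
  · rintro rfl
    exact viscosity_mulVec_field h1 θ hu

theorem contDiff_normal {k : WithTop ℕ∞} : ContDiff ℝ k (normal : Params n m → _) :=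
  contDiff_direction.comp (by fun_prop)

theorem contDiffOn_normal_apply {k : WithTop ℕ∞} (j : Fin (m + 1))
    {s : Set ((Fin n → ℝ) × Params n m)} :
    ContDiffOn ℝ k (fun p : (Fin n → ℝ) × Params n m => normal p.2 j) s :=
  ((contDiff_pi.1 contDiff_normal j).comp contDiff_snd).contDiffOn

theorem contDiffOn_field (h0 : P.H0) (h1 : P.H1) :
    ContDiffOn ℝ 2 P.field (P.U ×ˢ Set.univ) := by
  have hfst : Set.MapsTo Prod.fst (P.U ×ˢ (Set.univ : Set (Params n m))) P.U := fun p hp => hp.1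
  refine contDiffOn_mulVec (contDiffOn_matrix_inv (fun a b => ?_) fun p hp => ?_) ?_
  · simp only [viscosity, Matrix.sum_apply, Matrix.smul_apply, smul_eq_mul]
    exact ContDiffOn.sum fun j _ => ContDiffOn.sum fun k _ =>
      ((contDiffOn_normal_apply j).mul (contDiffOn_normal_apply k)).mul
        ((h0.2 j k a b).comp contDiffOn_fst hfst)
  · exact det_viscosity_ne_zero h1 p.2 hp.1
  · simp only [netFlux, speed, constant]
    refine (ContDiffOn.sub ?_ (by fun_prop)).sub (by fun_prop)
    exact ContDiffOn.sum fun j _ =>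
      (contDiffOn_normal_apply j).smul ((h0.1 j).comp contDiffOn_fst hfst)

theorem isProfileOn_iff (h1 : P.H1) (θ : Params n m) (v : ℝ → Fin n → ℝ) (S : Set ℝ) :
    P.IsProfileOn (speed θ) (normal θ) (constant θ) v S ↔
      ∀ y ∈ S, v y ∈ P.U ∧ HasDerivWithinAt v (P.field (v y, θ)) S y := by
  refine forall₂_congr fun y _ => and_congr_right fun hU => ?_
  constructor
  · rintro ⟨v', hv', h⟩
    rw [← (eq_field_iff h1 θ hU).1 h]
    exact hv'
  · intro h
    exact ⟨_, h, viscosity_mulVec_field h1 θ hU⟩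

theorem IsProfileOn.mono {s : ℝ} {ν : Fin (m + 1) → ℝ} {q : Fin n → ℝ} {v : ℝ → Fin n → ℝ}
    {S T : Set ℝ} (h : P.IsProfileOn s ν q v T) (hST : S ⊆ T) : P.IsProfileOn s ν q v S := by
  intro y hy
  obtain ⟨hU, v', hv', heq⟩ := h y (hST hy)
  exact ⟨hU, v', hv'.mono hST, heq⟩

theorem contDiffAt_field (h0 : P.H0) (h1 : P.H1) (θ : Params n m) {u : Fin n → ℝ}
    (hu : u ∈ P.U) : ContDiffAt ℝ 2 P.field (u, θ) :=
  (contDiffOn_field h0 h1).contDiffAt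
    ((P.isOpen_U.prod isOpen_univ).mem_nhds ⟨hu, Set.mem_univ _⟩)

theorem exists_lipschitzOnWith_field (h0 : P.H0) (h1 : P.H1) (θ : Params n m)
    {K : Set (Fin n → ℝ)} (hK : IsCompact K) (hKU : K ⊆ P.U) :
    ∃ C, LipschitzOnWith C (fun u => P.field (u, θ)) K := by
  refine LocallyLipschitzOn.exists_lipschitzOnWith_of_compact hK fun u hu => ?_
  have h : ContDiffAt ℝ 1 (fun u => P.field (u, θ)) u :=
    ContDiffAt.comp u (f := fun u => (u, θ))
      ((contDiffAt_field h0 h1 θ (hKU hu)).of_le one_le_two) (by fun_prop)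
  obtain ⟨C, t, ht, hL⟩ := h.exists_lipschitzOnWith
  exact ⟨C, t, mem_nhdsWithin_of_mem_nhds ht, hL⟩

/-- Uniqueness for the profile equation on an interval `[0, y]`. -/
theorem eqOn_of_isProfileOn (h0 : P.H0) (h1 : P.H1) (θ : Params n m) {v w : ℝ → Fin n → ℝ} {y : ℝ}
    (hv : P.IsProfileOn (speed θ) (normal θ) (constant θ) v (Set.Icc 0 y))
    (hw : P.IsProfileOn (speed θ) (normal θ) (constant θ) w (Set.Icc 0 y)) (h : v 0 = w 0) :
    Set.EqOn v w (Set.Icc 0 y) := by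
  rw [isProfileOn_iff h1] at hv hw
  have hvc : ContinuousOn v (Set.Icc 0 y) := fun x hx => (hv x hx).2.continuousWithinAt
  have hwc : ContinuousOn w (Set.Icc 0 y) := fun x hx => (hw x hx).2.continuousWithinAt
  have hK : IsCompact (v '' Set.Icc 0 y ∪ w '' Set.Icc 0 y) :=
    (isCompact_Icc.image_of_continuousOn hvc).union (isCompact_Icc.image_of_continuousOn hwc)
  obtain ⟨C, hC⟩ := exists_lipschitzOnWith_field h0 h1 θ hK (by
    rintro _ (⟨x, hx, rfl⟩ | ⟨x, hx, rfl⟩)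
    · exact (hv x hx).1
    · exact (hw x hx).1)
  have aux : ∀ {g : ℝ → Fin n → ℝ} {g' : Fin n → ℝ}, ∀ x ∈ Set.Ico 0 y,
      HasDerivWithinAt g g' (Set.Icc 0 y) x → HasDerivWithinAt g g' (Set.Ici x) x := by
    intro g g' x hx hg
    exact hg.mono_of_mem_nhdsWithin (mem_of_superset (Icc_mem_nhdsGE hx.2)
      (Set.Icc_subset_Icc_left hx.1))
  exact ODE_solution_unique_of_mem_Icc_right (v := fun _ u => P.field (u, θ))
    (s := fun _ => v '' Set.Icc 0 y ∪ w '' Set.Icc 0 y) (fun _ _ => hC) hvc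
    (fun x hx => aux x hx (hv x (Set.Ico_subset_Icc_self hx)).2)
    (fun x hx => Or.inl ⟨x, Set.Ico_subset_Icc_self hx, rfl⟩) hwc
    (fun x hx => aux x hx (hw x (Set.Ico_subset_Icc_self hx)).2)
    (fun x hx => Or.inr ⟨x, Set.Ico_subset_Icc_self hx, rfl⟩) h

/-- The profile is computed by any solution. -/
theorem profile_eq (h0 : P.H0) (h1 : P.H1) {θ : Params n m} {v : ℝ → Fin n → ℝ} {y : ℝ}
    (hy : 0 ≤ y) (hv : P.IsProfileOn (speed θ) (normal θ) (constant θ) v (Set.Icc 0 y))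
    (hstart : v 0 = start θ) : P.profile θ y = v y := by
  have hex : ∃ v : ℝ → Fin n → ℝ, v 0 = start θ ∧
      P.IsProfileOn (speed θ) (normal θ) (constant θ) v (Set.uIcc 0 y) :=
    ⟨v, hstart, by rwa [Set.uIcc_of_le hy]⟩
  rw [profile, dif_pos hex]
  have hs := hex.choose_spec
  exact eqOn_of_isProfileOn h0 h1 θ (hs.2.mono Set.Icc_subset_uIcc) hv (hs.1.trans hstart.symm)
    ⟨hy, le_rfl⟩

end System

section Cutoff

variable {E : Type*} [NormedAddCommGroup E] [NormedSpace ℝ E]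

open scoped Manifold ContDiff in
theorem exists_cutoff [FiniteDimensional ℝ E] {K U : Set E} (hK : IsCompact K) (hU : IsOpen U)
    (hKU : K ⊆ U) :
    ∃ χ : E → ℝ, ContDiff ℝ 1 χ ∧ (∀ᶠ u in 𝓝ˢ K, χ u = 1) ∧
      ∃ t, IsClosed t ∧ t ⊆ U ∧ ∀ u ∉ t, χ u = 0 := by
  have := FiniteDimensional.proper ℝ E
  obtain ⟨L, hL, hKL, hLU⟩ := exists_compact_between hK hU hKU
  obtain ⟨χ, h1, h2, -⟩ := exists_contMDiffMap_one_nhds_of_subset_interior 𝓘(ℝ, E) (n := 1)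
    hK.isClosed hKL
  exact ⟨χ, χ.contMDiff.contDiff, h1, L, hL.isClosed, hLU, h2⟩

theorem contDiff_cutoff_smul {Λ F : Type*} [NormedAddCommGroup Λ] [NormedSpace ℝ Λ]
    [NormedAddCommGroup F] [NormedSpace ℝ F] {χ : E → ℝ} (hχ : ContDiff ℝ 1 χ) {U t : Set E}
    (hU : IsOpen U) (ht : IsClosed t) (htU : t ⊆ U) (hχt : ∀ u ∉ t, χ u = 0) {h : E × Λ → F}
    (hh : ContDiffOn ℝ 1 h (U ×ˢ Set.univ)) : ContDiff ℝ 1 fun p => χ p.1 • h p := by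
  rw [contDiff_iff_contDiffAt]
  intro p
  by_cases hp : p.1 ∈ U
  · exact (hχ.comp contDiff_fst).contDiffAt.smul
      (hh.contDiffAt ((hU.prod isOpen_univ).mem_nhds ⟨hp, Set.mem_univ _⟩))
  · have hopen : tᶜ ×ˢ (Set.univ : Set Λ) ∈ 𝓝 p :=
      (ht.isOpen_compl.prod isOpen_univ).mem_nhds ⟨fun hpt => hp (htU hpt), Set.mem_univ _⟩
    refine (contDiffAt_const (c := (0 : F))).congr_of_eventuallyEq ?_
    filter_upwards [hopen] with z hz
    rw [hχt _ hz.1, zero_smul]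

end Cutoff

section Base

variable {n m : ℕ} {ubar : ℝ → Fin n → ℝ} {X : ℝ} {q : Fin n → ℝ}

theorem speed_basePoint : speed (basePoint m ubar X q) = 0 := rfl

theorem normal_basePoint : normal (basePoint m ubar X q) = Pi.single 0 1 := direction_zero

namespace System

variable {P : System n m}

theorem IsPeriodicWave.mem_U (hw : P.IsPeriodicWave ubar X q) (y : ℝ) : ubar y ∈ P.U :=
  (hw.profile y (Set.mem_univ y)).1

theorem IsPeriodicWave.isProfileOn (hw : P.IsPeriodicWave ubar X q) :
    P.IsProfileOn (speed (basePoint m ubar X q)) (normal (basePoint m ubar X q))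
      (constant (basePoint m ubar X q)) ubar Set.univ := by
  rw [normal_basePoint]
  exact hw.profile

theorem IsPeriodicWave.hasDerivAt (hw : P.IsPeriodicWave ubar X q) (h1 : P.H1) (y : ℝ) :
    HasDerivAt ubar (P.field (ubar y, basePoint m ubar X q)) y :=
  hasDerivWithinAt_univ.1 (((isProfileOn_iff h1 _ _ _).1 hw.isProfileOn y (Set.mem_univ y)).2)

theorem IsPeriodicWave.continuous (hw : P.IsPeriodicWave ubar X q) (h1 : P.H1) :
    Continuous ubar :=
  continuous_iff_continuousAt.2 fun y => (hw.hasDerivAt h1 y).continuousAt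

theorem IsPeriodicWave.deriv_eq (hw : P.IsPeriodicWave ubar X q) (h1 : P.H1) (y : ℝ) :
    deriv ubar y = P.field (ubar y, basePoint m ubar X q) := (hw.hasDerivAt h1 y).deriv

theorem IsPeriodicWave.contDiff (hw : P.IsPeriodicWave ubar X q) (h0 : P.H0) (h1 : P.H1) :
    ContDiff ℝ 2 ubar := by
  have hd : Differentiable ℝ ubar := fun y => (hw.hasDerivAt h1 y).differentiableAt
  have hder : deriv ubar = fun y => P.field (ubar y, basePoint m ubar X q) :=
    funext fun y => hw.deriv_eq h1 y
  have hcomp : ∀ {k : WithTop ℕ∞}, k ≤ 2 → ContDiff ℝ k ubar →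
      ContDiff ℝ k (deriv ubar) := by
    intro k hk hu
    rw [hder, contDiff_iff_contDiffAt]
    intro y
    exact ContDiffAt.comp y (f := fun y => (ubar y, basePoint m ubar X q))
      ((contDiffAt_field h0 h1 _ (hw.mem_U y)).of_le hk) (hu.contDiffAt.prodMk contDiffAt_const)
  have h1' : ContDiff ℝ 1 ubar := by
    rw [contDiff_one_iff_deriv]
    exact ⟨hd, contDiff_zero.1 (hcomp zero_le_two (contDiff_zero.2 (hw.continuous h1)))⟩
  have h2' := contDiff_succ_iff_deriv (n := 1) (f := ubar).2
    ⟨hd, by simp, hcomp one_le_two h1'⟩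
  simpa [one_add_one_eq_two] using h2'

theorem IsPeriodicWave.isCompact_range (hw : P.IsPeriodicWave ubar X q) (h1 : P.H1) :
    IsCompact (Set.range ubar) := by
  rw [← hw.periodic.image_Icc hw.period_pos 0]
  exact isCompact_Icc.image (hw.continuous h1)

/-- A `C¹` family of solutions of the profile equation, rescaled to `[0, 1]`. -/
structure IsFlow (P : System n m) (ubar : ℝ → Fin n → ℝ) (X : ℝ) (q : Fin n → ℝ)
    (V : Params n m → C(I, Fin n → ℝ)) : Prop where
  contDiffAt : ContDiffAt ℝ 1 V (basePoint m ubar X q)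
  base : ∀ t : I, V (basePoint m ubar X q) t = ubar (X * t)
  period_pos : ∀ᶠ θ in 𝓝 (basePoint m ubar X q), 0 < period θ
  start_eq : ∀ᶠ θ in 𝓝 (basePoint m ubar X q), V θ 0 = start θ
  isProfileOn : ∀ᶠ θ in 𝓝 (basePoint m ubar X q),
    P.IsProfileOn (speed θ) (normal θ) (constant θ) (fun y => extendI (V θ) (y / period θ))
      (Set.Icc 0 (period θ))
  average : ∀ h : (Fin n → ℝ) × Params n m → Fin n → ℝ, ContDiffOn ℝ 1 h (P.U ×ˢ Set.univ) →
    ∃ L : Params n m →L[ℝ] (Fin n → ℝ),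
      HasFDerivAt (fun θ => ∫ τ in (0 : ℝ)..1, h (extendI (V θ) τ, θ)) L (basePoint m ubar X q) ∧
      ∀ η, L η = ∫ τ in (0 : ℝ)..1, fderiv ℝ h (ubar (X * τ), basePoint m ubar X q)
        (extendI (fderiv ℝ V (basePoint m ubar X q) η) τ, η)
  variation : ∀ η, ∀ t : I, fderiv ℝ V (basePoint m ubar X q) η t = start η +
    ∫ τ in (0 : ℝ)..t, fderiv ℝ (fun p : (Fin n → ℝ) × Params n m => period p.2 • P.field p)
      (ubar (X * τ), basePoint m ubar X q)
      (extendI (fderiv ℝ V (basePoint m ubar X q) η) τ, η)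

theorem exists_isFlow (hw : P.IsPeriodicWave ubar X q) (h0 : P.H0) (h1 : P.H1) :
    ∃ V, P.IsFlow ubar X q V := by
  set b := basePoint m ubar X q with hb
  have hXpos := hw.period_pos
  obtain ⟨χ, hχ, hχ1, t, ht, htU, hχ0⟩ := exists_cutoff (hw.isCompact_range h1) P.isOpen_U
    (Set.range_subset_iff.2 hw.mem_U)
  have cut : ∀ {h : (Fin n → ℝ) × Params n m → Fin n → ℝ},
      ContDiffOn ℝ 1 h (P.U ×ˢ Set.univ) → ContDiff ℝ 1 fun p => χ p.1 • h p :=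
    fun hh => contDiff_cutoff_smul hχ P.isOpen_U ht htU hχ0 hh
  have hg : ContDiffOn ℝ 1 (fun p : (Fin n → ℝ) × Params n m => period p.2 • P.field p)
      (P.U ×ˢ Set.univ) := by
    have hp : ContDiffOn ℝ 1 (fun p : (Fin n → ℝ) × Params n m => period p.2)
        (P.U ×ˢ Set.univ) := (contDiff_fst.comp contDiff_snd).contDiffOn
    exact hp.smul ((contDiffOn_field h0 h1).of_le one_le_two)
  have hG := cut hg
  let v₀ : C(I, Fin n → ℝ) := ⟨fun τ => ubar (X * τ), (hw.continuous h1).comp (by fun_prop)⟩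
  have hχu : ∀ y, χ (ubar y) = 1 := fun y =>
    (eventually_nhdsSet_iff_forall.1 hχ1 _ ⟨y, rfl⟩).self_of_nhds
  have hv₀ : v₀ = constOp (ubar 0) + primitive (paramSuperposition
      (fun p : (Fin n → ℝ) × Params n m => χ p.1 • period p.2 • P.field p)
      hG.continuous (v₀, b)) := by
    ext1 τ
    rw [ContinuousMap.add_apply, constOp_apply, primitive_apply, ← sub_eq_iff_eq_add']
    have hder : ∀ s ∈ Set.uIcc 0 (τ : ℝ), HasDerivAt (fun s : ℝ => ubar (X * s))
        (X • P.field (ubar (X * s), b)) s := by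
      intro s _
      have h := (hw.hasDerivAt h1 (X * s)).scomp s ((hasDerivAt_id s).const_mul X)
      rw [mul_one] at h
      exact h
    have hcont : Continuous fun s : ℝ => P.field (ubar (X * s), b) := by
      have : Continuous fun s : ℝ => deriv ubar (X * s) :=
        ((hw.contDiff h0 h1).continuous_deriv one_le_two).comp (by fun_prop)
      simpa only [hw.deriv_eq h1] using this
    have hftc := intervalIntegral.integral_eq_sub_of_hasDerivAt hder
      ((hcont.const_smul X).intervalIntegrable _ _)
    rw [mul_zero] at hftc
    change ubar (X * τ) - ubar 0 = _
    rw [← hftc]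
    refine intervalIntegral.integral_congr fun s hs => ?_
    rw [Set.uIcc_of_le τ.2.1] at hs
    have hs' : s ∈ Set.Icc (0 : ℝ) 1 := ⟨hs.1, hs.2.trans τ.2.2⟩
    simp only [extendI_of_mem _ hs']
    change _ = χ (ubar (X * s)) • X • P.field (ubar (X * s), b)
    rw [hχu, one_smul]
  obtain ⟨W, hW, hWb, hWeq⟩ := exists_contDiffAt_solution _ hG (ubar 0) b v₀ hv₀
  let V : Params n m → C(I, Fin n → ℝ) := fun θ => W (start θ, θ)
  have hpair : ContDiff ℝ 1 fun θ : Params n m => (start θ, θ) := by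
    unfold start; fun_prop
  have hV : ContDiffAt ℝ 1 V b := ContDiffAt.comp b (f := fun θ => (start θ, θ)) hW hpair.contDiffAt
  have hVb : V b = v₀ := hWb
  have hVeq : ∀ᶠ θ in 𝓝 b, V θ = constOp (start θ) + primitive (paramSuperposition
      (fun p : (Fin n → ℝ) × Params n m => χ p.1 • period p.2 • P.field p)
      hG.continuous (V θ, θ)) :=
    (hpair.continuous.continuousAt (x := b)).eventually hWeq
  have hnear : ∀ᶠ θ in 𝓝 b, ∀ τ : I, χ (V θ τ) = 1 ∧ V θ τ ∈ P.U := by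
    obtain ⟨O, hO, hrange, hOχ⟩ := mem_nhdsSet_iff_exists.1 hχ1
    have hopen : IsOpen {v : C(I, Fin n → ℝ) | Set.MapsTo v Set.univ (O ∩ P.U)} :=
      ContinuousMap.isOpen_setOfPred_mapsTo isCompact_univ (hO.inter P.isOpen_U)
    have hmem : V b ∈ {v : C(I, Fin n → ℝ) | Set.MapsTo v Set.univ (O ∩ P.U)} := by
      intro τ _
      rw [hVb]
      exact ⟨hrange ⟨_, rfl⟩, hw.mem_U _⟩
    filter_upwards [hV.continuousAt.eventually (hopen.mem_nhds hmem)] with θ hθ τ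
    exact ⟨hOχ (hθ (Set.mem_univ τ)).1, (hθ (Set.mem_univ τ)).2⟩
  have hpos : ∀ᶠ θ in 𝓝 b, 0 < period θ := by
    have : Continuous (period : Params n m → ℝ) := continuous_fst
    exact this.continuousAt.eventually (lt_mem_nhds hXpos)
  have hcutfd : ∀ {h : (Fin n → ℝ) × Params n m → Fin n → ℝ} (y : ℝ),
      fderiv ℝ (fun p => χ p.1 • h p) (ubar y, b) = fderiv ℝ h (ubar y, b) := by
    intro h y
    refine Filter.EventuallyEq.fderiv_eq ?_
    have := (continuous_fst.continuousAt (x := (ubar y, b))).eventually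
      (eventually_nhdsSet_iff_forall.1 hχ1 (ubar y) ⟨y, rfl⟩)
    filter_upwards [this] with p hp
    rw [hp, one_smul]
  have hprim : ∀ {h : (Fin n → ℝ) × Params n m → Fin n → ℝ}
      (hh : ContDiffOn ℝ 1 h (P.U ×ˢ Set.univ)),
      ∃ L : Params n m →L[ℝ] C(I, Fin n → ℝ),
        HasFDerivAt (fun θ => primitive (paramSuperposition
          (fun p => χ p.1 • h p) (cut hh).continuous (V θ, θ))) L b ∧
        ∀ η, ∀ τ : I, L η τ = ∫ s in (0 : ℝ)..τ, fderiv ℝ h (ubar (X * s), b)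
          (extendI (fderiv ℝ V b η) s, η) := by
    intro h hh
    have hVd : HasFDerivAt V (fderiv ℝ V b) b := (hV.differentiableAt one_ne_zero).hasFDerivAt
    have h2 := HasFDerivAt.comp (f := fun θ => (V θ, θ)) b
      (hasFDerivAt_paramSuperposition _ (cut hh) (V b, b)) (hVd.prodMk (hasFDerivAt_id b))
    have h3 := (primitive (E := Fin n → ℝ)).hasFDerivAt.comp b h2
    refine ⟨_, h3, fun η τ => ?_⟩
    change primitive _ τ = _
    rw [primitive_apply]
    refine intervalIntegral.integral_congr fun s hs => ?_
    rw [Set.uIcc_of_le τ.2.1] at hs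
    have hs' : s ∈ Set.Icc (0 : ℝ) 1 := ⟨hs.1, hs.2.trans τ.2.2⟩
    simp only [extendI_of_mem _ hs']
    rw [← hcutfd (X * s)]
    have hVs : V b ⟨s, hs'⟩ = ubar (X * s) := by rw [hVb]; rfl
    rw [← hVs]
    rfl
  have heval : ∀ v : C(I, Fin n → ℝ), primitive v 1 = ∫ τ in (0 : ℝ)..1, extendI v τ :=
    fun v => rfl
  refine ⟨V, hV, fun τ => by rw [hVb]; rfl, hpos, ?_, ?_, ?_, ?_⟩
  · filter_upwards [hVeq] with θ hθ
    rw [hθ, ContinuousMap.add_apply, constOp_apply, primitive_apply]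
    simp
  · filter_upwards [hVeq, hnear, hpos] with θ hθ hθ' hθp
    rw [isProfileOn_iff h1]
    intro y hy
    have hyI : y / period θ ∈ Set.Icc (0 : ℝ) 1 :=
      ⟨div_nonneg hy.1 hθp.le, (div_le_one hθp).2 hy.2⟩
    refine ⟨(hθ' _).2, ?_⟩
    set Gθ : ℝ → Fin n → ℝ := extendI (paramSuperposition
      (fun p : (Fin n → ℝ) × Params n m => χ p.1 • period p.2 • P.field p)
      hG.continuous (V θ, θ)) with hGθ
    have hGc : Continuous Gθ := continuous_extendI _
    have hFTC : HasDerivAt (fun s => start θ + ∫ τ in (0 : ℝ)..s, Gθ τ) (Gθ (y / period θ))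
        (y / period θ) :=
      (intervalIntegral.integral_hasDerivAt_right (hGc.intervalIntegrable _ _)
        hGc.aestronglyMeasurable.stronglyMeasurableAtFilter hGc.continuousAt).const_add _
    have hcomp := hFTC.scomp y ((hasDerivAt_id y).div_const (period θ))
    have hval : (1 / period θ) • Gθ (y / period θ) =
        P.field (extendI (V θ) (y / period θ), θ) := by
      have : Gθ (y / period θ) = χ (V θ ⟨_, hyI⟩) • period θ • P.field (V θ ⟨_, hyI⟩, θ) := by
        rw [hGθ, extendI_of_mem _ hyI]; rfl
      rw [this, (hθ' _).1, one_smul, smul_smul, one_div, inv_mul_cancel₀ hθp.ne', one_smul,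
        extendI_of_mem _ hyI]
    rw [← hval]
    have hVθ : ∀ z ∈ Set.Icc 0 (period θ), extendI (V θ) (z / period θ) =
        start θ + ∫ τ in (0 : ℝ)..z / period θ, Gθ τ := by
      intro z hz
      have hzI : z / period θ ∈ Set.Icc (0 : ℝ) 1 :=
        ⟨div_nonneg hz.1 hθp.le, (div_le_one hθp).2 hz.2⟩
      rw [extendI_of_mem _ hzI]
      exact congrArg (fun r : C(I, Fin n → ℝ) => r ⟨_, hzI⟩) hθ
    exact hcomp.hasDerivWithinAt.congr hVθ (hVθ y hy)
  · intro h hh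
    obtain ⟨L, hL, hLeq⟩ := hprim hh
    let ev : C(I, Fin n → ℝ) →L[ℝ] (Fin n → ℝ) := ContinuousMap.evalCLM ℝ 1
    refine ⟨ev.comp L, ?_, fun η => hLeq η 1⟩
    have hcomp := ev.hasFDerivAt.comp b hL
    refine hcomp.congr_of_eventuallyEq ?_
    filter_upwards [hnear] with θ hθ
    change _ = primitive _ 1
    rw [heval]
    refine intervalIntegral.integral_congr fun s hs => ?_
    rw [Set.uIcc_of_le zero_le_one] at hs
    simp only [extendI_of_mem _ hs]
    change _ = χ (V θ ⟨s, hs⟩) • h (V θ ⟨s, hs⟩, θ)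
    rw [(hθ _).1, one_smul]
  · intro η τ
    obtain ⟨L, hL, hLeq⟩ := hprim hg
    let st : Params n m →L[ℝ] (Fin n → ℝ) :=
      (ContinuousLinearMap.fst ℝ _ _).comp (ContinuousLinearMap.snd ℝ _ _)
    have hsum := ((constOp.comp st).hasFDerivAt (x := b)).add hL
    have hVd := hsum.congr_of_eventuallyEq hVeq
    have h1 : fderiv ℝ V b η τ = constOp (start η) τ + L η τ := by
      rw [hVd.fderiv]; rfl
    rw [h1, hLeq η τ, constOp_apply]

end System

end Base

namespace System

variable {n m : ℕ} {ubar : ℝ → Fin n → ℝ} {X : ℝ} {q : Fin n → ℝ}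

section Averages

variable (P : System n m)

/-- The flux density `f^j(u) - ∑ₖ ν_k B^{jk}(u) u'` along solutions of the profile equation. -/
def fluxDensity (j : Fin (m + 1)) (p : (Fin n → ℝ) × Params n m) : Fin n → ℝ :=
  P.f j p.1 - ∑ k, normal p.2 k • (P.B j k p.1 *ᵥ P.field p)

variable {P}

theorem contDiffOn_fluxDensity (h0 : P.H0) (h1 : P.H1) (j : Fin (m + 1)) :
    ContDiffOn ℝ 1 (P.fluxDensity j) (P.U ×ˢ Set.univ) := by
  have hfst : Set.MapsTo Prod.fst (P.U ×ˢ (Set.univ : Set (Params n m))) P.U := fun p hp => hp.1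
  refine (((h0.1 j).of_le one_le_two).comp contDiffOn_fst hfst).sub ?_
  refine ContDiffOn.sum fun k _ => (contDiffOn_normal_apply k).smul ?_
  exact contDiffOn_mulVec (fun a b => ((h0.2 j k a b).of_le one_le_two).comp contDiffOn_fst hfst)
    ((contDiffOn_field h0 h1).of_le one_le_two)

variable {θ : Params n m} {v : ℝ → Fin n → ℝ}

theorem H_eq (h0 : P.H0) (h1 : P.H1) (hθ : 0 < period θ) (hstart : v 0 = start θ)
    (hv : P.IsProfileOn (speed θ) (normal θ) (constant θ) v (Set.Icc 0 (period θ))) :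
    P.H θ = v (period θ) - v 0 := by
  rw [H, profile_eq h0 h1 hθ.le hv hstart, hstart]

theorem profile_eq_of_mem (h0 : P.H0) (h1 : P.H1) (hstart : v 0 = start θ)
    (hv : P.IsProfileOn (speed θ) (normal θ) (constant θ) v (Set.Icc 0 (period θ))) {y : ℝ}
    (hy : y ∈ Set.Icc 0 (period θ)) : P.profile θ y = v y :=
  profile_eq h0 h1 hy.1 (hv.mono (Set.Icc_subset_Icc_right hy.2)) hstart

theorem M_eq (h0 : P.H0) (h1 : P.H1) (hθ : 0 < period θ) (hstart : v 0 = start θ)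
    (hv : P.IsProfileOn (speed θ) (normal θ) (constant θ) v (Set.Icc 0 (period θ))) :
    P.M θ = (1 / period θ) • ∫ y in (0 : ℝ)..period θ, v y := by
  rw [M]
  congr 1
  refine intervalIntegral.integral_congr fun y hy => ?_
  rw [Set.uIcc_of_le hθ.le] at hy
  exact profile_eq_of_mem h0 h1 hstart hv hy

theorem F_eq (h0 : P.H0) (h1 : P.H1) (hθ : 0 < period θ) (hstart : v 0 = start θ)
    (hv : P.IsProfileOn (speed θ) (normal θ) (constant θ) v (Set.Icc 0 (period θ)))
    (j : Fin (m + 1)) :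
    P.F j θ = (1 / period θ) • ∫ y in (0 : ℝ)..period θ, P.fluxDensity j (v y, θ) := by
  rw [F]
  congr 1
  refine intervalIntegral.integral_congr_Ioo_of_le hθ.le fun y hy => ?_
  have hy' := Set.Ioo_subset_Icc_self hy
  have hder : deriv (P.profile θ) y = P.field (v y, θ) := by
    have h2 := (((isProfileOn_iff h1 _ _ _).1 hv) y hy').2.hasDerivAt (Icc_mem_nhds hy.1 hy.2)
    have heq : P.profile θ =ᶠ[𝓝 y] v := by
      filter_upwards [Icc_mem_nhds hy.1 hy.2] with z hz
      exact profile_eq_of_mem h0 h1 hstart hv hz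
    exact (h2.congr_of_eventuallyEq heq).deriv
  simp only [hder, profile_eq_of_mem h0 h1 hstart hv hy', fluxDensity]

end Averages

variable {P : System n m} {V : Params n m → C(I, Fin n → ℝ)}

theorem IsFlow.eventually_H (hV : P.IsFlow ubar X q V) (h0 : P.H0) (h1 : P.H1) :
    P.H =ᶠ[𝓝 (basePoint m ubar X q)] fun θ => V θ 1 - start θ := by
  filter_upwards [hV.period_pos, hV.start_eq, hV.isProfileOn] with θ hp hs hprof
  have hs' : extendI (V θ) (0 / period θ) = start θ := by
    rw [zero_div, extendI_of_mem _ (by simp), ← hs]; rfl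
  rw [H_eq h0 h1 hp hs' hprof, hs', div_self hp.ne', extendI_of_mem _ (by simp)]
  rfl

theorem IsFlow.eventually_M (hV : P.IsFlow ubar X q V) (h0 : P.H0) (h1 : P.H1) :
    P.M =ᶠ[𝓝 (basePoint m ubar X q)] fun θ => ∫ τ in (0 : ℝ)..1, extendI (V θ) τ := by
  filter_upwards [hV.period_pos, hV.start_eq, hV.isProfileOn] with θ hp hs hprof
  have hs' : extendI (V θ) (0 / period θ) = start θ := by
    rw [zero_div, extendI_of_mem _ (by simp), ← hs]; rfl
  rw [M_eq h0 h1 hp hs' hprof, intervalIntegral.integral_comp_div (fun τ => extendI (V θ) τ) hp.ne',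
    smul_smul, one_div, inv_mul_cancel₀ hp.ne', one_smul, zero_div, div_self hp.ne']

theorem IsFlow.eventually_F (hV : P.IsFlow ubar X q V) (h0 : P.H0) (h1 : P.H1)
    (j : Fin (m + 1)) :
    P.F j =ᶠ[𝓝 (basePoint m ubar X q)]
      fun θ => ∫ τ in (0 : ℝ)..1, P.fluxDensity j (extendI (V θ) τ, θ) := by
  filter_upwards [hV.period_pos, hV.start_eq, hV.isProfileOn] with θ hp hs hprof
  have hs' : extendI (V θ) (0 / period θ) = start θ := by
    rw [zero_div, extendI_of_mem _ (by simp), ← hs]; rfl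
  rw [F_eq h0 h1 hp hs' hprof,
    intervalIntegral.integral_comp_div (fun τ => P.fluxDensity j (extendI (V θ) τ, θ)) hp.ne',
    smul_smul, one_div, inv_mul_cancel₀ hp.ne', one_smul, zero_div, div_self hp.ne']

section Pointwise

variable (P)

/-- The matrix of `v ↦ Df^j(ubar) v - (DB^{j1}(ubar) v) ubar'`. -/
def realA (ubar : ℝ → Fin n → ℝ) (j : Fin (m + 1)) (x : ℝ) : Matrix (Fin n) (Fin n) ℝ :=
  Matrix.of fun a b => fderiv ℝ (P.f j) (ubar x) (Pi.single b 1) a -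
      ∑ c, fderiv ℝ (fun u => P.B j 0 u a c) (ubar x) (Pi.single b 1) * deriv ubar x c

variable {P}

theorem clm_apply_eq_sum (L : (Fin n → ℝ) →L[ℝ] ℝ) (v : Fin n → ℝ) :
    L v = ∑ b, L (Pi.single b 1) * v b := by
  conv_lhs => rw [pi_eq_sum_univ' v, map_sum]
  refine Finset.sum_congr rfl fun b _ => ?_
  rw [map_smul, smul_eq_mul, mul_comm]

theorem realA_mulVec (j : Fin (m + 1)) (x : ℝ) (v : Fin n → ℝ) (a : Fin n) :
    (P.realA ubar j x *ᵥ v) a = fderiv ℝ (P.f j) (ubar x) v a -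
      ∑ c, fderiv ℝ (fun u => P.B j 0 u a c) (ubar x) v * deriv ubar x c := by
  have h1 := clm_apply_eq_sum ((ContinuousLinearMap.proj a).comp (fderiv ℝ (P.f j) (ubar x))) v
  simp only [ContinuousLinearMap.comp_apply, ContinuousLinearMap.proj_apply] at h1
  rw [h1]
  simp only [clm_apply_eq_sum (fderiv ℝ (fun u => P.B j 0 u a _) (ubar x)) v]
  simp only [Matrix.mulVec, dotProduct, realA, Matrix.of_apply, sub_mul, Finset.sum_mul,
    Finset.sum_sub_distrib]
  congr 1
  rw [Finset.sum_comm]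
  exact Finset.sum_congr rfl fun _ _ => Finset.sum_congr rfl fun _ _ => by ring

theorem hasDerivAt_normal_line (η : Params n m) (j : Fin (m + 1)) :
    HasDerivAt (fun ε : ℝ => normal (basePoint m ubar X q + ε • η) j)
      ((Fin.cons 0 η.2.2.2.1 : Fin (m + 1) → ℝ) j) 0 := by
  have h1 : HasDerivAt (fun ε : ℝ => (ε • η.2.2.2.1 : Fin m → ℝ)) η.2.2.2.1 0 := by
    simpa using (hasDerivAt_id (0 : ℝ)).smul_const η.2.2.2.1
  have h2 : HasFDerivAt (direction : (Fin m → ℝ) → _)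
      (ContinuousLinearMap.pi (Fin.cons (0 : (Fin m → ℝ) →L[ℝ] ℝ)
        fun j => ContinuousLinearMap.proj j)) ((0 : ℝ) • η.2.2.2.1) := by
    rw [zero_smul]; exact hasFDerivAt_direction_zero
  have h3 := hasDerivAt_pi.1 (h2.comp_hasDerivAt (0 : ℝ) h1) j
  have h4 : (fun ε : ℝ => normal (basePoint m ubar X q + ε • η) j) =
      fun ε : ℝ => direction (ε • η.2.2.2.1) j := by
    ext ε
    simp [normal, basePoint]
  rw [h4]
  refine h3.congr_deriv ?_
  refine Fin.cases ?_ (fun j => ?_) j <;> simp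

theorem hasDerivAt_line {F : Type*} [NormedAddCommGroup F] [NormedSpace ℝ F] {h : (Fin n → ℝ) → F}
    {u : Fin n → ℝ} (hh : DifferentiableAt ℝ h u) (v : Fin n → ℝ) :
    HasDerivAt (fun ε : ℝ => h (u + ε • v)) (fderiv ℝ h u v) 0 := by
  have h1 : HasDerivAt (fun ε : ℝ => u + ε • v) v 0 := by
    simpa using ((hasDerivAt_id (0 : ℝ)).smul_const v).const_add u
  have h2 : HasFDerivAt h (fderiv ℝ h u) (u + (0 : ℝ) • v) := by
    simpa using hh.hasFDerivAt
  exact h2.comp_hasDerivAt (0 : ℝ) h1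

theorem hasDerivAt_pair_line {F : Type*} [NormedAddCommGroup F] [NormedSpace ℝ F]
    {h : (Fin n → ℝ) × Params n m → F} {p : (Fin n → ℝ) × Params n m}
    (hh : DifferentiableAt ℝ h p) (w : (Fin n → ℝ) × Params n m) :
    HasDerivAt (fun ε : ℝ => h (p + ε • w)) (fderiv ℝ h p w) 0 := by
  have h1 : HasDerivAt (fun ε : ℝ => p + ε • w) w 0 := by
    simpa using ((hasDerivAt_id (0 : ℝ)).smul_const w).const_add p
  have h2 : HasFDerivAt h (fderiv ℝ h p) (p + (0 : ℝ) • w) := by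
    simpa using hh.hasFDerivAt
  exact h2.comp_hasDerivAt (0 : ℝ) h1

theorem H0.differentiableAt_f (h0 : P.H0) (j : Fin (m + 1)) {u : Fin n → ℝ} (hu : u ∈ P.U) :
    DifferentiableAt ℝ (P.f j) u :=
  ((h0.1 j).contDiffAt (P.isOpen_U.mem_nhds hu)).differentiableAt two_ne_zero

theorem H0.differentiableAt_B (h0 : P.H0) (j k : Fin (m + 1)) (a b : Fin n) {u : Fin n → ℝ}
    (hu : u ∈ P.U) : DifferentiableAt ℝ (fun u => P.B j k u a b) u :=
  ((h0.2 j k a b).contDiffAt (P.isOpen_U.mem_nhds hu)).differentiableAt two_ne_zero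

/-- The linearized profile equation. -/
theorem B_mulVec_fderiv_field (hw : P.IsPeriodicWave ubar X q) (h0 : P.H0) (h1 : P.H1) (x : ℝ)
    (v : Fin n → ℝ) (η : Params n m) :
    P.B 0 0 (ubar x) *ᵥ fderiv ℝ P.field (ubar x, basePoint m ubar X q) (v, η) =
      P.realA ubar 0 x *ᵥ v - speed η • ubar x - constant η +
        ∑ k : Fin m, η.2.2.2.1 k • (P.f k.succ (ubar x) -
          P.B k.succ 0 (ubar x) *ᵥ deriv ubar x - P.B 0 k.succ (ubar x) *ᵥ deriv ubar x) := by
  set b := basePoint m ubar X q with hb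
  have hu := hw.mem_U x
  have hgd : DifferentiableAt ℝ P.field (ubar x, b) :=
    (contDiffAt_field h0 h1 b hu).differentiableAt two_ne_zero
  have hline := hasDerivAt_pair_line hgd (v, η)
  have hU : ∀ᶠ ε : ℝ in 𝓝 0, ubar x + ε • v ∈ P.U := by
    have : ContinuousAt (fun ε : ℝ => ubar x + ε • v) 0 := by fun_prop
    exact this.eventually (by simpa using P.isOpen_U.mem_nhds hu)
  ext a
  have hl : HasDerivAt (fun ε : ℝ => ∑ j, ∑ k, (normal (b + ε • η) j * normal (b + ε • η) k) *
      ∑ c, P.B j k (ubar x + ε • v) a c * P.field ((ubar x, b) + ε • (v, η)) c) _ 0 :=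
    HasDerivAt.fun_sum fun j _ => HasDerivAt.fun_sum fun k _ =>
      ((hasDerivAt_normal_line η j).mul (hasDerivAt_normal_line η k)).mul
        (HasDerivAt.fun_sum fun c _ =>
          (hasDerivAt_line (h0.differentiableAt_B j k a c hu) v).mul (hasDerivAt_pi.1 hline c))
  have hsp : HasDerivAt (fun ε : ℝ => speed (b + ε • η)) (speed η) 0 := by
    have : (fun ε : ℝ => speed (b + ε • η)) = fun ε => ε * speed η := by
      ext ε; simp [speed, hb, basePoint]
    rw [this]
    simpa using (hasDerivAt_id (0 : ℝ)).mul_const (speed η)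
  have hco : HasDerivAt (fun ε : ℝ => constant (b + ε • η) a) (constant η a) 0 := by
    have : (fun ε : ℝ => constant (b + ε • η) a) = fun ε => q a + ε * constant η a := by
      ext ε; simp [constant, hb, basePoint]
    rw [this]
    simpa using ((hasDerivAt_id (0 : ℝ)).mul_const (constant η a)).const_add (q a)
  have hid : HasDerivAt (fun ε : ℝ => (ubar x + ε • v) a) (v a) 0 := by
    simpa using ((hasDerivAt_id (0 : ℝ)).mul_const (v a)).const_add (ubar x a)
  have hr : HasDerivAt (fun ε : ℝ => ∑ j, normal (b + ε • η) j * P.f j (ubar x + ε • v) a -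
      speed (b + ε • η) * (ubar x + ε • v) a - constant (b + ε • η) a) _ 0 :=
    ((HasDerivAt.fun_sum fun j _ => (hasDerivAt_normal_line η j).mul
      (hasDerivAt_pi.1 (hasDerivAt_line (h0.differentiableAt_f j hu) v) a)).sub
        (hsp.mul hid)).sub hco
  have heq : (fun ε : ℝ => ∑ j, ∑ k, (normal (b + ε • η) j * normal (b + ε • η) k) *
      ∑ c, P.B j k (ubar x + ε • v) a c * P.field ((ubar x, b) + ε • (v, η)) c) =ᶠ[𝓝 0]
      (fun ε : ℝ => ∑ j, normal (b + ε • η) j * P.f j (ubar x + ε • v) a -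
      speed (b + ε • η) * (ubar x + ε • v) a - constant (b + ε • η) a) := by
    filter_upwards [hU] with ε hε
    have := congrFun (viscosity_mulVec_field h1 (b + ε • η) hε) a
    simp only [viscosity, netFlux, Matrix.sum_mulVec, Matrix.smul_mulVec, Finset.sum_apply,
      Pi.sub_apply, Pi.smul_apply, smul_eq_mul] at this
    simp only [Matrix.mulVec, dotProduct] at this
    exact this
  have hfin := hl.unique (hr.congr_of_eventuallyEq heq)
  have hs0 : speed b = 0 := rfl
  simp only [Pi.mul_apply, normal_basePoint, zero_smul, add_zero, Fin.sum_univ_succ,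
    Fin.cons_zero, Fin.cons_succ,
    Pi.single_eq_same, Pi.single_eq_of_ne (Fin.succ_ne_zero _), zero_mul, mul_zero, one_mul,
    mul_one, zero_add, Finset.sum_const_zero, hs0, Finset.sum_add_distrib] at hfin
  simp only [Pi.add_apply, Pi.sub_apply, Pi.smul_apply, smul_eq_mul, realA_mulVec,
    Finset.sum_apply, hw.deriv_eq h1, ← hb, mul_sub, Finset.sum_sub_distrib]
  simp only [Matrix.mulVec, dotProduct]
  linarith

theorem fderiv_fluxDensity (hw : P.IsPeriodicWave ubar X q) (h0 : P.H0) (h1 : P.H1) (x : ℝ)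
    (v : Fin n → ℝ) (η : Params n m) (j : Fin (m + 1)) :
    fderiv ℝ (P.fluxDensity j) (ubar x, basePoint m ubar X q) (v, η) =
      P.realA ubar j x *ᵥ v -
        P.B j 0 (ubar x) *ᵥ fderiv ℝ P.field (ubar x, basePoint m ubar X q) (v, η) -
        ∑ k : Fin m, η.2.2.2.1 k • (P.B j k.succ (ubar x) *ᵥ deriv ubar x) := by
  set b := basePoint m ubar X q with hb
  have hu := hw.mem_U x
  have hgd : DifferentiableAt ℝ P.field (ubar x, b) :=
    (contDiffAt_field h0 h1 b hu).differentiableAt two_ne_zero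
  have hline := hasDerivAt_pair_line hgd (v, η)
  have hfd : DifferentiableAt ℝ (P.fluxDensity j) (ubar x, b) :=
    ((contDiffOn_fluxDensity h0 h1 j).contDiffAt
      ((P.isOpen_U.prod isOpen_univ).mem_nhds ⟨hu, Set.mem_univ _⟩)).differentiableAt one_ne_zero
  ext a
  have hl := hasDerivAt_pi.1 (hasDerivAt_pair_line hfd (v, η)) a
  have hr : HasDerivAt (fun ε : ℝ => P.f j (ubar x + ε • v) a -
      ∑ k, normal (b + ε • η) k *
        ∑ c, P.B j k (ubar x + ε • v) a c * P.field ((ubar x, b) + ε • (v, η)) c) _ 0 :=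
    (hasDerivAt_pi.1 (hasDerivAt_line (h0.differentiableAt_f j hu) v) a).sub
      (HasDerivAt.fun_sum fun k _ => (hasDerivAt_normal_line η k).mul
        (HasDerivAt.fun_sum fun c _ =>
          (hasDerivAt_line (h0.differentiableAt_B j k a c hu) v).mul (hasDerivAt_pi.1 hline c)))
  have heq : (fun ε : ℝ => P.fluxDensity j ((ubar x, b) + ε • (v, η)) a) =
      (fun ε : ℝ => P.f j (ubar x + ε • v) a -
      ∑ k, normal (b + ε • η) k *
        ∑ c, P.B j k (ubar x + ε • v) a c * P.field ((ubar x, b) + ε • (v, η)) c) := by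
    ext ε
    simp only [fluxDensity, Pi.sub_apply, Finset.sum_apply, Pi.smul_apply, smul_eq_mul,
      Matrix.mulVec, dotProduct]
    rfl
  rw [heq] at hl
  have hfin := hl.unique hr
  simp only [normal_basePoint, zero_smul, add_zero, Fin.sum_univ_succ,
    Fin.cons_zero, Fin.cons_succ,
    Pi.single_eq_same, Pi.single_eq_of_ne (Fin.succ_ne_zero _), zero_mul, one_mul,
    zero_add, Finset.sum_const_zero, Finset.sum_add_distrib] at hfin
  simp only [Pi.sub_apply, Pi.smul_apply, smul_eq_mul, realA_mulVec,
    Finset.sum_apply, hw.deriv_eq h1, ← hb]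
  simp only [Matrix.mulVec, dotProduct]
  linarith

end Pointwise

end System

namespace System

variable {n m : ℕ} {ubar : ℝ → Fin n → ℝ} {X : ℝ} {q : Fin n → ℝ} {P : System n m}

theorem contDiffAt_H (hw : P.IsPeriodicWave ubar X q) (h0 : P.H0) (h1 : P.H1) :
    ContDiffAt ℝ 1 P.H (basePoint m ubar X q) := by
  obtain ⟨V, hV⟩ := exists_isFlow hw h0 h1
  let ev : C(I, Fin n → ℝ) →L[ℝ] (Fin n → ℝ) := ContinuousMap.evalCLM ℝ 1
  have h2 : ContDiffAt ℝ 1 (fun θ => V θ 1 - start θ) (basePoint m ubar X q) := by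
    refine ContDiffAt.sub (ev.contDiff.contDiffAt.comp _ hV.contDiffAt) ?_
    unfold start
    fun_prop
  exact h2.congr_of_eventuallyEq (hV.eventually_H h0 h1)

theorem contDiffOn_fst_prod : ContDiffOn ℝ 1
    (Prod.fst : (Fin n → ℝ) × Params n m → Fin n → ℝ) (P.U ×ˢ Set.univ) := contDiffOn_fst

theorem differentiableAt_M (hw : P.IsPeriodicWave ubar X q) (h0 : P.H0) (h1 : P.H1) :
    DifferentiableAt ℝ P.M (basePoint m ubar X q) := by
  obtain ⟨V, hV⟩ := exists_isFlow hw h0 h1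
  obtain ⟨L, hL, -⟩ := hV.average _ contDiffOn_fst_prod
  exact (hL.congr_of_eventuallyEq (hV.eventually_M h0 h1)).differentiableAt

theorem differentiableAt_F (hw : P.IsPeriodicWave ubar X q) (h0 : P.H0) (h1 : P.H1)
    (j : Fin (m + 1)) : DifferentiableAt ℝ (P.F j) (basePoint m ubar X q) := by
  obtain ⟨V, hV⟩ := exists_isFlow hw h0 h1
  obtain ⟨L, hL, -⟩ := hV.average _ (contDiffOn_fluxDensity h0 h1 j)
  exact (hL.congr_of_eventuallyEq (hV.eventually_F h0 h1 j)).differentiableAt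

/-- `v`, with derivative `v'`, is the variation of the profile in the direction `η` (which does not
change the period). -/
structure IsVariation (P : System n m) (ubar : ℝ → Fin n → ℝ) (X : ℝ) (q : Fin n → ℝ)
    (η : Params n m) (v v' : ℝ → Fin n → ℝ) : Prop where
  initial : v 0 = start η
  hasDerivAt : ∀ x ∈ Set.Icc 0 X, HasDerivAt v (v' x) x
  continuous : Continuous v
  continuous_deriv : Continuous v'
  equation : ∀ x ∈ Set.Icc 0 X, P.B 0 0 (ubar x) *ᵥ v' x =
    P.realA ubar 0 x *ᵥ v x - speed η • ubar x - constant η +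
      ∑ k : Fin m, η.2.2.2.1 k • (P.f k.succ (ubar x) -
        P.B k.succ 0 (ubar x) *ᵥ deriv ubar x - P.B 0 k.succ (ubar x) *ᵥ deriv ubar x)
  fderiv_H : fderiv ℝ P.H (basePoint m ubar X q) η = v X - v 0
  fderiv_M : X • fderiv ℝ P.M (basePoint m ubar X q) η = ∫ x in (0 : ℝ)..X, v x
  fderiv_F : ∀ j, X • fderiv ℝ (P.F j) (basePoint m ubar X q) η = ∫ x in (0 : ℝ)..X,
    (P.realA ubar j x *ᵥ v x - P.B j 0 (ubar x) *ᵥ v' x -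
      ∑ k : Fin m, η.2.2.2.1 k • (P.B j k.succ (ubar x) *ᵥ deriv ubar x))

theorem exists_isVariation (hw : P.IsPeriodicWave ubar X q) (h0 : P.H0) (h1 : P.H1)
    (η : Params n m) (hη : η.1 = 0) : ∃ v v', P.IsVariation ubar X q η v v' := by
  obtain ⟨V, hV⟩ := exists_isFlow hw h0 h1
  set b := basePoint m ubar X q with hb
  have hX := hw.period_pos
  have hopen : IsOpen (P.U ×ˢ (Set.univ : Set (Params n m))) := P.isOpen_U.prod isOpen_univ
  have hmem : ∀ x, (ubar x, b) ∈ P.U ×ˢ (Set.univ : Set (Params n m)) :=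
    fun x => ⟨hw.mem_U x, Set.mem_univ _⟩
  set g : (Fin n → ℝ) × Params n m → Fin n → ℝ := fun p => period p.2 • P.field p with hg
  have hgC : ContDiffOn ℝ 1 g (P.U ×ˢ Set.univ) := by
    have hp : ContDiffOn ℝ 1 (fun p : (Fin n → ℝ) × Params n m => period p.2)
        (P.U ×ˢ Set.univ) := (contDiff_fst.comp contDiff_snd).contDiffOn
    exact hp.smul ((contDiffOn_field h0 h1).of_le one_le_two)
  set r : ℝ → Fin n → ℝ := extendI (fderiv ℝ V b η) with hr
  have hrc : Continuous r := continuous_extendI _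
  set W : ℝ → Fin n → ℝ := fun τ => fderiv ℝ g (ubar (X * τ), b) (r τ, η) with hW
  have hWc : Continuous W := by
    have h2 : Continuous fun τ : ℝ => fderiv ℝ g (ubar (X * τ), b) := by
      refine (hgC.continuousOn_fderiv_of_isOpen hopen le_rfl).comp_continuous
        (f := fun τ : ℝ => (ubar (X * τ), b)) ?_ fun τ => hmem _
      have := hw.continuous h1
      fun_prop
    exact h2.clm_apply (hrc.prodMk continuous_const)
  set v : ℝ → Fin n → ℝ := fun x => start η + ∫ τ in (0 : ℝ)..(x / X), W τ with hv
  set v' : ℝ → Fin n → ℝ := fun x => (1 / X) • W (x / X) with hv'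
  have hder : ∀ x, HasDerivAt v (v' x) x := by
    intro x
    have h2 : HasDerivAt (fun s => start η + ∫ τ in (0 : ℝ)..s, W τ) (W (x / X)) (x / X) :=
      (intervalIntegral.integral_hasDerivAt_right (hWc.intervalIntegrable _ _)
        hWc.aestronglyMeasurable.stronglyMeasurableAtFilter hWc.continuousAt).const_add _
    exact h2.scomp x ((hasDerivAt_id x).div_const X)
  have hIcc : ∀ x ∈ Set.Icc 0 X, x / X ∈ Set.Icc (0 : ℝ) 1 := fun x hx =>
    ⟨div_nonneg hx.1 hX.le, (div_le_one hX).2 hx.2⟩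
  have hvr : ∀ x ∈ Set.Icc 0 X, v x = r (x / X) := by
    intro x hx
    rw [hr, extendI_of_mem _ (hIcc x hx)]
    exact (hV.variation η ⟨_, hIcc x hx⟩).symm
  have hWg : ∀ τ, W τ = X • fderiv ℝ P.field (ubar (X * τ), b) (r τ, η) := by
    intro τ
    have hp : HasFDerivAt (fun p : (Fin n → ℝ) × Params n m => period p.2)
        ((ContinuousLinearMap.fst ℝ ℝ _).comp (ContinuousLinearMap.snd ℝ _ (Params n m)))
        (ubar (X * τ), b) := hasFDerivAt_fst.comp _ hasFDerivAt_snd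
    have hf : HasFDerivAt P.field (fderiv ℝ P.field (ubar (X * τ), b)) (ubar (X * τ), b) :=
      ((contDiffAt_field h0 h1 b (hw.mem_U _)).differentiableAt two_ne_zero).hasFDerivAt
    have h2 := (hp.smul hf).fderiv
    have h3 := congrArg (fun L : ((Fin n → ℝ) × Params n m) →L[ℝ] (Fin n → ℝ) => L (r τ, η)) h2
    refine h3.trans ?_
    change X • fderiv ℝ P.field (ubar (X * τ), b) (r τ, η) + η.1 • P.field (ubar (X * τ), b) = _
    rw [hη, zero_smul, add_zero]
  have hv'g : ∀ x ∈ Set.Icc 0 X, v' x = fderiv ℝ P.field (ubar x, b) (v x, η) := by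
    intro x hx
    simp only [hv']
    rw [hWg, smul_smul, one_div, inv_mul_cancel₀ hX.ne', one_smul, hvr x hx,
      mul_div_cancel₀ x hX.ne']
  have hbase1 : v 0 = start η := by simp [hv]
  have hscale : ∀ φ : ℝ → Fin n → ℝ, X • ∫ τ in (0 : ℝ)..1, φ (X * τ) = ∫ x in (0 : ℝ)..X, φ x := by
    intro φ
    rw [intervalIntegral.smul_integral_comp_mul_left]
    simp
  have hIX : ∀ τ ∈ Set.Icc (0 : ℝ) 1, X * τ ∈ Set.Icc 0 X := fun τ hτ =>
    ⟨mul_nonneg hX.le hτ.1, mul_le_of_le_one_right hX.le hτ.2⟩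
  have hrv : ∀ τ ∈ Set.Icc (0 : ℝ) 1, r τ = v (X * τ) := by
    intro τ hτ
    rw [hvr _ (hIX τ hτ), mul_div_cancel_left₀ τ hX.ne']
  refine ⟨v, v', hbase1, fun x _ => hder x,
    continuous_iff_continuousAt.2 fun x => (hder x).continuousAt, by fun_prop, ?_, ?_, ?_, ?_⟩
  · intro x hx
    rw [hv'g x hx]
    exact B_mulVec_fderiv_field hw h0 h1 x (v x) η
  · let ev : C(I, Fin n → ℝ) →L[ℝ] (Fin n → ℝ) := ContinuousMap.evalCLM ℝ 1
    let st : Params n m →L[ℝ] (Fin n → ℝ) :=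
      (ContinuousLinearMap.fst ℝ _ _).comp (ContinuousLinearMap.snd ℝ _ _)
    have hVd := (hV.contDiffAt.differentiableAt one_ne_zero).hasFDerivAt
    have h2 := ((ev.hasFDerivAt.comp b hVd).sub (st.hasFDerivAt (x := b))).congr_of_eventuallyEq
      (hV.eventually_H h0 h1)
    rw [h2.fderiv]
    change fderiv ℝ V b η 1 - start η = v X - v 0
    rw [hbase1, hvr X ⟨hX.le, le_rfl⟩, div_self hX.ne', hr, extendI_of_mem _ (by simp)]
    rfl
  · obtain ⟨L, hL, hLη⟩ := hV.average _ contDiffOn_fst_prod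
    rw [(hL.congr_of_eventuallyEq (hV.eventually_M h0 h1)).fderiv, hLη, ← hscale v]
    congr 1
    refine intervalIntegral.integral_congr fun τ hτ => ?_
    rw [Set.uIcc_of_le zero_le_one] at hτ
    simp only [fderiv_fst]
    exact hrv τ hτ
  · intro j
    obtain ⟨L, hL, hLη⟩ := hV.average _ (contDiffOn_fluxDensity h0 h1 j)
    rw [(hL.congr_of_eventuallyEq (hV.eventually_F h0 h1 j)).fderiv, hLη, ← hscale
      (fun x => P.realA ubar j x *ᵥ v x - P.B j 0 (ubar x) *ᵥ v' x -
      ∑ k : Fin m, η.2.2.2.1 k • (P.B j k.succ (ubar x) *ᵥ deriv ubar x))]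
    congr 1
    refine intervalIntegral.integral_congr fun τ hτ => ?_
    rw [Set.uIcc_of_le zero_le_one] at hτ
    simp only [hv'g _ (hIX τ hτ), ← hrv τ hτ]
    exact fderiv_fluxDensity hw h0 h1 (X * τ) (r τ) η j

theorem hasDerivAt_comp_fderiv {F : Type*} [NormedAddCommGroup F] [NormedSpace ℝ F]
    {h : Params n m → F} {c : ℝ → Params n m} {η : Params n m}
    (hh : DifferentiableAt ℝ h (basePoint m ubar X q)) (hc : HasDerivAt c η 0)
    (hc0 : c 0 = basePoint m ubar X q) :
    HasDerivAt (fun ε => h (c ε)) (fderiv ℝ h (basePoint m ubar X q) η) 0 := by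
  rw [← hc0] at hh ⊢
  exact hh.hasFDerivAt.comp_hasDerivAt (0 : ℝ) hc

/-- The direction of translations. -/
def translation (m : ℕ) (ubar : ℝ → Fin n → ℝ) : Params n m := (0, deriv ubar 0, 0, 0, 0)

/-- The direction of the period. -/
def periodDir (n m : ℕ) : Params n m := (1, 0, 0, 0, 0)

theorem fderiv_translation (hw : P.IsPeriodicWave ubar X q) (h0 : P.H0) (h1 : P.H1) :
    fderiv ℝ P.H (basePoint m ubar X q) (translation m ubar) = 0 ∧
      fderiv ℝ P.M (basePoint m ubar X q) (translation m ubar) = 0 ∧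
      ∀ j, fderiv ℝ (P.F j) (basePoint m ubar X q) (translation m ubar) = 0 := by
  set b := basePoint m ubar X q with hb
  have hX := hw.period_pos
  let c : ℝ → Params n m := fun ε => (X, ubar ε, 0, 0, q)
  have hu0 : HasDerivAt ubar (deriv ubar 0) 0 := (hw.hasDerivAt h1 0).differentiableAt.hasDerivAt
  have hc : HasDerivAt c (translation m ubar) 0 :=
    (hasDerivAt_const (0 : ℝ) X).prodMk (hu0.prodMk (hasDerivAt_const (0 : ℝ) _))
  have hprof : ∀ ε, P.IsProfileOn (speed (c ε)) (normal (c ε)) (constant (c ε))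
      (fun y => ubar (y + ε)) (Set.Icc 0 (period (c ε))) := by
    intro ε
    rw [isProfileOn_iff h1]
    exact fun y _ => ⟨hw.mem_U _, ((hw.hasDerivAt h1 (y + ε)).comp_add_const y ε).hasDerivWithinAt⟩
  have hper : ∀ φ : ℝ → Fin n → ℝ, Function.Periodic φ X → ∀ ε,
      ∫ y in (0 : ℝ)..X, φ (y + ε) = ∫ y in (0 : ℝ)..X, φ y := by
    intro φ hφ ε
    rw [intervalIntegral.integral_comp_add_right, zero_add, add_comm X ε,
      hφ.intervalIntegral_add_eq ε 0, zero_add]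
  refine ⟨?_, ?_, fun j => ?_⟩
  · refine (hasDerivAt_comp_fderiv ((contDiffAt_H hw h0 h1).differentiableAt one_ne_zero) hc
      rfl).unique ((hasDerivAt_const (0 : ℝ) (0 : Fin n → ℝ)).congr_of_eventuallyEq
        (Eventually.of_forall fun ε => ?_))
    change P.H (c ε) = 0
    rw [H_eq (θ := c ε) (v := fun y => ubar (y + ε)) h0 h1 hX (congrArg ubar (zero_add ε))
      (hprof ε)]
    change ubar (X + ε) - ubar (0 + ε) = 0
    rw [zero_add, add_comm, hw.periodic, sub_self]
  · refine (hasDerivAt_comp_fderiv (differentiableAt_M hw h0 h1) hc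
      rfl).unique ((hasDerivAt_const (0 : ℝ)
        ((1 / X) • ∫ y in (0 : ℝ)..X, ubar y)).congr_of_eventuallyEq
        (Eventually.of_forall fun ε => ?_))
    change P.M (c ε) = _
    rw [M_eq (θ := c ε) (v := fun y => ubar (y + ε)) h0 h1 hX (congrArg ubar (zero_add ε))
      (hprof ε)]
    exact congrArg _ (hper ubar hw.periodic ε)
  · refine (hasDerivAt_comp_fderiv (differentiableAt_F hw h0 h1 j) hc
      rfl).unique ((hasDerivAt_const (0 : ℝ)
        ((1 / X) • ∫ y in (0 : ℝ)..X, P.fluxDensity j (ubar y, b))).congr_of_eventuallyEq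
        (Eventually.of_forall fun ε => ?_))
    change P.F j (c ε) = _
    rw [F_eq (θ := c ε) (v := fun y => ubar (y + ε)) h0 h1 hX (congrArg ubar (zero_add ε))
      (hprof ε)]
    exact congrArg _ (hper (fun y => P.fluxDensity j (ubar y, b))
      (fun y => by simp only [hw.periodic y]) ε)

theorem M_basePoint (hw : P.IsPeriodicWave ubar X q) (h0 : P.H0) (h1 : P.H1) :
    P.M (basePoint m ubar X q) = (1 / X) • ∫ y in (0 : ℝ)..X, ubar y :=
  M_eq (v := ubar) h0 h1 hw.period_pos rfl (hw.isProfileOn.mono (Set.subset_univ _))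

theorem F_basePoint (hw : P.IsPeriodicWave ubar X q) (h0 : P.H0) (h1 : P.H1) (j : Fin (m + 1)) :
    P.F j (basePoint m ubar X q) =
      (1 / X) • ∫ y in (0 : ℝ)..X, P.fluxDensity j (ubar y, basePoint m ubar X q) :=
  F_eq (θ := basePoint m ubar X q) (v := ubar) h0 h1 hw.period_pos rfl
    (hw.isProfileOn.mono (Set.subset_univ _)) j

theorem continuous_fluxDensity (hw : P.IsPeriodicWave ubar X q) (h0 : P.H0) (h1 : P.H1)
    (j : Fin (m + 1)) : Continuous fun y => P.fluxDensity j (ubar y, basePoint m ubar X q) :=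
  (contDiffOn_fluxDensity h0 h1 j).continuousOn.comp_continuous
    ((hw.continuous h1).prodMk continuous_const) fun y => ⟨hw.mem_U y, Set.mem_univ _⟩

theorem hasDerivAt_average {φ : ℝ → Fin n → ℝ} (hφ : Continuous φ) (hX : X ≠ 0) :
    HasDerivAt (fun ε : ℝ => (1 / (X + ε)) • ∫ y in (0 : ℝ)..(X + ε), φ y)
      ((1 / X) • (φ X - (1 / X) • ∫ y in (0 : ℝ)..X, φ y)) 0 := by
  have h1 : HasDerivAt (fun ε : ℝ => X + ε) 1 0 := (hasDerivAt_id (0 : ℝ)).const_add X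
  have h2 : HasDerivAt (fun s : ℝ => ∫ y in (0 : ℝ)..s, φ y) (φ (X + 0)) (X + 0) :=
    intervalIntegral.integral_hasDerivAt_right (hφ.intervalIntegrable _ _)
      hφ.aestronglyMeasurable.stronglyMeasurableAtFilter hφ.continuousAt
  have h3 := h2.scomp (0 : ℝ) h1
  have h4 : HasDerivAt (fun ε : ℝ => (X + ε)⁻¹) (-1 / (X + 0) ^ 2) 0 :=
    h1.inv (by simpa using hX)
  have h5 := h4.smul h3
  simp only [one_div]
  refine h5.congr_deriv ?_
  simp only [add_zero, one_smul, Function.comp]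
  rw [smul_sub, smul_smul, sub_eq_add_neg, ← neg_smul]
  congr 2
  field_simp

theorem fderiv_periodDir (hw : P.IsPeriodicWave ubar X q) (h0 : P.H0) (h1 : P.H1) :
    fderiv ℝ P.H (basePoint m ubar X q) (periodDir n m) = deriv ubar 0 ∧
      X • fderiv ℝ P.M (basePoint m ubar X q) (periodDir n m) =
        ubar 0 - P.M (basePoint m ubar X q) ∧
      ∀ j, X • fderiv ℝ (P.F j) (basePoint m ubar X q) (periodDir n m) =
        P.fluxDensity j (ubar 0, basePoint m ubar X q) - P.F j (basePoint m ubar X q) := by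
  have hX := hw.period_pos
  have huX : ubar X = ubar 0 := by simpa using hw.periodic 0
  let c : ℝ → Params n m := fun ε => (X + ε, ubar 0, 0, 0, q)
  have hc : HasDerivAt c (periodDir n m) 0 :=
    ((hasDerivAt_id (0 : ℝ)).const_add X).prodMk (hasDerivAt_const (0 : ℝ) _)
  have hc0 : c 0 = basePoint m ubar X q := by simp [c, basePoint]
  have hprof : ∀ ε, P.IsProfileOn (speed (c ε)) (normal (c ε)) (constant (c ε))
      ubar (Set.Icc 0 (period (c ε))) := fun ε => hw.isProfileOn.mono (Set.subset_univ _)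
  have hpos : ∀ᶠ ε : ℝ in 𝓝 0, 0 < period (c ε) := by
    have : ContinuousAt (fun ε : ℝ => X + ε) 0 := by fun_prop
    exact this.eventually (lt_mem_nhds (by simpa using hX))
  refine ⟨?_, ?_, fun j => ?_⟩
  · have hd : HasDerivAt (fun ε : ℝ => ubar (X + ε) - ubar 0) (deriv ubar 0) 0 := by
      have h2 : HasDerivAt ubar (deriv ubar 0) (X + 0) := by
        have h3 := hw.hasDerivAt h1 (X + 0)
        rw [add_zero, huX, ← hw.deriv_eq h1 0] at h3
        simpa using h3
      exact (h2.comp_const_add X 0).sub_const _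
    refine (hasDerivAt_comp_fderiv ((contDiffAt_H hw h0 h1).differentiableAt one_ne_zero) hc
      hc0).unique (hd.congr_of_eventuallyEq ?_)
    filter_upwards [hpos] with ε hε
    exact H_eq (v := ubar) h0 h1 hε rfl (hprof ε)
  · have h2 := (hasDerivAt_comp_fderiv (differentiableAt_M hw h0 h1) hc
      hc0).unique ((hasDerivAt_average (hw.continuous h1) hX.ne').congr_of_eventuallyEq (by
        filter_upwards [hpos] with ε hε
        exact M_eq (v := ubar) h0 h1 hε rfl (hprof ε)))
    rw [h2, smul_smul, mul_one_div_cancel hX.ne', one_smul, huX, M_basePoint hw h0 h1]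
  · have h2 := (hasDerivAt_comp_fderiv (differentiableAt_F hw h0 h1 j) hc
      hc0).unique ((hasDerivAt_average (continuous_fluxDensity hw h0 h1 j)
        hX.ne').congr_of_eventuallyEq (by
        filter_upwards [hpos] with ε hε
        exact F_eq (v := ubar) h0 h1 hε rfl (hprof ε) j))
    rw [h2, smul_smul, mul_one_div_cancel hX.ne', one_smul, huX, F_basePoint hw h0 h1]

theorem deriv_ubar_ne_zero (hw : P.IsPeriodicWave ubar X q) (h0 : P.H0) (h1 : P.H1) :
    deriv ubar 0 ≠ 0 := by
  intro h
  refine hw.nonconstant ⟨ubar 0, ?_⟩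
  have hpos : ∀ y, 0 ≤ y → ubar y = ubar 0 := by
    intro y hy
    refine eqOn_of_isProfileOn h0 h1 (basePoint m ubar X q)
      (hw.isProfileOn.mono (Set.subset_univ _)) (w := fun _ => ubar 0) ?_ rfl
      (Set.right_mem_Icc.2 hy)
    rw [isProfileOn_iff h1]
    intro z _
    refine ⟨hw.mem_U 0, ?_⟩
    rw [← hw.deriv_eq h1, h]
    exact hasDerivWithinAt_const _ _ _
  intro y
  obtain ⟨k, hk⟩ := Archimedean.arch (-y) hw.period_pos
  have := hw.periodic.nsmul k y
  rw [← this]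
  exact hpos _ (by linarith)

end System

namespace System

variable {n m : ℕ} {ubar : ℝ → Fin n → ℝ} {X : ℝ} {q : Fin n → ℝ} {P : System n m}

/-- A solution on `[0, T]` that takes the same value at both ends extends to a periodic one. -/
theorem exists_periodic_extension (h0 : P.H0) (h1 : P.H1) {θ : Params n m} {v : ℝ → Fin n → ℝ}
    {T : ℝ} (hT : 0 < T)
    (hv : P.IsProfileOn (speed θ) (normal θ) (constant θ) v (Set.Icc 0 T)) (hvT : v T = v 0) :
    ∃ w : ℝ → Fin n → ℝ, w 0 = v 0 ∧
      P.IsProfileOn (speed θ) (normal θ) (constant θ) w Set.univ ∧ Function.Periodic w T := by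
  rw [isProfileOn_iff h1] at hv
  have : Fact (0 < T) := ⟨hT⟩
  have hvc : ContinuousOn v (Set.Icc 0 T) := fun x hx => (hv x hx).2.continuousWithinAt
  set c : AddCircle T → Fin n → ℝ := AddCircle.liftIco T 0 v with hc
  have hcc : Continuous c := AddCircle.liftIco_zero_continuous hvT.symm hvc
  set w : ℝ → Fin n → ℝ := fun y => c y with hwdef
  have hwper : Function.Periodic w T := fun y => by simp [hwdef]
  have hwv : ∀ y ∈ Set.Ico 0 T, w y = v y := fun y hy => AddCircle.liftIco_zero_coe_apply hy
  have hw0 : w 0 = v 0 := hwv 0 ⟨le_rfl, hT⟩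
  have hwv' : ∀ y ∈ Set.Icc 0 T, w y = v y := by
    intro y hy
    rcases hy.2.lt_or_eq with h | h
    · exact hwv y ⟨hy.1, h⟩
    · rw [h, hvT, ← hw0]
      simpa using hwper 0
  have hwc : Continuous w := hcc.comp continuous_quotient_mk'
  have hwU : ∀ y, w y ∈ P.U := by
    intro y
    obtain ⟨z, hz, hyz⟩ := hwper.exists_mem_Ico₀ hT y
    rw [hyz, hwv z hz]
    exact (hv z (Set.Ico_subset_Icc_self hz)).1
  set h : ℝ → Fin n → ℝ := fun y => P.field (w y, θ) with hh
  have hhc : Continuous h :=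
    (contDiffOn_field h0 h1).continuousOn.comp_continuous (hwc.prodMk continuous_const)
      fun y => ⟨hwU y, Set.mem_univ _⟩
  set W : ℝ → Fin n → ℝ := fun y => v 0 + ∫ s in (0 : ℝ)..y, h s with hW
  have hWd : ∀ y, HasDerivAt W (h y) y := fun y =>
    (intervalIntegral.integral_hasDerivAt_right (hhc.intervalIntegrable _ _)
      hhc.aestronglyMeasurable.stronglyMeasurableAtFilter hhc.continuousAt).const_add _
  have hWv : ∀ y ∈ Set.Icc 0 T, W y = v y := by
    intro y hy
    have hFTC : ∫ s in (0 : ℝ)..y, h s = v y - v 0 := by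
      refine intervalIntegral.integral_eq_sub_of_hasDeriv_right ?_ ?_ (hhc.intervalIntegrable _ _)
      · rw [Set.uIcc_of_le hy.1]
        exact hvc.mono (Set.Icc_subset_Icc_right hy.2)
      · intro x hx
        rw [min_eq_left hy.1, max_eq_right hy.1] at hx
        have hxT : x < T := hx.2.trans_le hy.2
        have hxI : x ∈ Set.Icc 0 T := ⟨hx.1.le, hxT.le⟩
        simp only [hh, hwv' x hxI]
        exact ((hv x hxI).2.hasDerivAt (Icc_mem_nhds hx.1 hxT)).hasDerivWithinAt
    simp only [hW, hFTC, add_sub_cancel]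
  have hhper : Function.Periodic h T := fun y => by simp only [hh, hwper y]
  have hWper : Function.Periodic W T := by
    intro y
    have h2 : ∫ s in y..(y + T), h s = 0 := by
      rw [hhper.intervalIntegral_add_eq y 0, zero_add]
      have h3 := hWv T ⟨hT.le, le_rfl⟩
      rw [hvT] at h3
      simpa [hW] using h3
    have h4 := intervalIntegral.integral_add_adjacent_intervals
      (hhc.intervalIntegrable (μ := MeasureTheory.volume) 0 y) (hhc.intervalIntegrable y (y + T))
    simp only [hW, ← h4, h2, add_zero]
  have hWw : W = w := by
    ext1 y
    obtain ⟨k, hk, -⟩ := existsUnique_add_zsmul_mem_Ico hT y 0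
    rw [zero_add] at hk
    have e1 := hWper.zsmul k y
    have e2 := hwper.zsmul k y
    rw [← e1, ← e2, hWv _ (Set.Ico_subset_Icc_self hk), hwv _ hk]
  refine ⟨w, hw0, ?_, hwper⟩
  rw [isProfileOn_iff h1]
  intro y _
  refine ⟨hwU y, ?_⟩
  have := hWd y
  rw [hWw] at this
  exact this.hasDerivWithinAt

theorem H_basePoint (hw : P.IsPeriodicWave ubar X q) (h0 : P.H0) (h1 : P.H1) :
    P.H (basePoint m ubar X q) = 0 := by
  rw [H_eq (θ := basePoint m ubar X q) (v := ubar) h0 h1 hw.period_pos rfl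
    (hw.isProfileOn.mono (Set.subset_univ _))]
  change ubar X - ubar 0 = 0
  rw [sub_eq_zero]
  simpa using hw.periodic 0

theorem finrank_params : Module.finrank ℝ (Params n m) = 2 * n + m + 2 := by
  simp [Module.finrank_prod]
  ring

/-- Coordinates on the kernel of the derivative of `H`, transversal to translations. -/
theorem exists_transversal {L : Params n m →L[ℝ] (Fin n → ℝ)} (hL : Function.Surjective L)
    {t : Params n m} (ht : L t = 0) (ht0 : t ≠ 0) :
    ∃ J : (Fin n ⊕ Fin (m + 1) → ℝ) →L[ℝ] Params n m, (∀ p, L (J p) = 0) ∧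
      ∀ p (τ : ℝ), J p = τ • t → p = 0 := by
  let K : Submodule ℝ (Params n m) := LinearMap.ker (L : Params n m →ₗ[ℝ] (Fin n → ℝ))
  let tK : K := ⟨t, ht⟩
  have htK : tK ≠ 0 := fun h => ht0 (congrArg Subtype.val h)
  obtain ⟨C, hC⟩ := Submodule.exists_isCompl (Submodule.span ℝ {tK})
  have hKdim : Module.finrank ℝ K = n + m + 2 := by
    have h2 := LinearMap.finrank_range_add_finrank_ker (L : Params n m →ₗ[ℝ] (Fin n → ℝ))
    rw [LinearMap.range_eq_top.2 hL, finrank_top, finrank_params, Module.finrank_fin_fun] at h2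
    have : Module.finrank ℝ K = Module.finrank ℝ
      (LinearMap.ker (L : Params n m →ₗ[ℝ] (Fin n → ℝ))) := rfl
    omega
  have hCdim : Module.finrank ℝ C = n + m + 1 := by
    have h2 := Submodule.finrank_add_eq_of_isCompl hC
    rw [finrank_span_singleton htK, hKdim] at h2
    omega
  have : Module.Free ℝ C := Module.Free.of_divisionRing ℝ C
  let e : (Fin n ⊕ Fin (m + 1) → ℝ) ≃ₗ[ℝ] C := LinearEquiv.ofFinrankEq _ _ (by
    rw [hCdim]; simp; ring)
  let J : (Fin n ⊕ Fin (m + 1) → ℝ) →ₗ[ℝ] Params n m := K.subtype ∘ₗ C.subtype ∘ₗ e.toLinearMap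
  refine ⟨LinearMap.toContinuousLinearMap J, fun p => (C.subtype (e p)).2, fun p τ h => ?_⟩
  have h2 : (e p : K) = τ • tK := Subtype.ext h
  have h3 : (e p : K) ∈ Submodule.span ℝ {tK} ⊓ C :=
    ⟨h2 ▸ Submodule.smul_mem _ _ (Submodule.mem_span_singleton_self _), (e p).2⟩
  rw [hC.inf_eq_bot, Submodule.mem_bot] at h3
  have h4 : e p = 0 := Subtype.ext h3
  simpa using h4

theorem exists_isLocalParametrization (hw : P.IsPeriodicWave ubar X q) (h0 : P.H0) (h1 : P.H1)
    (h2 : P.H2 ubar X q) : ∃ ψ, P.IsLocalParametrization ubar X q ψ := by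
  set b := basePoint m ubar X q with hb
  set L := fderiv ℝ P.H b with hLdef
  have hLs : Function.Surjective L := h2
  obtain ⟨V, hV⟩ := exists_isFlow hw h0 h1
  have ht0 : translation m ubar ≠ 0 := fun h =>
    deriv_ubar_ne_zero hw h0 h1 (congrArg (fun p : Params n m => p.2.1) h)
  obtain ⟨J, hJL, hJt⟩ := exists_transversal hLs (fderiv_translation hw h0 h1).1 ht0
  obtain ⟨S', hS'⟩ := (L : Params n m →ₗ[ℝ] (Fin n → ℝ)).exists_rightInverse_of_surjective
    (LinearMap.range_eq_top.2 hLs)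
  let S : (Fin n → ℝ) →L[ℝ] Params n m := LinearMap.toContinuousLinearMap S'
  have hS : ∀ y, L (S y) = y := fun y => LinearMap.congr_fun hS' y
  let Φ : Params n m → Params n m := fun θ => θ - b - S (L (θ - b)) + S (P.H θ)
  have hH := contDiffAt_H hw h0 h1
  have hΦ : ContDiffAt ℝ 1 Φ b := by
    have : ContDiffAt ℝ 1 (fun θ => S (P.H θ)) b := S.contDiff.contDiffAt.comp b hH
    exact ContDiffAt.add (by fun_prop) this
  have hΦ' : HasFDerivAt Φ
      ((ContinuousLinearEquiv.refl ℝ (Params n m) : Params n m ≃L[ℝ] Params n m) :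
        Params n m →L[ℝ] Params n m) b := by
    have e1 : HasFDerivAt (fun θ => θ - b) (ContinuousLinearMap.id ℝ (Params n m)) b :=
      (hasFDerivAt_id b).sub_const b
    have e2 := (S.comp L).hasFDerivAt.comp b e1
    have e3 := S.hasFDerivAt.comp b (hH.differentiableAt one_ne_zero).hasFDerivAt
    refine ((e1.sub e2).add e3).congr_fderiv ?_
    refine ContinuousLinearMap.ext fun η => ?_
    change η - S (L η) + S (L η) = η
    abel
  have hΦb : Φ b = 0 := by
    simp [Φ, hb, H_basePoint hw h0 h1]
  let O := hΦ.toOpenPartialHomeomorph Φ hΦ' one_ne_zero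
  have hsrc : b ∈ O.source := hΦ.mem_toOpenPartialHomeomorph_source hΦ' one_ne_zero
  have hinv : ContDiffAt ℝ 1 O.symm (Φ b) := hΦ.to_localInverse hΦ' one_ne_zero
  have hsymm : O.symm 0 = b := by rw [← hΦb]; exact O.left_inv hsrc
  let ψ : (Fin n ⊕ Fin (m + 1) → ℝ) → Params n m := fun p => O.symm (J p)
  have hψ0 : ψ 0 = b := by simp only [ψ, map_zero, hsymm]
  have hψ : ContDiffAt ℝ 1 ψ 0 := by
    refine ContDiffAt.comp 0 ?_ J.contDiff.contDiffAt
    rw [map_zero, ← hΦb]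
    exact hinv
  have hΦψ : ∀ᶠ p in 𝓝 0, Φ (ψ p) = J p := by
    have htgt : ∀ᶠ z in 𝓝 (J 0), z ∈ O.target := by
      rw [map_zero, ← hΦb]
      exact O.open_target.mem_nhds (O.map_source hsrc)
    filter_upwards [J.continuous.continuousAt.eventually htgt] with p hp
    exact O.right_inv hp
  have hHψ : ∀ᶠ p in 𝓝 0, P.H (ψ p) = 0 := by
    filter_upwards [hΦψ] with p hp
    have := congrArg L hp
    simp only [Φ, map_add, map_sub, hS, hJL] at this
    simpa using this
  have hψ' : fderiv ℝ ψ 0 = J := by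
    have e1 := (hψ.differentiableAt one_ne_zero).hasFDerivAt
    have e2 : HasFDerivAt (fun p => Φ (ψ p))
        (((ContinuousLinearEquiv.refl ℝ (Params n m) : Params n m ≃L[ℝ] Params n m) :
        Params n m →L[ℝ] Params n m).comp (fderiv ℝ ψ 0)) 0 := by
      refine HasFDerivAt.comp (g := Φ) (f := ψ) 0 ?_ e1
      rw [hψ0]
      exact hΦ'
    have e3 := e2.unique (J.hasFDerivAt.congr_of_eventuallyEq hΦψ)
    rw [← e3]
    rfl
  refine ⟨ψ, hψ, hψ0, ?_, ?_⟩
  · have htend : Tendsto ψ (𝓝 0) (𝓝 b) := by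
      have := hψ.continuousAt
      rwa [ContinuousAt, hψ0] at this
    filter_upwards [hHψ, htend.eventually hV.period_pos, htend.eventually hV.start_eq,
      htend.eventually hV.isProfileOn] with p e1 e2 e3 e4
    have hs' : extendI (V (ψ p)) (0 / period (ψ p)) = start (ψ p) := by
      rw [zero_div, extendI_of_mem _ (by simp), ← e3]; rfl
    have e5 := H_eq h0 h1 e2 hs' e4
    rw [e1] at e5
    obtain ⟨w, hw0, hwp, hwper⟩ := exists_periodic_extension h0 h1 e2 e4 (sub_eq_zero.1 e5.symm)
    exact ⟨w, hw0.trans hs', hwp, hwper⟩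
  · intro h τ hτ
    rw [hψ'] at hτ
    exact hJt h τ hτ

end System

section MatrixOperators

variable {ι : Type*} [Fintype ι]

/-- A complex matrix as a real operator. -/
def matCLM : Matrix ι ι ℂ →ₗ[ℝ] ((ι → ℂ) →L[ℝ] (ι → ℂ)) where
  toFun A := LinearMap.toContinuousLinearMap ((Matrix.mulVecLin A).restrictScalars ℝ)
  map_add' A B := by
    ext1 v
    exact Matrix.add_mulVec A B v
  map_smul' c A := by
    ext1 v
    exact Matrix.smul_mulVec c A v

theorem matCLM_apply (A : Matrix ι ι ℂ) (v : ι → ℂ) : matCLM A v = A *ᵥ v := rfl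

theorem continuous_matCLM {A : ℝ → Matrix ι ι ℂ} (hA : Continuous A) :
    Continuous fun x => matCLM (A x) :=
  (LinearMap.continuous_of_finiteDimensional
    (matCLM : Matrix ι ι ℂ →ₗ[ℝ] ((ι → ℂ) →L[ℝ] (ι → ℂ)))).comp hA

theorem analyticAt_quadratic {Z : Type*} [NormedAddCommGroup Z] [NormedSpace ℝ Z] {m : ℕ}
    (c₀ c₁ c₂ : Z) (c : Fin m → Z) (d : Fin m → Fin m → Z) (p : (Fin m → ℝ) × ℂ) :
    AnalyticAt ℝ (fun p : (Fin m → ℝ) × ℂ => c₀ + p.2.re • c₁ + p.2.im • c₂ +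
      ∑ k, p.1 k • c k + ∑ j, ∑ k, (p.1 j * p.1 k) • d j k) p := by
  have hre : AnalyticAt ℝ (fun p : (Fin m → ℝ) × ℂ => p.2.re) p :=
    (Complex.reCLM.comp (ContinuousLinearMap.snd ℝ (Fin m → ℝ) ℂ)).analyticAt p
  have him : AnalyticAt ℝ (fun p : (Fin m → ℝ) × ℂ => p.2.im) p :=
    (Complex.imCLM.comp (ContinuousLinearMap.snd ℝ (Fin m → ℝ) ℂ)).analyticAt p
  have hk : ∀ k, AnalyticAt ℝ (fun p : (Fin m → ℝ) × ℂ => p.1 k) p := fun k =>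
    ((ContinuousLinearMap.proj (R := ℝ) (φ := fun _ : Fin m => ℝ) k).comp
      (ContinuousLinearMap.fst ℝ (Fin m → ℝ) ℂ)).analyticAt p
  refine AnalyticAt.add (AnalyticAt.add (AnalyticAt.add (AnalyticAt.add analyticAt_const ?_) ?_)
    ?_) ?_
  · exact hre.smul analyticAt_const
  · exact him.smul analyticAt_const
  · exact Finset.analyticAt_fun_sum _ fun k _ => (hk k).smul analyticAt_const
  · exact Finset.analyticAt_fun_sum _ fun j _ => Finset.analyticAt_fun_sum _ fun k _ =>
      ((hk j).mul (hk k)).smul analyticAt_const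

end MatrixOperators

namespace System

variable {n m : ℕ} (P : System n m) (ubar : ℝ → Fin n → ℝ)

/-- The inverse of `B^{11}(ubar)`, as a complex matrix. -/
def coeffBinv (x : ℝ) : Matrix (Fin n) (Fin n) ℂ := (P.B 0 0 (ubar x))⁻¹.map Complex.ofReal

/-- The part of order zero of the first-order system equivalent to the eigenvalue equation. -/
def sysZero (x : ℝ) : Matrix (Fin n ⊕ Fin n) (Fin n ⊕ Fin n) ℂ :=
  Matrix.fromBlocks (P.coeffBinv ubar x * P.coeffA ubar 0 x) (P.coeffBinv ubar x) 0 0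

/-- The coefficient of `λ` of the first-order system. -/
def sysLam (n : ℕ) : Matrix (Fin n ⊕ Fin n) (Fin n ⊕ Fin n) ℂ := Matrix.fromBlocks 0 0 1 0

/-- The coefficient of `ξ_k` of the first-order system. -/
def sysLin (k : Fin m) (x : ℝ) : Matrix (Fin n ⊕ Fin n) (Fin n ⊕ Fin n) ℂ :=
  Matrix.fromBlocks (-Complex.I • (P.coeffBinv ubar x * P.coeffB ubar 0 k.succ x)) 0
    (Complex.I • (P.coeffA ubar k.succ x -
      P.coeffB ubar k.succ 0 x * (P.coeffBinv ubar x * P.coeffA ubar 0 x)))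
    (-Complex.I • (P.coeffB ubar k.succ 0 x * P.coeffBinv ubar x))

/-- The coefficient of `ξ_j ξ_k` of the first-order system. -/
def sysQuad (j k : Fin m) (x : ℝ) : Matrix (Fin n ⊕ Fin n) (Fin n ⊕ Fin n) ℂ :=
  Matrix.fromBlocks 0 0 (P.coeffB ubar j.succ k.succ x -
    P.coeffB ubar j.succ 0 x * (P.coeffBinv ubar x * P.coeffB ubar 0 k.succ x)) 0

/-- The matrix of the first-order system in the variables `(w, z)`, with
`z = B^{11} w' - A^1 w + i ∑ ξ_k B^{1k} w`, equivalent to the eigenvalue equation. -/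
def sysMatrix (ξt : Fin m → ℝ) (lam : ℂ) (x : ℝ) : Matrix (Fin n ⊕ Fin n) (Fin n ⊕ Fin n) ℂ :=
  P.sysZero ubar x + lam • sysLam n + ∑ k, (ξt k : ℂ) • P.sysLin ubar k x +
    ∑ j, ∑ k, ((ξt j : ℂ) * (ξt k : ℂ)) • P.sysQuad ubar j k x

/-- The first component of the vector field of the first-order system. -/
def sysFst (ξt : Fin m → ℝ) (x : ℝ) (w z : Fin n → ℂ) : Fin n → ℂ :=
  P.coeffBinv ubar x *ᵥ (z + P.coeffA ubar 0 x *ᵥ w -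
    Complex.I • ∑ k : Fin m, (ξt k : ℂ) • (P.coeffB ubar 0 k.succ x *ᵥ w))

/-- The second component of the vector field of the first-order system, in terms of `w` and the
derivative `w'`. -/
def sysSnd (ξt : Fin m → ℝ) (lam : ℂ) (x : ℝ) (w w' : Fin n → ℂ) : Fin n → ℂ :=
  lam • w + Complex.I • ∑ j : Fin m, (ξt j : ℂ) • (P.coeffA ubar j.succ x *ᵥ w) -
    Complex.I • ∑ j : Fin m, (ξt j : ℂ) • (P.coeffB ubar j.succ 0 x *ᵥ w') +
    ∑ j : Fin m, ∑ k : Fin m,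
      ((ξt j : ℂ) * (ξt k : ℂ)) • (P.coeffB ubar j.succ k.succ x *ᵥ w)

variable {P ubar}

theorem smul_elim_elim {R A : Type*} [SMul R A] {α β : Type*} (c : R) (u : α → A) (v : β → A) :
    c • Sum.elim u v = Sum.elim (c • u) (c • v) := by
  ext (i | i) <;> rfl

theorem sum_elim_elim {A : Type*} [AddCommMonoid A] {α β κ : Type*} (s : Finset κ)
    (u : κ → α → A) (v : κ → β → A) :
    ∑ k ∈ s, Sum.elim (u k) (v k) = Sum.elim (∑ k ∈ s, u k) (∑ k ∈ s, v k) := by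
  ext (i | i) <;> simp

theorem elim_add_elim {A : Type*} [Add A] {α β : Type*} (u u' : α → A) (v v' : β → A) :
    Sum.elim u v + Sum.elim u' v' = Sum.elim (u + u') (v + v') := by
  ext (i | i) <;> rfl

theorem sysMatrix_mulVec (ξt : Fin m → ℝ) (lam : ℂ) (x : ℝ) (w z : Fin n → ℂ) :
    P.sysMatrix ubar ξt lam x *ᵥ Sum.elim w z =
      Sum.elim (P.sysFst ubar ξt x w z) (P.sysSnd ubar ξt lam x w (P.sysFst ubar ξt x w z)) := by
  simp only [sysMatrix, sysZero, sysLam, sysLin, sysQuad, Matrix.add_mulVec, Matrix.sum_mulVec,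
    Matrix.smul_mulVec, Matrix.fromBlocks_mulVec, Sum.elim_comp_inl,
    Sum.elim_comp_inr, Matrix.zero_mulVec, Matrix.one_mulVec, add_zero, zero_add,
    smul_elim_elim, sum_elim_elim, elim_add_elim, smul_zero, Finset.sum_const_zero]
  congr 1
  · simp only [sysFst, Matrix.mulVec_sub, Matrix.mulVec_add, Matrix.mulVec_smul,
      Matrix.mulVec_sum, Matrix.mulVec_mulVec, Finset.smul_sum, neg_smul, smul_neg,
      Finset.sum_neg_distrib, ← sub_eq_add_neg, smul_comm Complex.I]
    abel
  · have hI : ∀ (a b : ℂ) (v : Fin n → ℂ),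
        Complex.I • a • (Complex.I • b • v) = -((a * b) • v) := by
      intro a b v
      ext i
      simp only [Pi.smul_apply, Pi.neg_apply, smul_eq_mul]
      linear_combination (a * b * v i) * Complex.I_mul_I
    simp only [sysSnd, sysFst, Matrix.mulVec_sub, Matrix.mulVec_add, Matrix.mulVec_smul,
      Matrix.mulVec_sum, Matrix.mulVec_mulVec, Finset.smul_sum, hI, smul_sub, smul_add,
      Matrix.sub_mulVec, Finset.sum_sub_distrib, Finset.sum_add_distrib, neg_smul, smul_neg,
      Finset.sum_neg_distrib]
    simp only [smul_comm Complex.I]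
    abel

section Regularity

variable {X : ℝ} {q : Fin n → ℝ}

theorem contDiff_ofReal_comp {k : WithTop ℕ∞} {g : ℝ → ℝ} (hg : ContDiff ℝ k g) :
    ContDiff ℝ k fun x => (g x : ℂ) := Complex.ofRealCLM.contDiff.comp hg

theorem contDiff_comp_ubar (hw : P.IsPeriodicWave ubar X q) (h0 : P.H0) (h1 : P.H1)
    {F : Type*} [NormedAddCommGroup F] [NormedSpace ℝ F] {k : WithTop ℕ∞} (hk : k ≤ 2)
    {h : (Fin n → ℝ) → F} (hh : ContDiffOn ℝ k h P.U) : ContDiff ℝ k fun x => h (ubar x) := by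
  rw [contDiff_iff_contDiffAt]
  intro x
  exact (hh.contDiffAt (P.isOpen_U.mem_nhds (hw.mem_U x))).comp x
    ((hw.contDiff h0 h1).of_le hk).contDiffAt

theorem contDiff_coeffB (hw : P.IsPeriodicWave ubar X q) (h0 : P.H0) (h1 : P.H1)
    (j k : Fin (m + 1)) (a b : Fin n) : ContDiff ℝ 1 fun x => P.coeffB ubar j k x a b :=
  contDiff_ofReal_comp (contDiff_comp_ubar hw h0 h1 one_le_two ((h0.2 j k a b).of_le one_le_two))

theorem contDiff_realA (hw : P.IsPeriodicWave ubar X q) (h0 : P.H0) (h1 : P.H1)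
    (j : Fin (m + 1)) (a b : Fin n) : ContDiff ℝ 1 fun x => P.realA ubar j x a b := by
  have hone : (1 : WithTop ℕ∞) + 1 ≤ 2 := by norm_num
  have hd : ContDiff ℝ 1 (deriv ubar) := by
    have h2 : ContDiff ℝ (1 + 1) ubar := (hw.contDiff h0 h1).of_le hone
    exact (contDiff_succ_iff_deriv.1 h2).2.2
  simp only [realA, Matrix.of_apply]
  refine ContDiff.sub ?_ (ContDiff.sum fun c _ => ContDiff.mul ?_ (contDiff_pi.1 hd c))
  · have h2 : ContDiff ℝ 1 fun x => fderiv ℝ (P.f j) (ubar x) :=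
      contDiff_comp_ubar hw h0 h1 one_le_two ((h0.1 j).fderiv_of_isOpen P.isOpen_U hone)
    exact contDiff_pi.1 (h2.clm_apply contDiff_const) a
  · have h2 : ContDiff ℝ 1 fun x => fderiv ℝ (fun u => P.B j 0 u a c) (ubar x) :=
      contDiff_comp_ubar hw h0 h1 one_le_two ((h0.2 j 0 a c).fderiv_of_isOpen P.isOpen_U hone)
    exact h2.clm_apply contDiff_const

theorem contDiff_coeffA (hw : P.IsPeriodicWave ubar X q) (h0 : P.H0) (h1 : P.H1)
    (j : Fin (m + 1)) (a b : Fin n) : ContDiff ℝ 1 fun x => P.coeffA ubar j x a b :=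
  contDiff_ofReal_comp (contDiff_realA hw h0 h1 j a b)

theorem viscosity_basePoint (u : Fin n → ℝ) : P.viscosity (basePoint m ubar X q) u = P.B 0 0 u := by
  simp only [viscosity, normal_basePoint, Fin.sum_univ_succ, Pi.single_eq_same,
    Pi.single_eq_of_ne (Fin.succ_ne_zero _), zero_mul, mul_zero, zero_smul, one_mul, one_smul,
    Finset.sum_const_zero, add_zero]

theorem det_B_ne_zero (hw : P.IsPeriodicWave ubar X q) (h1 : P.H1) (x : ℝ) :
    (P.B 0 0 (ubar x)).det ≠ 0 := by
  have := det_viscosity_ne_zero h1 (basePoint m ubar X q) (hw.mem_U x)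
  rwa [viscosity_basePoint] at this

theorem contDiff_coeffBinv (hw : P.IsPeriodicWave ubar X q) (h0 : P.H0) (h1 : P.H1)
    (a b : Fin n) : ContDiff ℝ 1 fun x => P.coeffBinv ubar x a b :=
  contDiff_ofReal_comp (contDiffOn_univ.1 (contDiffOn_matrix_inv (fun i j => contDiffOn_univ.2
    (contDiff_comp_ubar hw h0 h1 one_le_two ((h0.2 0 0 i j).of_le one_le_two)))
    (fun x _ => det_B_ne_zero hw h1 x) a b))

theorem coeffB_mul_coeffBinv (hw : P.IsPeriodicWave ubar X q) (h1 : P.H1) (x : ℝ) :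
    P.coeffB ubar 0 0 x * P.coeffBinv ubar x = 1 := by
  have h2 := Matrix.mul_nonsing_inv (P.B 0 0 (ubar x))
    (isUnit_iff_ne_zero.2 (det_B_ne_zero hw h1 x))
  have h3 := congrArg (fun A : Matrix (Fin n) (Fin n) ℝ => A.map Complex.ofRealHom) h2
  rw [Matrix.map_mul, Matrix.map_one _ (map_zero _) (map_one _)] at h3
  exact h3

theorem coeffBinv_mul_coeffB (hw : P.IsPeriodicWave ubar X q) (h1 : P.H1) (x : ℝ) :
    P.coeffBinv ubar x * P.coeffB ubar 0 0 x = 1 :=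
  mul_eq_one_comm.1 (coeffB_mul_coeffBinv hw h1 x)

theorem contDiff_mulVec {ι : Type*} [Fintype ι] {k : WithTop ℕ∞} {A : ℝ → Matrix ι ι ℂ}
    {b : ℝ → ι → ℂ} (hA : ∀ i j, ContDiff ℝ k fun x => A x i j) (hb : ContDiff ℝ k b) :
    ContDiff ℝ k fun x => A x *ᵥ b x :=
  contDiffOn_univ.1 (contDiffOn_mulVec (fun i j => (hA i j).contDiffOn) hb.contDiffOn)

theorem continuous_of_entries {ι κ : Type*} {A : ℝ → Matrix ι κ ℂ}
    (hA : ∀ i j, ContDiff ℝ 1 fun x => A x i j) : Continuous A :=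
  continuous_matrix fun i j => (hA i j).continuous

theorem continuous_sysZero (hw : P.IsPeriodicWave ubar X q) (h0 : P.H0) (h1 : P.H1) :
    Continuous (P.sysZero ubar) :=
  have hi := continuous_of_entries (contDiff_coeffBinv hw h0 h1)
  Continuous.matrix_fromBlocks (hi.matrix_mul (continuous_of_entries (contDiff_coeffA hw h0 h1 0)))
    hi continuous_const continuous_const

theorem continuous_sysLin (hw : P.IsPeriodicWave ubar X q) (h0 : P.H0) (h1 : P.H1) (k : Fin m) :
    Continuous (P.sysLin ubar k) :=
  have hi := continuous_of_entries (contDiff_coeffBinv hw h0 h1)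
  have hA := fun j => continuous_of_entries (contDiff_coeffA hw h0 h1 j)
  have hB := fun j k => continuous_of_entries (contDiff_coeffB hw h0 h1 j k)
  Continuous.matrix_fromBlocks ((hi.matrix_mul (hB 0 k.succ)).const_smul (-Complex.I))
    continuous_const
    (((hA k.succ).sub ((hB k.succ 0).matrix_mul (hi.matrix_mul (hA 0)))).const_smul Complex.I)
    (((hB k.succ 0).matrix_mul hi).const_smul (-Complex.I))

theorem continuous_sysQuad (hw : P.IsPeriodicWave ubar X q) (h0 : P.H0) (h1 : P.H1)
    (j k : Fin m) : Continuous (P.sysQuad ubar j k) :=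
  have hi := continuous_of_entries (contDiff_coeffBinv hw h0 h1)
  have hB := fun j k => continuous_of_entries (contDiff_coeffB hw h0 h1 j k)
  Continuous.matrix_fromBlocks continuous_const continuous_const
    ((hB j.succ k.succ).sub ((hB j.succ 0).matrix_mul (hi.matrix_mul (hB 0 k.succ))))
    continuous_const

theorem continuous_sysMatrix (hw : P.IsPeriodicWave ubar X q) (h0 : P.H0) (h1 : P.H1)
    (ξt : Fin m → ℝ) (lam : ℂ) : Continuous (P.sysMatrix ubar ξt lam) := by
  have hZ := continuous_sysZero hw h0 h1
  have hL := continuous_sysLin hw h0 h1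
  have hQ := continuous_sysQuad hw h0 h1
  unfold sysMatrix
  fun_prop

/-- The flux variable `z = B^{11} w' - A^1 w + i ∑ ξ_k B^{1k} w`. -/
def fluxVar (P : System n m) (ubar : ℝ → Fin n → ℝ) (ξt : Fin m → ℝ) (x : ℝ) (w w' : Fin n → ℂ) :
    Fin n → ℂ :=
  P.coeffB ubar 0 0 x *ᵥ w' - P.coeffA ubar 0 x *ᵥ w +
    Complex.I • ∑ k : Fin m, (ξt k : ℂ) • (P.coeffB ubar 0 k.succ x *ᵥ w)

theorem sysFst_fluxVar (hw : P.IsPeriodicWave ubar X q) (h1 : P.H1) (ξt : Fin m → ℝ) (x : ℝ)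
    (w w' : Fin n → ℂ) : P.sysFst ubar ξt x w (P.fluxVar ubar ξt x w w') = w' := by
  have : P.fluxVar ubar ξt x w w' + P.coeffA ubar 0 x *ᵥ w -
      Complex.I • ∑ k : Fin m, (ξt k : ℂ) • (P.coeffB ubar 0 k.succ x *ᵥ w) =
      P.coeffB ubar 0 0 x *ᵥ w' := by
    rw [fluxVar]; abel
  rw [sysFst, this, Matrix.mulVec_mulVec, coeffBinv_mul_coeffB hw h1, Matrix.one_mulVec]

theorem fluxVar_sysFst (hw : P.IsPeriodicWave ubar X q) (h1 : P.H1) (ξt : Fin m → ℝ) (x : ℝ)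
    (w z : Fin n → ℂ) : P.fluxVar ubar ξt x w (P.sysFst ubar ξt x w z) = z := by
  rw [fluxVar, sysFst, Matrix.mulVec_mulVec, coeffB_mul_coeffBinv hw h1, Matrix.one_mulVec]
  abel

/-- The eigenvalue equation as a first-order system. -/
theorem IsEigensolution.hasDerivAt (hw : P.IsPeriodicWave ubar X q) (h0 : P.H0) (h1 : P.H1)
    {ξt : Fin m → ℝ} {lam : ℂ} {w : ℝ → Fin n → ℂ} (h : P.IsEigensolution ubar ξt lam w) (x : ℝ) :
    HasDerivAt (fun x => Sum.elim (w x) (P.fluxVar ubar ξt x (w x) (deriv w x)))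
      (P.sysMatrix ubar ξt lam x *ᵥ Sum.elim (w x) (P.fluxVar ubar ξt x (w x) (deriv w x))) x := by
  obtain ⟨hC, heq⟩ := h
  have hC1 : ContDiff ℝ 1 w := hC.of_le one_le_two
  have hC' : ContDiff ℝ 1 (deriv w) := by
    have h2 : ContDiff ℝ (1 + 1) w := hC.of_le (by norm_num)
    exact (contDiff_succ_iff_deriv.1 h2).2.2
  rw [sysMatrix_mulVec, sysFst_fluxVar hw h1]
  have hd1 : DifferentiableAt ℝ (fun y => P.coeffB ubar 0 0 y *ᵥ deriv w y) x :=
    (contDiff_mulVec (contDiff_coeffB hw h0 h1 0 0) hC').differentiable one_ne_zero x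
  have hd2 : DifferentiableAt ℝ (fun y => P.coeffA ubar 0 y *ᵥ w y) x :=
    (contDiff_mulVec (contDiff_coeffA hw h0 h1 0) hC1).differentiable one_ne_zero x
  have hd3 : DifferentiableAt ℝ (fun y => ∑ k : Fin m,
      (ξt k : ℂ) • (P.coeffB ubar 0 k.succ y *ᵥ w y)) x := by
    refine (ContDiff.sum fun k _ => ContDiff.const_smul (ξt k : ℂ) ?_).differentiable one_ne_zero x
    exact contDiff_mulVec (contDiff_coeffB hw h0 h1 0 k.succ) hC1
  have hz : HasDerivAt (fun x => P.fluxVar ubar ξt x (w x) (deriv w x)) _ x :=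
    (hd1.hasDerivAt.sub hd2.hasDerivAt).add (hd3.hasDerivAt.const_smul Complex.I)
  have hsnd : deriv (fun y => P.coeffB ubar 0 0 y *ᵥ deriv w y) x -
      deriv (fun y => P.coeffA ubar 0 y *ᵥ w y) x +
      Complex.I • deriv (fun y => ∑ k : Fin m,
        (ξt k : ℂ) • (P.coeffB ubar 0 k.succ y *ᵥ w y)) x =
      P.sysSnd ubar ξt lam x (w x) (deriv w x) := by
    have h3 := heq x
    simp only [sysSnd]
    simp only [mul_comm ((ξt _ : ℂ)) (ξt _ : ℂ)] at h3 ⊢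
    rw [← sub_eq_zero, ← h3]
    abel
  rw [hsnd] at hz
  have hw' : HasDerivAt w (deriv w x) x := (hC1.differentiable one_ne_zero x).hasDerivAt
  rw [hasDerivAt_pi] at hz hw' ⊢
  rintro (a | a)
  · exact hw' a
  · exact hz a

theorem isEigensolution_of_hasDerivAt (hw : P.IsPeriodicWave ubar X q) (h0 : P.H0) (h1 : P.H1)
    {ξt : Fin m → ℝ} {lam : ℂ} {y : ℝ → Fin n ⊕ Fin n → ℂ}
    (hy : ∀ x, HasDerivAt y (P.sysMatrix ubar ξt lam x *ᵥ y x) x) :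
    P.IsEigensolution ubar ξt lam (fun x a => y x (Sum.inl a)) ∧
      ∀ x, deriv (fun x a => y x (Sum.inl a)) x =
        P.sysFst ubar ξt x (fun a => y x (Sum.inl a)) (fun a => y x (Sum.inr a)) := by
  set w : ℝ → Fin n → ℂ := fun x a => y x (Sum.inl a) with hwdef
  set z : ℝ → Fin n → ℂ := fun x a => y x (Sum.inr a) with hzdef
  have helim : ∀ x, y x = Sum.elim (w x) (z x) := by
    intro x; ext (a | a) <;> rfl
  have hy' : ∀ x, HasDerivAt y (Sum.elim (P.sysFst ubar ξt x (w x) (z x))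
      (P.sysSnd ubar ξt lam x (w x) (P.sysFst ubar ξt x (w x) (z x)))) x := by
    intro x
    have := hy x
    rwa [helim x, sysMatrix_mulVec] at this
  have hwd : ∀ x, HasDerivAt w (P.sysFst ubar ξt x (w x) (z x)) x := fun x =>
    hasDerivAt_pi.2 fun a => hasDerivAt_pi.1 (hy' x) (Sum.inl a)
  have hzd : ∀ x, HasDerivAt z (P.sysSnd ubar ξt lam x (w x) (P.sysFst ubar ξt x (w x) (z x))) x :=
    fun x => hasDerivAt_pi.2 fun a => hasDerivAt_pi.1 (hy' x) (Sum.inr a)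
  have hyc : Continuous y := continuous_iff_continuousAt.2 fun x => (hy x).continuousAt
  have hyC : ContDiff ℝ 1 y := by
    rw [contDiff_one_iff_deriv]
    refine ⟨fun x => (hy x).differentiableAt, ?_⟩
    have : deriv y = fun x => P.sysMatrix ubar ξt lam x *ᵥ y x := funext fun x => (hy x).deriv
    rw [this]
    exact (continuous_sysMatrix hw h0 h1 ξt lam).matrix_mulVec hyc
  have hwC : ContDiff ℝ 1 w := contDiff_pi.2 fun a => contDiff_pi.1 hyC (Sum.inl a)
  have hzC : ContDiff ℝ 1 z := contDiff_pi.2 fun a => contDiff_pi.1 hyC (Sum.inr a)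
  have hderw : deriv w = fun x => P.sysFst ubar ξt x (w x) (z x) :=
    funext fun x => (hwd x).deriv
  have hC2 : ContDiff ℝ 1 fun y => P.coeffA ubar 0 y *ᵥ w y :=
    contDiff_mulVec (contDiff_coeffA hw h0 h1 0) hwC
  have hC3 : ContDiff ℝ 1 (fun y => ∑ k : Fin m,
      (ξt k : ℂ) • (P.coeffB ubar 0 k.succ y *ᵥ w y)) :=
    ContDiff.sum fun k _ => ContDiff.const_smul (ξt k : ℂ)
      (contDiff_mulVec (contDiff_coeffB hw h0 h1 0 k.succ) hwC)
  have hwC' : ContDiff ℝ 1 (deriv w) := by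
    rw [hderw]
    exact contDiff_mulVec (contDiff_coeffBinv hw h0 h1)
      ((hzC.add hC2).sub (hC3.const_smul Complex.I))
  have hwC2 : ContDiff ℝ 2 w := by
    have h2 := contDiff_succ_iff_deriv (n := 1) (f := w).2
      ⟨fun x => (hwd x).differentiableAt, by simp, hwC'⟩
    simpa [one_add_one_eq_two] using h2
  refine ⟨⟨hwC2, fun x => ?_⟩, fun x => congrFun hderw x⟩
  have hBw : (fun y => P.coeffB ubar 0 0 y *ᵥ deriv w y) = fun y => z y + P.coeffA ubar 0 y *ᵥ w y -
      Complex.I • ∑ k : Fin m, (ξt k : ℂ) • (P.coeffB ubar 0 k.succ y *ᵥ w y) := by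
    ext1 y
    rw [hderw]
    simp only [sysFst]
    rw [Matrix.mulVec_mulVec, coeffB_mul_coeffBinv hw h1, Matrix.one_mulVec]
  have hd := ((hzd x).add (hC2.differentiable one_ne_zero x).hasDerivAt).sub
    ((hC3.differentiable one_ne_zero x).hasDerivAt.const_smul Complex.I)
  have hd' : deriv (fun y => P.coeffB ubar 0 0 y *ᵥ deriv w y) x =
      P.sysSnd ubar ξt lam x (w x) (P.sysFst ubar ξt x (w x) (z x)) +
        deriv (fun y => P.coeffA ubar 0 y *ᵥ w y) x -
        Complex.I • deriv (fun y => ∑ k : Fin m,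
          (ξt k : ℂ) • (P.coeffB ubar 0 k.succ y *ᵥ w y)) x := by
    rw [hBw]; exact hd.deriv
  rw [hd', ← (hwd x).deriv]
  simp only [sysSnd]
  simp only [mul_comm ((ξt _ : ℂ)) (ξt _ : ℂ)]
  abel

theorem sysCLM_decomposition (ξt : Fin m → ℝ) (lam : ℂ) (x : ℝ) :
    matCLM (P.sysMatrix ubar ξt lam x) = matCLM (P.sysZero ubar x) + lam.re • matCLM (sysLam n) +
      lam.im • matCLM (Complex.I • sysLam n) + ∑ k, ξt k • matCLM (P.sysLin ubar k x) +
      ∑ j, ∑ k, (ξt j * ξt k) • matCLM (P.sysQuad ubar j k x) := by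
  have hlam : lam • sysLam n = lam.re • sysLam n + lam.im • (Complex.I • sysLam n) := by
    ext i j
    simp only [Matrix.smul_apply, Matrix.add_apply, smul_eq_mul, Complex.real_smul]
    conv_lhs => rw [← Complex.re_add_im lam]
    ring
  simp only [← map_smul, ← map_sum, ← map_add]
  have hlin : ∀ k, (ξt k : ℂ) • P.sysLin ubar k x = ξt k • P.sysLin ubar k x := by
    intro k; ext; simp
  have hquad : ∀ j k, ((ξt j : ℂ) * (ξt k : ℂ)) • P.sysQuad ubar j k x =
      (ξt j * ξt k) • P.sysQuad ubar j k x := by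
    intro j k; ext; simp
  rw [sysMatrix, hlam, ← add_assoc]
  simp only [hlin, hquad]

/-- The coefficient operators of the first-order system. -/
def sysCLM (P : System n m) (ubar : ℝ → Fin n → ℝ) (p : (Fin m → ℝ) × ℂ) (x : ℝ) :
    (Fin n ⊕ Fin n → ℂ) →L[ℝ] (Fin n ⊕ Fin n → ℂ) := matCLM (P.sysMatrix ubar p.1 p.2 x)

theorem continuous_sysCLM (hw : P.IsPeriodicWave ubar X q) (h0 : P.H0) (h1 : P.H1)
    (p : (Fin m → ℝ) × ℂ) : Continuous (P.sysCLM ubar p) :=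
  continuous_matCLM (continuous_sysMatrix hw h0 h1 p.1 p.2)

theorem analyticAt_sysCLM (x : ℝ) (p : (Fin m → ℝ) × ℂ) :
    AnalyticAt ℝ (fun p => P.sysCLM ubar p x) p := by
  simp only [sysCLM, sysCLM_decomposition]
  exact analyticAt_quadratic _ _ _ (fun k => matCLM (P.sysLin ubar k x))
    (fun j k => matCLM (P.sysQuad ubar j k x)) p

theorem analyticAt_rescale_sysCLM (hw : P.IsPeriodicWave ubar X q) (h0 : P.H0) (h1 : P.H1) (x : ℝ)
    (p : (Fin m → ℝ) × ℂ) :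
    AnalyticAt ℝ (fun p => rescale (P.sysCLM ubar p) (continuous_sysCLM hw h0 h1 p) x) p := by
  have hZ := continuous_matCLM (continuous_sysZero hw h0 h1)
  have hL := fun k => continuous_matCLM (continuous_sysLin hw h0 h1 k)
  have hQ := fun j k => continuous_matCLM (continuous_sysQuad hw h0 h1 j k)
  have hcl : Continuous fun _ : ℝ => matCLM (sysLam n) := continuous_const
  have hcl' : Continuous fun _ : ℝ => matCLM (Complex.I • sysLam n) := continuous_const
  have heq : (fun p : (Fin m → ℝ) × ℂ =>
      rescale (P.sysCLM ubar p) (continuous_sysCLM hw h0 h1 p) x) = fun p =>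
      rescale _ hZ x + p.2.re • rescale _ hcl x + p.2.im • rescale _ hcl' x +
        ∑ k, p.1 k • rescale _ (hL k) x + ∑ j, ∑ k, (p.1 j * p.1 k) • rescale _ (hQ j k) x := by
    funext p
    ext1 t
    simp only [rescale, sysCLM, sysCLM_decomposition, ContinuousMap.coe_mk,
      ContinuousMap.add_apply, ContinuousMap.smul_apply, ContinuousMap.sum_apply, smul_add,
      Finset.smul_sum, smul_comm x]
  rw [heq]
  exact analyticAt_quadratic _ _ _ (fun k => rescale _ (hL k) x)
    (fun j k => rescale _ (hQ j k) x) p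

theorem exists_isKernelBasis (hw : P.IsPeriodicWave ubar X q) (h0 : P.H0) (h1 : P.H1) :
    ∃ w, P.IsKernelBasis ubar w := by
  let y : Fin n ⊕ Fin n → (Fin m → ℝ) × ℂ → ℝ → Fin n ⊕ Fin n → ℂ := fun l p x =>
    linearFlow (P.sysCLM ubar p) (continuous_sysCLM hw h0 h1 p) (Pi.single l 1) x
  have hy : ∀ l p x, HasDerivAt (y l p) (P.sysMatrix ubar p.1 p.2 x *ᵥ y l p x) x := fun l p x =>
    hasDerivAt_linearFlow _ _ _ x
  have hy0 : ∀ l p, y l p 0 = Pi.single l 1 := fun l p => linearFlow_zero _ _ _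
  have hyan : ∀ l x p, AnalyticAt ℝ (fun p => y l p x) p := fun l x p =>
    analyticAt_linearFlow _ _ _ _ _ (analyticAt_rescale_sysCLM hw h0 h1 x p)
  have hsol := fun l ξt lam => isEigensolution_of_hasDerivAt (ξt := ξt) (lam := lam) hw h0 h1
    (hy l (ξt, lam))
  let pr : (Fin n ⊕ Fin n → ℂ) →L[ℝ] (Fin n → ℂ) :=
    ContinuousLinearMap.pi fun a => ContinuousLinearMap.proj (Sum.inl a)
  refine ⟨fun l ξt lam x a => y l (ξt, lam) x (Sum.inl a), fun l ξt lam => (hsol l ξt lam).1,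
    ?_, ?_, ?_⟩
  · intro ξt lam
    rw [Fintype.linearIndependent_iff]
    intro c hc l
    have hsum : ∀ x, ∑ l, c l • (fun a => y l (ξt, lam) x (Sum.inl a)) = (0 : Fin n → ℂ) := by
      intro x
      have := congrFun hc x
      simpa using this
    let Y : ℝ → Fin n ⊕ Fin n → ℂ := fun x => ∑ l, c l • y l (ξt, lam) x
    have hY : ∀ x, HasDerivAt Y (P.sysMatrix ubar ξt lam x *ᵥ Y x) x := by
      intro x
      simp only [Y, Matrix.mulVec_sum, Matrix.mulVec_smul]
      exact HasDerivAt.fun_sum fun l _ => (hy l (ξt, lam) x).const_smul (c l)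
    have hYw : ∀ x, (fun a => Y x (Sum.inl a)) = (0 : Fin n → ℂ) := by
      intro x
      rw [← hsum x]
      ext a
      simp [Y]
    have h2 := (isEigensolution_of_hasDerivAt hw h0 h1 hY).2 0
    have h3 := fluxVar_sysFst hw h1 ξt 0 (fun a => Y 0 (Sum.inl a)) (fun a => Y 0 (Sum.inr a))
    rw [← h2] at h3
    have hYw' : (fun x a => Y x (Sum.inl a)) = fun _ => (0 : Fin n → ℂ) := funext hYw
    rw [hYw', hYw 0] at h3
    have hz : (fun a => Y 0 (Sum.inr a)) = (0 : Fin n → ℂ) := by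
      rw [← h3]
      simp [fluxVar]
    have hY0 : Y 0 = c := by
      ext l
      simp only [Y, hy0, Finset.sum_apply, Pi.smul_apply, Pi.single_apply, smul_eq_mul, mul_ite,
        mul_one, mul_zero]
      rw [Finset.sum_ite_eq Finset.univ l c, if_pos (Finset.mem_univ l)]
    rw [← hY0]
    rcases l with a | a
    · exact congrFun (hYw 0) a
    · exact congrFun hz a
  · intro l x p _
    exact (pr.analyticAt _).comp (hyan l x p)
  · intro l x p _
    have : (fun p : (Fin m → ℝ) × ℂ => deriv (fun x a => y l (p.1, p.2) x (Sum.inl a)) x) =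
        fun p => pr (P.sysCLM ubar p x (y l p x)) := by
      funext p
      have hd := hasDerivAt_pi.1 (hy l p x)
      exact HasDerivAt.deriv (hasDerivAt_pi.2 fun a => hd (Sum.inl a))
    rw [this]
    exact (pr.analyticAt _).comp
      ((ContinuousLinearMap.analyticAt_bilinear (ContinuousLinearMap.id ℝ
        ((Fin n ⊕ Fin n → ℂ) →L[ℝ] (Fin n ⊕ Fin n → ℂ))) _).comp₂
        (analyticAt_sysCLM x p) (hyan l x p))

end Regularity

end System

namespace System

variable {n m : ℕ}

/-- Indices of the coordinates `s`, `a`, `q`, `(X, δ)` of the parameters. -/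
abbrev Coord (n m : ℕ) : Type := Unit ⊕ ((Fin n ⊕ Fin n) ⊕ Fin (m + 1))

/-- The coordinates of a parameter. -/
def coords (η : Params n m) : Coord n m → ℝ :=
  Sum.elim (fun _ => speed η) (Sum.elim (Sum.elim (start η) (constant η))
    (Fin.cons (period η) η.2.2.2.1))

/-- The direction of the speed. -/
def speedDir (n m : ℕ) : Params n m := (0, 0, 1, 0, 0)

/-- The directions of the unit normal. -/
def normalDir (n : ℕ) {m : ℕ} (k : Fin m) : Params n m := (0, 0, 0, Pi.single k 1, 0)

/-- The directions of the initial value and of the constant of integration. -/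
def dataDir (m : ℕ) (c : Fin n ⊕ Fin n) : Params n m :=
  Sum.elim (fun i => (0, Pi.single i 1, 0, 0, 0)) (fun i => (0, 0, 0, 0, Pi.single i 1)) c

/-- The coordinate directions. -/
def coordDir : Coord n m → Params n m :=
  Sum.elim (fun _ => speedDir n m) (Sum.elim (dataDir m)
    (Fin.cons (periodDir n m) (normalDir n)))

theorem sum_coords (η : Params n m) : ∑ c, coords η c • coordDir c = η := by
  obtain ⟨X, a, s, δ, q⟩ := η
  simp only [Fintype.sum_sum_type, Fin.sum_univ_succ, coords, coordDir, dataDir, speedDir,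
    normalDir, periodDir, Sum.elim_inl, Sum.elim_inr, Fin.cons_zero, Fin.cons_succ, speed, start,
    constant, period, Finset.univ_unique, Finset.sum_singleton, Prod.smul_mk, smul_zero,
    smul_eq_mul, mul_one]
  simp only [Prod.ext_iff, Prod.fst_add, Prod.snd_add, Prod.fst_sum, Prod.snd_sum,
    Finset.sum_const_zero, mul_zero, add_zero, zero_add, true_and]
  exact ⟨(pi_eq_sum_univ' a).symm, (pi_eq_sum_univ' δ).symm, (pi_eq_sum_univ' q).symm⟩

theorem map_eq_sum_coords {W : Type*} [AddCommGroup W] [Module ℝ W] (T : Params n m →ₗ[ℝ] W)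
    (η : Params n m) : T η = ∑ c, coords η c • T (coordDir c) := by
  conv_lhs => rw [← sum_coords η, map_sum]
  simp only [map_smul]

/-- The inclusion of `ℝⁿ` in `ℂⁿ`. -/
def complexify (n : ℕ) : (Fin n → ℝ) →L[ℝ] (Fin n → ℂ) :=
  ContinuousLinearMap.pi fun a => Complex.ofRealCLM.comp (ContinuousLinearMap.proj a)

theorem complexify_apply (v : Fin n → ℝ) (a : Fin n) : complexify n v a = (v a : ℂ) := rfl

/-- The value of the complexification of `T` at the complex direction
`(X, a, s, δ, q) = (-i X ξ₁, 0, -λ, i ξ̃, 0)`. -/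
def modulation {W : Type*} [AddCommGroup W] [Module ℝ W] [Module ℂ W] (X : ℝ)
    (ξ : Fin (m + 1) → ℝ) (lam : ℂ) (T : Params n m →ₗ[ℝ] W) : W :=
  (-(Complex.I * X * ξ 0)) • T (periodDir n m) + (-lam) • T (speedDir n m) +
    ∑ k : Fin m, (Complex.I * ξ k.succ) • T (normalDir n k)

end System

namespace System

variable {n m : ℕ} (P : System n m) (b : Params n m)

/-- The linear map `λ DM + ∑ i ξ_j DF^j`. -/
def whithamFlux (ξ : Fin (m + 1) → ℝ) (lam : ℂ) : Params n m →ₗ[ℝ] (Fin n → ℂ) :=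
  lam • ((complexify n).comp (fderiv ℝ P.M b)).toLinearMap +
    ∑ j, (Complex.I * ξ j) • ((complexify n).comp (fderiv ℝ (P.F j) b)).toLinearMap

theorem whithamFlux_apply (ξ : Fin (m + 1) → ℝ) (lam : ℂ) (η : Params n m) :
    P.whithamFlux b ξ lam η = lam • complexify n (fderiv ℝ P.M b η) +
      ∑ j, (Complex.I * ξ j) • complexify n (fderiv ℝ (P.F j) b η) := by
  simp [whithamFlux]

/-- The linear map `λ D(ΩN) + ∑ i ξ_j D(SΩ e_j)` at a wave of period `X` and speed `0` in the
direction `e₁`. -/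
def whithamPhase (n : ℕ) (X : ℝ) (ξ : Fin (m + 1) → ℝ) (lam : ℂ) :
    Params n m →ₗ[ℝ] (Fin (m + 1) → ℂ) where
  toFun η k := lam * ((Fin.cons (-(period η / X ^ 2)) (fun k => η.2.2.2.1 k / X) :
    Fin (m + 1) → ℝ) k : ℝ) + Complex.I * ξ k * (speed η / X : ℝ)
  map_add' η η' := by
    ext k
    refine Fin.cases ?_ (fun k => ?_) k <;> simp [period, speed] <;> ring
  map_smul' c η := by
    ext k
    refine Fin.cases ?_ (fun k => ?_) k <;> simp [period, speed] <;> ring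

/-- The linear map `(DH, λ DM + ∑ i ξ_j DF^j)`. -/
def profileMap (ξ : Fin (m + 1) → ℝ) (lam : ℂ) : Params n m →ₗ[ℝ] (Fin n ⊕ Fin n → ℂ) where
  toFun η := Sum.elim (complexify n (fderiv ℝ P.H b η)) (P.whithamFlux b ξ lam η)
  map_add' η η' := by simp only [map_add, elim_add_elim]
  map_smul' c η := by simp only [map_smul, smul_elim_elim, RingHom.id_apply]

/-- The matrix of `(DH, λ DM + ∑ i ξ_j DF^j)` in the directions `a` and `q`, the direction
`a_{i₀}` being replaced by `modulation`. -/
def reducedMatrix (X : ℝ) (i₀ : Fin n) (ξ : Fin (m + 1) → ℝ) (lam : ℂ) :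
    Matrix (Fin n ⊕ Fin n) (Fin n ⊕ Fin n) ℂ :=
  (Matrix.of fun r c => P.profileMap b ξ lam (dataDir m c) r).updateCol (Sum.inl i₀)
    (modulation X ξ lam (P.profileMap b ξ lam))

/-- The linear map `(a_{i₀} / t, DH, λ DM + ∑ i ξ_j DF^j, λ D(ΩN) + ∑ i ξ_j D(SΩ e_j))`. -/
def fullMap (X t : ℝ) (i₀ : Fin n) (ξ : Fin (m + 1) → ℝ) (lam : ℂ) :
    Params n m →ₗ[ℝ] (Coord n m → ℂ) where
  toFun η := Sum.elim (fun _ => (start η i₀ / t : ℝ))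
    (Sum.elim (P.profileMap b ξ lam η) (whithamPhase n X ξ lam η))
  map_add' η η' := by
    have : (fun _ : Unit => ((start (η + η') i₀ / t : ℝ) : ℂ)) =
        (fun _ => ((start η i₀ / t : ℝ) : ℂ)) + fun _ => ((start η' i₀ / t : ℝ) : ℂ) := by
      ext; simp [start]; ring
    simp only [map_add, elim_add_elim, this]
  map_smul' c η := by
    have : (fun _ : Unit => ((start (c • η) i₀ / t : ℝ) : ℂ)) =
        c • (fun _ => ((start η i₀ / t : ℝ) : ℂ)) := by
      ext; simp [start]; ring
    simp only [map_smul, smul_elim_elim, RingHom.id_apply, this]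

/-- The matrix of `fullMap`. -/
def fullMatrix (X t : ℝ) (i₀ : Fin n) (ξ : Fin (m + 1) → ℝ) (lam : ℂ) :
    Matrix (Coord n m) (Coord n m) ℂ :=
  Matrix.of fun r c => P.fullMap b X t i₀ ξ lam (coordDir c) r

variable {P b}

theorem fullMap_eq_sum (X t : ℝ) (i₀ : Fin n) (ξ : Fin (m + 1) → ℝ) (lam : ℂ) (η : Params n m)
    (r : Coord n m) : P.fullMap b X t i₀ ξ lam η r =
      ∑ c, (coords η c : ℂ) * P.fullMatrix b X t i₀ ξ lam r c := by
  rw [map_eq_sum_coords]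
  simp only [Finset.sum_apply, Pi.smul_apply, fullMatrix, Matrix.of_apply, Complex.real_smul]

theorem fullMatrix_mul (X t : ℝ) (i₀ : Fin n) (ξ : Fin (m + 1) → ℝ) (lam : ℂ) {κ : Type*}
    (η : κ → Params n m) :
    P.fullMatrix b X t i₀ ξ lam * Matrix.of (fun r c => (coords (η c) r : ℂ)) =
      Matrix.of fun r c => P.fullMap b X t i₀ ξ lam (η c) r := by
  ext r c
  rw [Matrix.mul_apply, Matrix.of_apply, fullMap_eq_sum]
  exact Finset.sum_congr rfl fun c' _ => mul_comm _ _

theorem whithamPhase_normalDir (X : ℝ) (ξ : Fin (m + 1) → ℝ) (lam : ℂ) (k : Fin m)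
    (r : Fin (m + 1)) : whithamPhase n X ξ lam (normalDir n k) r =
      if r = k.succ then lam / X else 0 := by
  refine Fin.cases ?_ (fun r => ?_) r
  · simp [whithamPhase, normalDir, period, speed, (Fin.succ_ne_zero _).symm]
  · by_cases h : r = k
    · subst h
      simp [whithamPhase, normalDir, speed, div_eq_mul_inv]
    · simp [whithamPhase, normalDir, speed, h]

theorem whithamPhase_periodDir (X : ℝ) (ξ : Fin (m + 1) → ℝ) (lam : ℂ)
    (r : Fin (m + 1)) : whithamPhase n X ξ lam (periodDir n m) r =
      if r = 0 then -lam / X ^ 2 else 0 := by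
  refine Fin.cases ?_ (fun r => ?_) r
  · simp [whithamPhase, periodDir, period, speed, div_eq_mul_inv]
  · simp [whithamPhase, periodDir, speed, Fin.succ_ne_zero]

theorem whithamPhase_speedDir (X : ℝ) (ξ : Fin (m + 1) → ℝ) (lam : ℂ)
    (r : Fin (m + 1)) : whithamPhase n X ξ lam (speedDir n m) r = Complex.I * ξ r / X := by
  refine Fin.cases ?_ (fun r => ?_) r <;>
  simp [whithamPhase, speedDir, period, speed, div_eq_mul_inv]

theorem whithamPhase_of_start (X : ℝ) (ξ : Fin (m + 1) → ℝ) (lam : ℂ) (a q : Fin n → ℝ) :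
    whithamPhase n X ξ lam ((0, a, 0, 0, q) : Params n m) = 0 := by
  ext r
  refine Fin.cases ?_ (fun r => ?_) r <;>
  simp [whithamPhase, period, speed]

theorem modulation_whithamPhase {X : ℝ} (hX : X ≠ 0) (ξ : Fin (m + 1) → ℝ) (lam : ℂ) :
    modulation X ξ lam (whithamPhase n X ξ lam) = 0 := by
  have hX' : (X : ℂ) ≠ 0 := by exact_mod_cast hX
  ext r
  simp only [modulation, Pi.add_apply, Finset.sum_apply, Pi.smul_apply, whithamPhase_normalDir,
    whithamPhase_periodDir, whithamPhase_speedDir, smul_eq_mul, Pi.zero_apply]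
  refine Fin.cases ?_ (fun r => ?_) r
  · simp only [if_true, (Fin.succ_ne_zero _).symm, if_false, mul_zero, Finset.sum_const_zero]
    field_simp
    ring
  · simp only [Fin.succ_ne_zero, if_false, Fin.succ_inj, mul_ite, mul_zero, Finset.sum_ite_eq,
      Finset.mem_univ, if_true]
    field_simp
    ring

theorem modulation_fullMap {X : ℝ} (hX : X ≠ 0) (t : ℝ) (i₀ : Fin n) (ξ : Fin (m + 1) → ℝ)
    (lam : ℂ) : modulation X ξ lam (P.fullMap b X t i₀ ξ lam) =
      (Sum.elim 0 (Sum.elim (modulation X ξ lam (P.profileMap b ξ lam)) 0) : Coord n m → ℂ) := by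
  rw [← modulation_whithamPhase (n := n) hX ξ lam]
  ext (r | r | r)
  · simp [modulation, fullMap, speedDir, periodDir, normalDir, start]
  · simp only [modulation, fullMap, LinearMap.coe_mk, AddHom.coe_mk, Pi.add_apply, Pi.smul_apply,
      Finset.sum_apply, Sum.elim_inr, Sum.elim_inl]
  · simp only [modulation, fullMap, LinearMap.coe_mk, AddHom.coe_mk, Pi.add_apply, Pi.smul_apply,
      Finset.sum_apply, Sum.elim_inr]

theorem modulation_eq_sum (X t : ℝ) (i₀ : Fin n) (ξ : Fin (m + 1) → ℝ) (lam : ℂ)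
    (r : Coord n m) : modulation X ξ lam (P.fullMap b X t i₀ ξ lam) r =
      ∑ c, (Sum.elim (fun _ => -lam) (Sum.elim 0 (Fin.cons (-(Complex.I * X * ξ 0))
        fun k => Complex.I * ξ k.succ)) : Coord n m → ℂ) c *
          P.fullMatrix b X t i₀ ξ lam r c := by
  simp only [modulation, Fintype.sum_sum_type (α₂ := (Fin n ⊕ Fin n) ⊕ Fin (m + 1)),
    Fintype.sum_sum_type (α₂ := Fin (m + 1)), Fin.sum_univ_succ,
    fullMatrix, Matrix.of_apply, coordDir, Sum.elim_inl, Sum.elim_inr, Fin.cons_zero,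
    Fin.cons_succ, Pi.add_apply, Pi.smul_apply, Finset.sum_apply, smul_eq_mul, Pi.zero_apply,
    zero_mul, Finset.sum_const_zero, zero_add, Finset.univ_unique, Finset.sum_singleton]
  ring

/-- The determinant of `fullMatrix` in terms of `reducedMatrix`. -/
theorem det_fullMatrix {X t : ℝ} (hX : X ≠ 0) (ht : t ≠ 0) {i₀ : Fin n} {a : Fin n → ℝ}
    (ha : a i₀ = t) {ξ : Fin (m + 1) → ℝ} {lam : ℂ}
    (hta : P.profileMap b ξ lam (0, a, 0, 0, 0) = 0) :
    lam * t * (P.fullMatrix b X t i₀ ξ lam).det =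
      (P.reducedMatrix b X i₀ ξ lam).det * ((-lam / X ^ 2) * (lam / X) ^ m) := by
  classical
  set A := P.fullMatrix b X t i₀ ξ lam with hA
  set η : Params n m := (0, a, 0, 0, 0) with hη
  let is : Coord n m := Sum.inl ()
  let ia : Coord n m := Sum.inr (Sum.inl (Sum.inl i₀))
  have hne : is ≠ ia := Sum.inl_ne_inr
  let v : Coord n m → ℂ := Sum.elim (fun _ => -lam) (Sum.elim 0 (Fin.cons (-(Complex.I * X * ξ 0))
        fun k => Complex.I * ξ k.succ))
  let A₁ := A.updateCol ia (fun r => ∑ c, (coords η c : ℂ) • A r c)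
  have h1 : A₁.det = t * A.det := by
    rw [show A₁.det = (coords η ia : ℂ) • A.det from Matrix.det_updateCol_sum A ia _, ← ha]
    rfl
  let A₂ := A₁.updateCol is (fun r => ∑ c, v c • A₁ r c)
  have h2 : A₂.det = -lam * A₁.det := Matrix.det_updateCol_sum A₁ is v
  let A₃ := A₂.submatrix id (Equiv.swap is ia)
  have h3 : A₃.det = - A₂.det := by
    rw [show A₃.det = _ from Matrix.det_permute' (Equiv.swap is ia) A₂, Equiv.Perm.sign_swap hne]
    simp
  have hcol1 : (fun r => ∑ c, (coords η c : ℂ) • A r c) = (Sum.elim 1 0 : Coord n m → ℂ) := by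
    ext r
    have h4 := fullMap_eq_sum (P := P) (b := b) X t i₀ ξ lam η r
    simp only [smul_eq_mul, hA, ← h4]
    have h5 : P.fullMap b X t i₀ ξ lam η = Sum.elim (fun _ => ((a i₀ / t : ℝ) : ℂ))
        (Sum.elim (P.profileMap b ξ lam η) (whithamPhase n X ξ lam η)) := rfl
    rw [h5, hta, hη, whithamPhase_of_start, ha, div_self ht]
    rcases r with r | r | r <;> simp
  have hcol2 : (fun r => ∑ c, v c • A₁ r c) =
      (Sum.elim 0 (Sum.elim (modulation X ξ lam (P.profileMap b ξ lam)) 0) : Coord n m → ℂ) := by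
    rw [← modulation_fullMap (P := P) (b := b) hX t i₀]
    ext r
    rw [modulation_eq_sum]
    refine Finset.sum_congr rfl fun c _ => ?_
    by_cases hc : c = ia
    · subst hc; simp [v, ia]
    · simp only [A₁, Matrix.updateCol_ne hc]; rfl
  have hblock : A₃ = Matrix.fromBlocks 1 (Matrix.of fun r c => A₃ (Sum.inl r) (Sum.inr c)) 0
      (Matrix.fromBlocks (P.reducedMatrix b X i₀ ξ lam)
        (Matrix.of fun r c => A₃ (Sum.inr (Sum.inl r)) (Sum.inr (Sum.inr c))) 0
        (Matrix.diagonal (Fin.cons (-lam / X ^ 2) fun _ => lam / X))) := by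
    have hs : ∀ r, A₃ r (Sum.inl ()) = Sum.elim (1 : Unit → ℂ) 0 r := by
      intro r
      have : A₃ r is = A₂ r ia := by
        simp only [A₃, Matrix.submatrix_apply, Equiv.swap_apply_left]
        rfl
      rw [show (Sum.inl () : Coord n m) = is from rfl, this, ← hcol1]
      simp only [A₂, A₁, Matrix.updateCol_ne hne.symm, Matrix.updateCol_self]
    have hm : ∀ r, A₃ r ia =
        (Sum.elim 0 (Sum.elim (modulation X ξ lam (P.profileMap b ξ lam)) 0) :
          Coord n m → ℂ) r := by
      intro r
      have : A₃ r ia = A₂ r is := by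
        simp only [A₃, Matrix.submatrix_apply, Equiv.swap_apply_right]; rfl
      rw [this, ← hcol2]
      simp only [A₂, Matrix.updateCol_self]
    have ho : ∀ r c, c ≠ is → c ≠ ia → A₃ r c = P.fullMap b X t i₀ ξ lam (coordDir c) r := by
      intro r c h4 h5
      have : A₃ r c = A₂ r c := by
        simp only [A₃, Matrix.submatrix_apply, Equiv.swap_apply_of_ne_of_ne h4 h5]; rfl
      rw [this]
      simp only [A₂, A₁, Matrix.updateCol_ne h4, Matrix.updateCol_ne h5]
      rfl
    ext r (c | c | c)
    · rw [hs]
      rcases r with r | r | r <;> simp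
    · by_cases hc : c = Sum.inl i₀
      · subst hc
        rw [hm]
        rcases r with r | r | r
        · simp only [Matrix.fromBlocks_apply₁₂, Matrix.of_apply]
          exact (hm _).symm
        · simp [reducedMatrix]
        · simp
      · have h5 : (Sum.inr (Sum.inl c) : Coord n m) ≠ ia := by simpa [ia] using hc
        rcases r with r | r | r
        · rfl
        · rw [ho _ _ Sum.inr_ne_inl h5]
          simp only [Matrix.fromBlocks_apply₂₂, Matrix.fromBlocks_apply₁₁, reducedMatrix,
            Matrix.updateCol_ne hc]
          rfl
        · rw [ho _ _ Sum.inr_ne_inl h5]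
          have : P.fullMap b X t i₀ ξ lam (coordDir (Sum.inr (Sum.inl c))) (Sum.inr (Sum.inr r)) =
            whithamPhase n X ξ lam (dataDir m c) r := rfl
          rw [this]
          rcases c with c | c <;> simp [dataDir, whithamPhase_of_start]
    · rcases r with r | r | r
      · rfl
      · rfl
      · rw [ho _ _ Sum.inr_ne_inl (by simp [ia])]
        have : P.fullMap b X t i₀ ξ lam (coordDir (Sum.inr (Sum.inr c))) (Sum.inr (Sum.inr r)) =
          whithamPhase n X ξ lam ((Fin.cons (periodDir n m) (normalDir n) :
            Fin (m + 1) → Params n m) c) r := rfl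
        rw [this]
        refine Fin.cases ?_ (fun c => ?_) c
        · rw [Fin.cons_zero, whithamPhase_periodDir]
          simp only [Matrix.fromBlocks_apply₂₂, Matrix.diagonal_apply]
          split_ifs with h
          · rw [h, Fin.cons_zero]
          · rfl
        · rw [Fin.cons_succ, whithamPhase_normalDir]
          simp only [Matrix.fromBlocks_apply₂₂, Matrix.diagonal_apply]
          split_ifs with h
          · rw [h, Fin.cons_succ]
          · rfl
  have h4 : A₃.det = (P.reducedMatrix b X i₀ ξ lam).det * ((-lam / X ^ 2) * (lam / X) ^ m) := by
    rw [hblock, Matrix.det_fromBlocks_zero₂₁, Matrix.det_fromBlocks_zero₂₁, Matrix.det_one,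
      Matrix.det_diagonal, Fin.prod_univ_succ]
    simp only [Fin.cons_zero, Fin.cons_succ, Finset.prod_const, Finset.card_univ,
      Fintype.card_fin, one_mul]
  rw [← h4, h3, h2, h1]
  ring

end System

namespace System

variable {n m : ℕ} {P : System n m} {ubar : ℝ → Fin n → ℝ} {X : ℝ} {q : Fin n → ℝ}
  {ψ : (Fin n ⊕ Fin (m + 1) → ℝ) → Params n m}

/-- The speed as a linear functional. -/
def speedCLM (n m : ℕ) : Params n m →L[ℝ] ℝ :=
  (ContinuousLinearMap.fst ℝ ℝ ((Fin m → ℝ) × (Fin n → ℝ))).comp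
    ((ContinuousLinearMap.snd ℝ (Fin n → ℝ) _).comp (ContinuousLinearMap.snd ℝ ℝ _))

/-- The linearized unit normal as a linear map. -/
def normalCLM (n m : ℕ) : Params n m →L[ℝ] (Fin m → ℝ) :=
  (ContinuousLinearMap.fst ℝ (Fin m → ℝ) (Fin n → ℝ)).comp ((ContinuousLinearMap.snd ℝ ℝ _).comp
    ((ContinuousLinearMap.snd ℝ (Fin n → ℝ) _).comp (ContinuousLinearMap.snd ℝ ℝ _)))

/-- The period as a linear functional. -/
def periodCLM (n m : ℕ) : Params n m →L[ℝ] ℝ := ContinuousLinearMap.fst ℝ ℝ _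

theorem hasFDerivAt_frequency (hX : X ≠ 0) :
    HasFDerivAt (fun θ : Params n m => frequency θ) ((-(X ^ 2)⁻¹) • periodCLM n m)
      (basePoint m ubar X q) := by
  have h1 : HasFDerivAt (fun θ : Params n m => θ.1) (periodCLM n m) (basePoint m ubar X q) :=
    (periodCLM n m).hasFDerivAt
  have h2 := (hasDerivAt_inv (x := X) hX).comp_hasFDerivAt (basePoint m ubar X q) h1
  simp only [frequency, period, one_div]
  exact h2

theorem hasFDerivAt_speed_mul_frequency (hX : X ≠ 0) :
    HasFDerivAt (fun θ : Params n m => speed θ * frequency θ) ((1 / X) • speedCLM n m)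
      (basePoint m ubar X q) := by
  have hs : HasFDerivAt (fun θ : Params n m => speed θ) (speedCLM n m) (basePoint m ubar X q) :=
    (speedCLM n m).hasFDerivAt
  have h := hs.fun_mul (hasFDerivAt_frequency (ubar := ubar) (q := q) hX)
  rw [speed_basePoint, zero_smul, zero_add] at h
  exact h

theorem fderiv_frequency_smul_normal (hX : X ≠ 0) (η : Params n m) :
    DifferentiableAt ℝ (fun θ : Params n m => frequency θ • normal θ) (basePoint m ubar X q) ∧
    fderiv ℝ (fun θ : Params n m => frequency θ • normal θ) (basePoint m ubar X q) η =
      Fin.cons (-(period η / X ^ 2)) (fun k => η.2.2.2.1 k / X) := by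
  have hn : HasFDerivAt (fun θ : Params n m => normal θ)
      ((ContinuousLinearMap.pi (Fin.cons (0 : (Fin m → ℝ) →L[ℝ] ℝ)
        fun j => ContinuousLinearMap.proj j)).comp (normalCLM n m)) (basePoint m ubar X q) :=
    HasFDerivAt.comp (basePoint m ubar X q) (hasFDerivAt_direction_zero (m := m))
      (normalCLM n m).hasFDerivAt
  have h := (hasFDerivAt_frequency (ubar := ubar) (q := q) hX).fun_smul hn
  refine ⟨h.differentiableAt, ?_⟩
  rw [h.fderiv, normal_basePoint]
  have hfb : frequency (basePoint m ubar X q) = 1 / X := rfl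
  rw [hfb]
  ext k
  refine Fin.cases ?_ (fun k => ?_) k
  · simp [period, periodCLM]
    ring
  · simp [normalCLM]
    ring

/-- The tangent vectors of a local parametrization. -/
def tangent (ψ : (Fin n ⊕ Fin (m + 1) → ℝ) → Params n m) (c : Fin n ⊕ Fin (m + 1)) : Params n m :=
  fderiv ℝ ψ 0 (Pi.single c 1)

theorem fderiv_comp_tangent (hψ : P.IsLocalParametrization ubar X q ψ) {W : Type*}
    [NormedAddCommGroup W] [NormedSpace ℝ W] {h : Params n m → W}
    (hh : DifferentiableAt ℝ h (basePoint m ubar X q)) (c : Fin n ⊕ Fin (m + 1)) :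
    fderiv ℝ (fun p => h (ψ p)) 0 (Pi.single c 1) =
      fderiv ℝ h (basePoint m ubar X q) (tangent ψ c) := by
  rw [← hψ.base] at hh ⊢
  rw [fderiv_fun_comp (0 : Fin n ⊕ Fin (m + 1) → ℝ) hh (hψ.contDiffAt.differentiableAt one_ne_zero)]
  rfl

theorem whithamMatrix_eq (hw : P.IsPeriodicWave ubar X q) (h0 : P.H0) (h1 : P.H1)
    (hψ : P.IsLocalParametrization ubar X q ψ) (ξ : Fin (m + 1) → ℝ) (lam : ℂ) :
    P.whithamMatrix ψ ξ lam = Matrix.of fun r c =>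
      Sum.elim (P.whithamFlux (basePoint m ubar X q) ξ lam (tangent ψ c))
        (whithamPhase n X ξ lam (tangent ψ c)) r := by
  have hX := hw.period_pos.ne'
  ext (a | k) c
  · simp only [whithamMatrix, Matrix.of_apply, Sum.elim_inl, whithamFlux_apply, Pi.add_apply,
      Pi.smul_apply, Finset.sum_apply, complexify_apply, smul_eq_mul,
      fderiv_comp_tangent hψ (differentiableAt_M hw h0 h1),
      fun j => fderiv_comp_tangent hψ (differentiableAt_F hw h0 h1 j)]
  · have hs : ∀ j : Fin (m + 1), DifferentiableAt ℝ (fun θ : Params n m =>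
        (speed θ * frequency θ) • (Pi.single j 1 : Fin (m + 1) → ℝ)) (basePoint m ubar X q) :=
      fun j => (hasFDerivAt_speed_mul_frequency hX).differentiableAt.smul_const _
    have hs' : ∀ j : Fin (m + 1), fderiv ℝ (fun θ : Params n m =>
        (speed θ * frequency θ) • (Pi.single j 1 : Fin (m + 1) → ℝ)) (basePoint m ubar X q)
          (tangent ψ c) = (speed (tangent ψ c) / X) • (Pi.single j 1 : Fin (m + 1) → ℝ) := by
      intro j
      rw [((hasFDerivAt_speed_mul_frequency hX).smul_const _).fderiv]
      rw [ContinuousLinearMap.smulRight_apply, smul_apply, smul_eq_mul, one_div_mul_eq_div]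
      rfl
    simp only [whithamMatrix, Matrix.of_apply, Sum.elim_inr, whithamPhase, LinearMap.coe_mk,
      AddHom.coe_mk, fderiv_comp_tangent hψ (fderiv_frequency_smul_normal hX 0).1,
      (fderiv_frequency_smul_normal hX _).2, fun j => fderiv_comp_tangent hψ (hs j), hs',
      Pi.smul_apply, Pi.single_apply, smul_eq_mul, mul_ite, mul_one, mul_zero]
    congr 1
    simp only [apply_ite Complex.ofReal, Complex.ofReal_zero, mul_ite, mul_zero]
    rw [Finset.sum_ite_eq Finset.univ k, if_pos (Finset.mem_univ k)]

theorem fderiv_H_tangent (hw : P.IsPeriodicWave ubar X q) (h0 : P.H0) (h1 : P.H1)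
    (hψ : P.IsLocalParametrization ubar X q ψ) (c : Fin n ⊕ Fin (m + 1)) :
    fderiv ℝ P.H (basePoint m ubar X q) (tangent ψ c) = 0 := by
  rw [← fderiv_comp_tangent hψ ((contDiffAt_H hw h0 h1).differentiableAt one_ne_zero)]
  have hpos : ∀ᶠ p in 𝓝 0, 0 < period (ψ p) := by
    have hc : ContinuousAt (fun p => period (ψ p)) 0 :=
      continuous_fst.continuousAt.comp hψ.contDiffAt.continuousAt
    refine hc.eventually (lt_mem_nhds ?_)
    change 0 < period (ψ 0)
    rw [hψ.base]
    exact hw.period_pos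
  have hev : (fun p => P.H (ψ p)) =ᶠ[𝓝 0] fun _ => 0 := by
    filter_upwards [hpos, hψ.periodic] with p hp ⟨v, hv0, hv, hper⟩
    rw [H_eq h0 h1 hp hv0 (hv.mono (Set.subset_univ _)), sub_eq_zero]
    simpa using hper 0
  rw [hev.fderiv_eq]
  simp

theorem profileMap_translation (hw : P.IsPeriodicWave ubar X q) (h0 : P.H0) (h1 : P.H1)
    (ξ : Fin (m + 1) → ℝ) (lam : ℂ) :
    P.profileMap (basePoint m ubar X q) ξ lam (translation m ubar) = 0 := by
  obtain ⟨hH, hM, hF⟩ := fderiv_translation hw h0 h1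
  ext (a | a)
  · simp [profileMap, hH]
  · simp [profileMap, whithamFlux_apply, hM, hF]

/-- A frame of the parameter space: the translation, a right inverse of `DH`, and the tangent
vectors of a local parametrization. -/
def frame (ubar : ℝ → Fin n → ℝ) (G : Fin n → Params n m)
    (ψ : (Fin n ⊕ Fin (m + 1) → ℝ) → Params n m) :
    Unit ⊕ (Fin n ⊕ (Fin n ⊕ Fin (m + 1))) → Params n m :=
  Sum.elim (fun _ => translation m ubar) (Sum.elim G (tangent ψ))

/-- Association of the summands of the coordinate indices. -/
def coordAssoc (n m : ℕ) : Coord n m ≃ Unit ⊕ (Fin n ⊕ (Fin n ⊕ Fin (m + 1))) :=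
  Equiv.sumCongr (Equiv.refl Unit) (Equiv.sumAssoc _ _ _)

theorem det_frame_ne_zero (hw : P.IsPeriodicWave ubar X q) (h0 : P.H0) (h1 : P.H1)
    (hψ : P.IsLocalParametrization ubar X q ψ) {G : Fin n → Params n m}
    (hG : ∀ i, fderiv ℝ P.H (basePoint m ubar X q) (G i) = Pi.single i 1) :
    (Matrix.of fun r c => (coords (frame ubar G ψ (coordAssoc n m c)) r : ℂ)).det ≠ 0 := by
  have hreal : (Matrix.of fun r c => coords (frame ubar G ψ (coordAssoc n m c)) r).det ≠ 0 := by
    intro hdet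
    obtain ⟨v, hv0, hv⟩ := Matrix.exists_mulVec_eq_zero_iff.2 hdet
    apply hv0
    set v' : Unit ⊕ (Fin n ⊕ (Fin n ⊕ Fin (m + 1))) → ℝ := fun c => v ((coordAssoc n m).symm c)
    have hsum : ∑ c, v' c • frame ubar G ψ c = 0 := by
      rw [← (coordAssoc n m).sum_comp]
      simp only [v', Equiv.symm_apply_apply]
      calc ∑ c, v c • frame ubar G ψ (coordAssoc n m c)
          = ∑ c, ∑ r, (coords (frame ubar G ψ (coordAssoc n m c)) r * v c) • coordDir r := by
            refine Finset.sum_congr rfl fun c _ => ?_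
            conv_lhs => rw [← sum_coords (frame ubar G ψ (coordAssoc n m c)), Finset.smul_sum]
            simp only [smul_smul, mul_comm]
        _ = ∑ r, (∑ c, coords (frame ubar G ψ (coordAssoc n m c)) r * v c) • coordDir r := by
            rw [Finset.sum_comm]
            simp only [Finset.sum_smul]
        _ = 0 := by
            refine Finset.sum_eq_zero fun r _ => ?_
            have := congrFun hv r
            simp only [Matrix.mulVec, dotProduct, Matrix.of_apply, Pi.zero_apply] at this
            rw [this, zero_smul]
    rw [Fintype.sum_sum_type, Fintype.sum_sum_type (α₁ := Fin n)] at hsum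
    simp only [frame, Sum.elim_inl, Sum.elim_inr, Finset.univ_unique, Finset.sum_singleton] at hsum
    have hDH := congrArg (fderiv ℝ P.H (basePoint m ubar X q)) hsum
    simp only [map_add, map_sum, map_smul, (fderiv_translation hw h0 h1).1, smul_zero, zero_add,
      hG, fderiv_H_tangent hw h0 h1 hψ, Finset.sum_const_zero, add_zero, map_zero] at hDH
    have hvG : ∀ i, v' (Sum.inr (Sum.inl i)) = 0 := by
      intro i
      rw [← pi_eq_sum_univ' (fun i => v' (Sum.inr (Sum.inl i)))] at hDH
      exact congrFun hDH i
    simp only [hvG, zero_smul, Finset.sum_const_zero, zero_add] at hsum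
    set h : Fin n ⊕ Fin (m + 1) → ℝ := fun c => v' (Sum.inr (Sum.inr c)) with hh
    have htan : fderiv ℝ ψ 0 h = ∑ c, v' (Sum.inr (Sum.inr c)) • tangent ψ c := by
      rw [pi_eq_sum_univ' h, map_sum]
      simp only [map_smul, hh]
      rfl
    have hh0 : h = 0 := by
      refine hψ.transversal h (-v' (Sum.inl default)) ?_
      rw [htan, neg_smul]
      exact eq_neg_of_add_eq_zero_right hsum
    have hv2 : ∀ c, v' (Sum.inr (Sum.inr c)) = 0 := fun c => congrFun hh0 c
    simp only [hv2, zero_smul, Finset.sum_const_zero, add_zero] at hsum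
    have hv3 : v' (Sum.inl default) = 0 := by
      refine (smul_eq_zero.1 hsum).resolve_right fun h3 => ?_
      exact deriv_ubar_ne_zero hw h0 h1 (congrArg (fun η : Params n m => η.2.1) h3)
    have hv' : ∀ c, v' c = 0 := by
      rintro (c | c | c)
      exacts [hv3, hvG c, hv2 c]
    ext c
    simpa [v'] using hv' (coordAssoc n m c)
  have h2 := RingHom.map_det Complex.ofRealHom
    (Matrix.of fun r c => coords (frame ubar G ψ (coordAssoc n m c)) r)
  intro h3
  apply hreal
  have : Complex.ofRealHom (Matrix.of fun r c =>
      coords (frame ubar G ψ (coordAssoc n m c)) r).det = 0 := by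
    rw [h2]; exact h3
  simpa using this

theorem det_fullMatrix_mul_frame (hw : P.IsPeriodicWave ubar X q) (h0 : P.H0) (h1 : P.H1)
    (hψ : P.IsLocalParametrization ubar X q ψ) {G : Fin n → Params n m}
    (hG : ∀ i, fderiv ℝ P.H (basePoint m ubar X q) (G i) = Pi.single i 1) {i₀ : Fin n}
    (hi₀ : deriv ubar 0 i₀ ≠ 0) (ξ : Fin (m + 1) → ℝ) (lam : ℂ) :
    (P.fullMatrix (basePoint m ubar X q) X (deriv ubar 0 i₀) i₀ ξ lam).det *
      (Matrix.of fun r c => (coords (frame ubar G ψ (coordAssoc n m c)) r : ℂ)).det =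
      P.deltaHat ψ ξ lam := by
  set b := basePoint m ubar X q
  rw [← Matrix.det_mul, fullMatrix_mul, ← Matrix.det_submatrix_equiv_self (coordAssoc n m).symm]
  set A : Matrix (Unit ⊕ (Fin n ⊕ (Fin n ⊕ Fin (m + 1)))) (Unit ⊕ (Fin n ⊕ (Fin n ⊕ Fin (m + 1))))
    ℂ := Matrix.submatrix _ _ _ with hA
  have hA' : ∀ r c, A r c = P.fullMap b X (deriv ubar 0 i₀) i₀ ξ lam (frame ubar G ψ c)
      ((coordAssoc n m).symm r) := by
    intro r c
    simp [hA]
  have hblock : A = Matrix.fromBlocks 1 (Matrix.of fun r c => A (Sum.inl r) (Sum.inr c)) 0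
      (Matrix.fromBlocks 1 0 (Matrix.of fun r c => A (Sum.inr (Sum.inr r)) (Sum.inr (Sum.inl c)))
        (P.whithamMatrix ψ ξ lam)) := by
    ext (r | r | r) (c | c | c)
    · rw [hA']
      change (((deriv ubar 0 i₀ / deriv ubar 0 i₀ : ℝ)) : ℂ) = _
      simp [div_self hi₀]
    · rfl
    · rfl
    · rw [hA']
      change P.profileMap b ξ lam (translation m ubar) (Sum.inl r) = _
      rw [profileMap_translation hw h0 h1]
      rfl
    · rw [hA']
      change complexify n (fderiv ℝ P.H b (G c)) r = _
      rw [hG, complexify_apply]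
      simp [Matrix.one_apply, Pi.single_apply, apply_ite Complex.ofReal]
    · rw [hA']
      change complexify n (fderiv ℝ P.H b (tangent ψ c)) r = _
      rw [fderiv_H_tangent hw h0 h1 hψ]
      simp
    · rw [hA']
      rcases r with r | r
      · change P.profileMap b ξ lam (translation m ubar) (Sum.inr r) = _
        rw [profileMap_translation hw h0 h1]
        rfl
      · change whithamPhase n X ξ lam (translation m ubar) r = _
        rw [translation, whithamPhase_of_start]
        rfl
    · rfl
    · rw [hA', whithamMatrix_eq hw h0 h1 hψ]
      rcases r with r | r <;> rfl
  rw [hblock, Matrix.det_fromBlocks_zero₂₁, Matrix.det_fromBlocks_zero₁₂, Matrix.det_one,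
    Matrix.det_one, one_mul, one_mul]
  rfl

end System

theorem isHomogeneous_det {ι τ R : Type*} [Fintype ι] [DecidableEq ι] [CommRing R]
    {A : Matrix ι ι (MvPolynomial τ R)} {α β : ι → ℕ}
    (hA : ∀ r c, (A r c).IsHomogeneous (α r + β c)) :
    A.det.IsHomogeneous (∑ r, α r + ∑ c, β c) := by
  rw [Matrix.det_apply']
  refine MvPolynomial.IsHomogeneous.sum _ _ _ fun e _ => ?_
  have h1 : (∏ i, A (e i) i).IsHomogeneous (∑ i, (α (e i) + β i)) :=
    MvPolynomial.IsHomogeneous.prod _ _ _ fun i _ => hA (e i) i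
  rw [Finset.sum_add_distrib, Equiv.sum_comp e α] at h1
  have h2 : ((Equiv.Perm.sign e : ℤ) : MvPolynomial τ R) =
      MvPolynomial.C ((Equiv.Perm.sign e : ℤ) : R) := by simp
  rw [h2]
  exact h1.C_mul _

namespace System

variable {n m : ℕ} (P : System n m) (b : Params n m)

/-- The entries of `profileMap` as polynomials in `(ξ, λ)`. -/
def profilePoly (η : Params n m) : Fin n ⊕ Fin n → MvPolynomial (Fin (m + 1) ⊕ Unit) ℂ :=
  Sum.elim (fun a => MvPolynomial.C (fderiv ℝ P.H b η a : ℂ))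
    (fun a => MvPolynomial.C (fderiv ℝ P.M b η a : ℂ) * MvPolynomial.X (Sum.inr ()) +
      ∑ j, MvPolynomial.C (Complex.I * (fderiv ℝ (P.F j) b η a : ℂ)) * MvPolynomial.X (Sum.inl j))

/-- The entries of `modulation` of `profileMap` as polynomials in `(ξ, λ)`. -/
def modulationPoly (X : ℝ) (r : Fin n ⊕ Fin n) : MvPolynomial (Fin (m + 1) ⊕ Unit) ℂ :=
  MvPolynomial.C (-(Complex.I * X)) * MvPolynomial.X (Sum.inl 0) *
      P.profilePoly b (periodDir n m) r +
    MvPolynomial.C (-1) * MvPolynomial.X (Sum.inr ()) * P.profilePoly b (speedDir n m) r +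
    ∑ k : Fin m, MvPolynomial.C Complex.I * MvPolynomial.X (Sum.inl k.succ) *
      P.profilePoly b (normalDir n k) r

/-- The entries of `reducedMatrix` as polynomials in `(ξ, λ)`. -/
def polyMatrix (X : ℝ) (i₀ : Fin n) :
    Matrix (Fin n ⊕ Fin n) (Fin n ⊕ Fin n) (MvPolynomial (Fin (m + 1) ⊕ Unit) ℂ) :=
  (Matrix.of fun r c => P.profilePoly b (dataDir m c) r).updateCol (Sum.inl i₀)
    (P.modulationPoly b X)

variable {P b}

theorem eval_profilePoly (η : Params n m) (ξ : Fin (m + 1) → ℝ) (lam : ℂ) (r : Fin n ⊕ Fin n) :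
    MvPolynomial.eval (Sum.elim (fun j => (ξ j : ℂ)) (fun _ => lam)) (P.profilePoly b η r) =
      P.profileMap b ξ lam η r := by
  rcases r with r | r
  · simp [profilePoly, profileMap, complexify_apply]
  · simp only [profilePoly, profileMap, whithamFlux_apply, complexify_apply, Sum.elim_inr, map_add,
      map_mul, map_sum, MvPolynomial.eval_C, MvPolynomial.eval_X, LinearMap.coe_mk, AddHom.coe_mk,
      Pi.add_apply, Pi.smul_apply, Finset.sum_apply, smul_eq_mul, Sum.elim_inl]
    rw [mul_comm lam]
    congr 1
    exact Finset.sum_congr rfl fun j _ => by ring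

theorem eval_modulationPoly (X : ℝ) (ξ : Fin (m + 1) → ℝ) (lam : ℂ) (r : Fin n ⊕ Fin n) :
    MvPolynomial.eval (Sum.elim (fun j => (ξ j : ℂ)) (fun _ => lam)) (P.modulationPoly b X r) =
      modulation X ξ lam (P.profileMap b ξ lam) r := by
  simp only [modulationPoly, modulation, map_add, map_mul, map_sum, MvPolynomial.eval_C,
    MvPolynomial.eval_X, eval_profilePoly, Pi.add_apply, Pi.smul_apply, Finset.sum_apply,
    smul_eq_mul, Sum.elim_inl, Sum.elim_inr]
  congr 2 <;> ring

theorem eval_polyMatrix (X : ℝ) (i₀ : Fin n) (ξ : Fin (m + 1) → ℝ) (lam : ℂ)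
    (r c : Fin n ⊕ Fin n) :
    MvPolynomial.eval (Sum.elim (fun j => (ξ j : ℂ)) (fun _ => lam)) (P.polyMatrix b X i₀ r c) =
      P.reducedMatrix b X i₀ ξ lam r c := by
  by_cases hc : c = Sum.inl i₀
  · subst hc
    simp only [polyMatrix, reducedMatrix, Matrix.updateCol_self, eval_modulationPoly]
  · simp only [polyMatrix, reducedMatrix, Matrix.updateCol_ne hc, Matrix.of_apply,
      eval_profilePoly]

theorem eval_det_polyMatrix (X : ℝ) (i₀ : Fin n) (ξ : Fin (m + 1) → ℝ) (lam : ℂ) :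
    MvPolynomial.eval (Sum.elim (fun j => (ξ j : ℂ)) (fun _ => lam)) (P.polyMatrix b X i₀).det =
      (P.reducedMatrix b X i₀ ξ lam).det := by
  rw [RingHom.map_det]
  congr 1
  ext r c
  rw [RingHom.mapMatrix_apply, Matrix.map_apply, eval_polyMatrix]

/-- The degrees of the rows of `polyMatrix`. -/
def rowDegree : Fin n ⊕ Fin n → ℕ := Sum.elim 0 1

theorem isHomogeneous_profilePoly (η : Params n m) (r : Fin n ⊕ Fin n) :
    (P.profilePoly b η r).IsHomogeneous (rowDegree r) := by
  rcases r with r | r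
  · exact MvPolynomial.isHomogeneous_C _ _
  · refine MvPolynomial.IsHomogeneous.add ((MvPolynomial.isHomogeneous_X _ _).C_mul _)
      (MvPolynomial.IsHomogeneous.sum _ _ _ fun j _ => (MvPolynomial.isHomogeneous_X _ _).C_mul _)

theorem isHomogeneous_modulationPoly (X : ℝ) (r : Fin n ⊕ Fin n) :
    (P.modulationPoly b X r).IsHomogeneous (rowDegree r + 1) := by
  rw [add_comm (rowDegree r) 1]
  have h : ∀ (c : ℂ) (v : Fin (m + 1) ⊕ Unit) (η : Params n m),
      (MvPolynomial.C c * MvPolynomial.X v * P.profilePoly b η r).IsHomogeneous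
        (1 + rowDegree r) := fun c v η =>
    ((MvPolynomial.isHomogeneous_X _ _).C_mul _).mul (isHomogeneous_profilePoly η r)
  exact ((h _ _ _).add (h _ _ _)).add (MvPolynomial.IsHomogeneous.sum _ _ _ fun k _ => h _ _ _)

/-- The degrees of the columns of `polyMatrix`. -/
def colDegree (i₀ : Fin n) : Fin n ⊕ Fin n → ℕ := Pi.single (Sum.inl i₀) 1

theorem sum_rowDegree_add_sum_colDegree (i₀ : Fin n) :
    ∑ r : Fin n ⊕ Fin n, rowDegree r + ∑ c : Fin n ⊕ Fin n, colDegree i₀ c = n + 1 := by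
  rw [colDegree, Finset.sum_pi_single']
  simp [rowDegree]

theorem isHomogeneous_polyMatrix (X : ℝ) (i₀ : Fin n) (r c : Fin n ⊕ Fin n) :
    (P.polyMatrix b X i₀ r c).IsHomogeneous (rowDegree r + colDegree i₀ c) := by
  by_cases hc : c = Sum.inl i₀
  · subst hc
    rw [colDegree, Pi.single_eq_same, polyMatrix, Matrix.updateCol_self]
    exact isHomogeneous_modulationPoly X r
  · rw [colDegree, Pi.single_eq_of_ne hc, polyMatrix, Matrix.updateCol_ne hc]
    exact isHomogeneous_profilePoly _ r

theorem isHomogeneous_det_polyMatrix (X : ℝ) (i₀ : Fin n) :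
    (P.polyMatrix b X i₀).det.IsHomogeneous (n + 1) := by
  have h := isHomogeneous_det (isHomogeneous_polyMatrix (P := P) (b := b) X i₀)
  rwa [sum_rowDegree_add_sum_colDegree] at h

variable {ubar : ℝ → Fin n → ℝ} {X : ℝ} {q : Fin n → ℝ}
  {ψ : (Fin n ⊕ Fin (m + 1) → ℝ) → Params n m}

theorem continuous_deltaHat (ξ : Fin (m + 1) → ℝ) : Continuous fun lam => P.deltaHat ψ ξ lam := by
  refine Continuous.matrix_det (continuous_matrix fun r c => ?_)
  rcases r with r | r <;> simp only [whithamMatrix, Matrix.of_apply, Sum.elim_inl, Sum.elim_inr] <;>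
  fun_prop

/-- The linearized dispersion relation in terms of the reduced determinant. -/
theorem exists_deltaHat_eq (hw : P.IsPeriodicWave ubar X q) (h0 : P.H0) (h1 : P.H1)
    (h2 : P.H2 ubar X q) (hψ : P.IsLocalParametrization ubar X q ψ) {i₀ : Fin n}
    (hi₀ : deriv ubar 0 i₀ ≠ 0) :
    ∃ c : ℂ, c ≠ 0 ∧ ∀ ξ lam, P.deltaHat ψ ξ lam =
      lam ^ m * (c * (P.reducedMatrix (basePoint m ubar X q) X i₀ ξ lam).det) := by
  choose G hG using fun i : Fin n => h2 (Pi.single i 1)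
  set J : ℂ := (Matrix.of fun r c => (coords (frame ubar G ψ (coordAssoc n m c)) r : ℂ)).det
  have hJ : J ≠ 0 := det_frame_ne_zero hw h0 h1 hψ hG
  have hX : (X : ℂ) ≠ 0 := by exact_mod_cast hw.period_pos.ne'
  have ht : (deriv ubar 0 i₀ : ℂ) ≠ 0 := by exact_mod_cast hi₀
  refine ⟨-J / (X ^ (m + 2) * deriv ubar 0 i₀), ?_, fun ξ => congrFun ?_⟩
  · exact div_ne_zero (neg_ne_zero.2 hJ) (mul_ne_zero (pow_ne_zero _ hX) ht)
  refine Continuous.ext_on (dense_compl_singleton (0 : ℂ)) (continuous_deltaHat ξ) ?_ ?_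
  · simp only [← eval_det_polyMatrix]
    have h3 : Continuous fun lam : ℂ => (Sum.elim (fun j => (ξ j : ℂ)) (fun _ => lam) :
        Fin (m + 1) ⊕ Unit → ℂ) := by
      refine continuous_pi fun c => ?_
      rcases c with c | c
      · exact continuous_const
      · exact continuous_id
    have h4 := (MvPolynomial.continuous_eval
      (P.polyMatrix (basePoint m ubar X q) X i₀).det).comp h3
    exact (continuous_pow m).mul (continuous_const.mul h4)
  · intro lam hlam
    have hlam : lam ≠ 0 := hlam
    have h3 := det_fullMatrix (P := P) (b := basePoint m ubar X q) hw.period_pos.ne' hi₀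
      (a := deriv ubar 0) rfl (profileMap_translation hw h0 h1 ξ lam)
    have h4 := det_fullMatrix_mul_frame hw h0 h1 hψ hG hi₀ ξ lam
    simp only
    rw [← h4]
    change _ * J = _
    set D := (P.fullMatrix (basePoint m ubar X q) X (deriv ubar 0 i₀) i₀ ξ lam).det
    set R := (P.reducedMatrix (basePoint m ubar X q) X i₀ ξ lam).det
    have h5 : D = R * (-lam ^ m / X ^ (m + 2)) / deriv ubar 0 i₀ := by
      rw [eq_div_iff ht]
      apply mul_left_cancel₀ hlam
      rw [mul_comm D, ← mul_assoc, h3, div_pow]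
      field_simp
      ring
    rw [h5]
    field_simp

end System

theorem exists_norm_mulVec_le {ι : Type*} [Fintype ι] {A : ℝ → Matrix ι ι ℂ} (hA : Continuous A)
    (X : ℝ) : ∃ K : ℝ, 0 ≤ K ∧ ∀ x ∈ Set.Icc 0 X, ∀ y, ‖A x *ᵥ y‖ ≤ K * ‖y‖ := by
  obtain ⟨K, hK⟩ := (isCompact_Icc (a := (0 : ℝ)) (b := X)).exists_bound_of_continuousOn
    (continuous_matCLM hA).continuousOn
  refine ⟨max K 0, le_max_right _ _, fun x hx y => ?_⟩
  rw [← matCLM_apply]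
  exact ((matCLM (A x)).le_opNorm y).trans
    (mul_le_mul_of_nonneg_right ((hK x hx).trans (le_max_left _ _)) (norm_nonneg _))

theorem norm_le_of_perturbation {E : Type*} [NormedAddCommGroup E] [NormedSpace ℝ E]
    {f f' : ℝ → E} {X K ε : ℝ} (hK : 0 < K) (hε : 0 ≤ ε)
    (hf : ∀ x ∈ Set.Icc 0 X, HasDerivAt f (f' x) x) (h0 : f 0 = 0)
    (hb : ∀ x ∈ Set.Icc 0 X, ‖f' x‖ ≤ K * ‖f x‖ + ε) {x : ℝ} (hx : x ∈ Set.Icc 0 X) :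
    ‖f x‖ ≤ (Real.exp (K * X) / K) * ε := by
  have h1 := norm_le_gronwallBound_of_norm_deriv_right_le (f := f) (f' := f') (δ := 0) (K := K)
    (ε := ε) (a := 0) (b := X) (fun y hy => (hf y hy).continuousAt.continuousWithinAt)
    (fun y hy => (hf y (Set.Ico_subset_Icc_self hy)).hasDerivWithinAt) (by rw [h0, norm_zero])
    (fun y hy => hb y (Set.Ico_subset_Icc_self hy)) x hx
  simp only [gronwallBound_of_K_ne_0 hK.ne', zero_mul, zero_add, sub_zero] at h1
  refine h1.trans ?_
  have h2 : Real.exp (K * x) ≤ Real.exp (K * X) :=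
    Real.exp_le_exp.2 (mul_le_mul_of_nonneg_left hx.2 hK.le)
  calc ε / K * (Real.exp (K * x) - 1) ≤ ε / K * Real.exp (K * X) :=
        mul_le_mul_of_nonneg_left (by linarith) (div_nonneg hε hK.le)
    _ = Real.exp (K * X) / K * ε := by ring

namespace System

variable {n m : ℕ} (P : System n m) (ubar : ℝ → Fin n → ℝ)

/-- The part of first order in `(ξ, λ)` of the matrix of the first-order system. -/
def linPart (p : (Fin (m + 1) → ℝ) × ℂ) (x : ℝ) : Matrix (Fin n ⊕ Fin n) (Fin n ⊕ Fin n) ℂ :=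
  p.2 • sysLam n + ∑ k : Fin m, (p.1 k.succ : ℂ) • P.sysLin ubar k x

/-- The part of second order in `(ξ, λ)` of the matrix of the first-order system. -/
def quadPart (p : (Fin (m + 1) → ℝ) × ℂ) (x : ℝ) : Matrix (Fin n ⊕ Fin n) (Fin n ⊕ Fin n) ℂ :=
  ∑ j : Fin m, ∑ k : Fin m,
    ((p.1 j.succ : ℂ) * (p.1 k.succ : ℂ)) • P.sysQuad ubar j k x

variable {P ubar}

theorem sysMatrix_tail (p : (Fin (m + 1) → ℝ) × ℂ) (x : ℝ) :
    P.sysMatrix ubar (Fin.tail p.1) p.2 x =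
      P.sysZero ubar x + P.linPart ubar p x + P.quadPart ubar p x := by
  rw [sysMatrix, linPart, quadPart, ← add_assoc]
  rfl

theorem sysZero_mulVec (x : ℝ) (w z : Fin n → ℂ) :
    P.sysZero ubar x *ᵥ Sum.elim w z =
      Sum.elim (P.coeffBinv ubar x *ᵥ (P.coeffA ubar 0 x *ᵥ w + z)) 0 := by
  simp only [sysZero, Matrix.fromBlocks_mulVec, Sum.elim_comp_inl, Sum.elim_comp_inr,
    Matrix.zero_mulVec, add_zero, Matrix.mulVec_add, Matrix.mulVec_mulVec]

theorem linPart_mulVec (p : (Fin (m + 1) → ℝ) × ℂ) (x : ℝ) (w z : Fin n → ℂ) :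
    P.linPart ubar p x *ᵥ Sum.elim w z = Sum.elim
      (-∑ k : Fin m, (Complex.I * p.1 k.succ) •
        (P.coeffBinv ubar x *ᵥ (P.coeffB ubar 0 k.succ x *ᵥ w)))
      (p.2 • w + ∑ k : Fin m, (Complex.I * p.1 k.succ) • (P.coeffA ubar k.succ x *ᵥ w -
        P.coeffB ubar k.succ 0 x *ᵥ
          (P.coeffBinv ubar x *ᵥ (P.coeffA ubar 0 x *ᵥ w + z)))) := by
  simp only [linPart, sysLam, sysLin, Matrix.add_mulVec, Matrix.sum_mulVec, Matrix.smul_mulVec,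
    Matrix.fromBlocks_mulVec, Sum.elim_comp_inl, Sum.elim_comp_inr, Matrix.zero_mulVec,
    Matrix.one_mulVec, add_zero, zero_add, smul_elim_elim, sum_elim_elim, elim_add_elim, smul_zero,
    Matrix.mulVec_add, Matrix.mulVec_mulVec, Matrix.sub_mulVec]
  congr 1
  · rw [← Finset.sum_neg_distrib]
    refine Finset.sum_congr rfl fun k _ => ?_
    rw [neg_smul, smul_neg, smul_smul, mul_comm]
  · congr 1
    refine Finset.sum_congr rfl fun k _ => ?_
    rw [mul_comm Complex.I, mul_smul, neg_smul, ← sub_eq_add_neg, ← smul_sub, sub_sub]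

theorem quadPart_mulVec (p : (Fin (m + 1) → ℝ) × ℂ) (x : ℝ) (w z : Fin n → ℂ) :
    P.quadPart ubar p x *ᵥ Sum.elim w z = Sum.elim (0 : Fin n → ℂ)
      (∑ j : Fin m, ∑ k : Fin m, ((p.1 j.succ : ℂ) * (p.1 k.succ : ℂ)) •
        (P.coeffB ubar j.succ k.succ x *ᵥ w - P.coeffB ubar j.succ 0 x *ᵥ
          (P.coeffBinv ubar x *ᵥ (P.coeffB ubar 0 k.succ x *ᵥ w)))) := by
  simp only [quadPart, sysQuad, Matrix.sum_mulVec, Matrix.smul_mulVec,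
    Matrix.fromBlocks_mulVec, Sum.elim_comp_inl, Sum.elim_comp_inr, Matrix.zero_mulVec,
    add_zero, smul_elim_elim, sum_elim_elim, smul_zero, Finset.sum_const_zero,
    Matrix.mulVec_mulVec, Matrix.sub_mulVec]

variable {X : ℝ} {q : Fin n → ℝ}

theorem continuous_linPart (hw : P.IsPeriodicWave ubar X q) (h0 : P.H0) (h1 : P.H1)
    (p : (Fin (m + 1) → ℝ) × ℂ) : Continuous (P.linPart ubar p) := by
  have hL := continuous_sysLin hw h0 h1
  unfold linPart
  fun_prop

theorem continuous_quadPart (hw : P.IsPeriodicWave ubar X q) (h0 : P.H0) (h1 : P.H1)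
    (p : (Fin (m + 1) → ℝ) × ℂ) : Continuous (P.quadPart ubar p) := by
  have hQ := continuous_sysQuad hw h0 h1
  unfold quadPart
  fun_prop

theorem norm_ofReal_apply_le (p : (Fin (m + 1) → ℝ) × ℂ) (j : Fin (m + 1)) :
    ‖(p.1 j : ℂ)‖ ≤ ‖p‖ := by
  rw [Complex.norm_real]
  exact (norm_le_pi_norm p.1 j).trans (norm_fst_le p)

/-- Bounds of the parts of the first-order system over a period. -/
theorem exists_part_bounds (hw : P.IsPeriodicWave ubar X q) (h0 : P.H0) (h1 : P.H1) :
    ∃ K : ℝ, 1 ≤ K ∧ ∀ p, ∀ x ∈ Set.Icc 0 X, ∀ y,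
      ‖P.sysZero ubar x *ᵥ y‖ ≤ K * ‖y‖ ∧ ‖P.linPart ubar p x *ᵥ y‖ ≤ K * ‖p‖ * ‖y‖ ∧
      ‖P.quadPart ubar p x *ᵥ y‖ ≤ K * ‖p‖ ^ 2 * ‖y‖ := by
  obtain ⟨KZ, hKZ, hZ⟩ := exists_norm_mulVec_le (continuous_sysZero hw h0 h1) X
  obtain ⟨Kl, hKl, hl⟩ := exists_norm_mulVec_le (continuous_const (y := sysLam n)) X
  choose KL hKL hL using fun k => exists_norm_mulVec_le (continuous_sysLin hw h0 h1 k) X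
  choose KQ hKQ hQ using fun j k => exists_norm_mulVec_le (continuous_sysQuad hw h0 h1 j k) X
  have hSL : 0 ≤ ∑ k, KL k := Finset.sum_nonneg fun k _ => hKL k
  have hSQ : 0 ≤ ∑ j, ∑ k, KQ j k :=
    Finset.sum_nonneg fun j _ => Finset.sum_nonneg fun k _ => hKQ j k
  refine ⟨1 + KZ + Kl + ∑ k, KL k + ∑ j, ∑ k, KQ j k, by linarith, fun p x hx y => ⟨?_, ?_, ?_⟩⟩
  · refine (hZ x hx y).trans (mul_le_mul_of_nonneg_right ?_ (norm_nonneg _))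
    linarith
  · have hp2 : ‖p.2‖ ≤ ‖p‖ := norm_snd_le p
    have hb : ‖P.linPart ubar p x *ᵥ y‖ ≤ (Kl + ∑ k, KL k) * ‖p‖ * ‖y‖ := by
      simp only [linPart, Matrix.add_mulVec, Matrix.sum_mulVec, Matrix.smul_mulVec]
      refine (norm_add_le _ _).trans ?_
      rw [add_mul, add_mul, Finset.sum_mul, Finset.sum_mul]
      refine add_le_add ?_ ((norm_sum_le _ _).trans (Finset.sum_le_sum fun k _ => ?_))
      · rw [norm_smul]
        calc ‖p.2‖ * ‖sysLam n *ᵥ y‖ ≤ ‖p‖ * (Kl * ‖y‖) :=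
              mul_le_mul hp2 (hl x hx y) (norm_nonneg _) (norm_nonneg _)
          _ = Kl * ‖p‖ * ‖y‖ := by ring
      · rw [norm_smul]
        calc ‖(p.1 k.succ : ℂ)‖ * ‖P.sysLin ubar k x *ᵥ y‖ ≤ ‖p‖ * (KL k * ‖y‖) :=
              mul_le_mul (norm_ofReal_apply_le p _) (hL k x hx y) (norm_nonneg _) (norm_nonneg _)
          _ = KL k * ‖p‖ * ‖y‖ := by ring
    refine hb.trans (mul_le_mul_of_nonneg_right (mul_le_mul_of_nonneg_right ?_ (norm_nonneg _))
      (norm_nonneg _))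
    linarith
  · have hb : ‖P.quadPart ubar p x *ᵥ y‖ ≤ (∑ j, ∑ k, KQ j k) * ‖p‖ ^ 2 * ‖y‖ := by
      simp only [quadPart, Matrix.sum_mulVec, Matrix.smul_mulVec, Finset.sum_mul]
      refine (norm_sum_le _ _).trans (Finset.sum_le_sum fun j _ =>
        (norm_sum_le _ _).trans (Finset.sum_le_sum fun k _ => ?_))
      rw [norm_smul, norm_mul]
      calc ‖(p.1 j.succ : ℂ)‖ * ‖(p.1 k.succ : ℂ)‖ * ‖P.sysQuad ubar j k x *ᵥ y‖
          ≤ ‖p‖ * ‖p‖ * (KQ j k * ‖y‖) :=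
            mul_le_mul (mul_le_mul (norm_ofReal_apply_le p _) (norm_ofReal_apply_le p _)
              (norm_nonneg _) (norm_nonneg _)) (hQ j k x hx y) (norm_nonneg _) (by positivity)
        _ = KQ j k * ‖p‖ ^ 2 * ‖y‖ := by ring
    refine hb.trans (mul_le_mul_of_nonneg_right (mul_le_mul_of_nonneg_right ?_ (by positivity))
      (norm_nonneg _))
    linarith

theorem sysZero_mulVec_inr (x : ℝ) (y : Fin n ⊕ Fin n → ℂ) (a : Fin n) :
    (P.sysZero ubar x *ᵥ y) (Sum.inr a) = 0 := by
  rw [← Sum.elim_comp_inl_inr y, sysZero_mulVec]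
  rfl

theorem integral_apply {κ : Type*} [Fintype κ] {g : ℝ → κ → ℂ} (hg : Continuous g) (s t : ℝ)
    (i : κ) : (∫ x in s..t, g x) i = ∫ x in s..t, g x i :=
  ((ContinuousLinearMap.proj (R := ℝ) (φ := fun _ : κ => ℂ) i).intervalIntegral_comp_comm
    (hg.intervalIntegrable s t)).symm

/-- Solutions of the first-order system compared with approximate solutions. -/
theorem exists_flow_error (hw : P.IsPeriodicWave ubar X q) (h0 : P.H0) (h1 : P.H1) :
    ∃ C : ℝ, 0 ≤ C ∧ ∀ (p : (Fin (m + 1) → ℝ) × ℂ) (ω g g' : ℝ → Fin n ⊕ Fin n → ℂ) (ε : ℝ),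
      ‖p‖ ≤ 1 → 0 ≤ ε →
      (∀ x, HasDerivAt ω (P.sysMatrix ubar (Fin.tail p.1) p.2 x *ᵥ ω x) x) →
      (∀ x ∈ Set.Icc 0 X, HasDerivAt g (g' x) x) → Continuous g → g 0 = ω 0 →
      (∀ x ∈ Set.Icc 0 X, ‖g' x - P.sysMatrix ubar (Fin.tail p.1) p.2 x *ᵥ g x‖ ≤ ε) →
      ‖ω X - g X‖ ≤ C * ε ∧ ∀ a, ‖ω X (Sum.inr a) - ω 0 (Sum.inr a) -
        (∫ x in (0 : ℝ)..X, ((P.linPart ubar p x + P.quadPart ubar p x) *ᵥ g x)) (Sum.inr a)‖ ≤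
          C * ε * ‖p‖ := by
  obtain ⟨K, hK1, hK⟩ := exists_part_bounds hw h0 h1
  have hX := hw.period_pos
  set C₀ := Real.exp (3 * K * X) / (3 * K) with hC₀
  have hC₀p : 0 ≤ C₀ := by positivity
  refine ⟨max C₀ (2 * K * C₀ * X), le_max_of_le_left hC₀p, ?_⟩
  intro p ω g g' ε hp hε hω hg hgc hg0 herr
  have hLQ : ∀ x ∈ Set.Icc 0 X, ∀ y,
      ‖(P.linPart ubar p x + P.quadPart ubar p x) *ᵥ y‖ ≤ 2 * K * ‖p‖ * ‖y‖ := by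
    intro x hx y
    obtain ⟨-, h3, h4⟩ := hK p x hx y
    rw [Matrix.add_mulVec]
    have h5 : ‖p‖ ^ 2 ≤ ‖p‖ := by nlinarith [norm_nonneg p]
    have h6 : K * ‖p‖ ^ 2 * ‖y‖ ≤ K * ‖p‖ * ‖y‖ :=
      mul_le_mul_of_nonneg_right (mul_le_mul_of_nonneg_left h5 (by linarith)) (norm_nonneg _)
    calc _ ≤ _ := norm_add_le _ _
      _ ≤ K * ‖p‖ * ‖y‖ + K * ‖p‖ * ‖y‖ := add_le_add h3 (h4.trans h6)
      _ = _ := by ring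
  have hA : ∀ x ∈ Set.Icc 0 X, ∀ y,
      ‖P.sysMatrix ubar (Fin.tail p.1) p.2 x *ᵥ y‖ ≤ 3 * K * ‖y‖ := by
    intro x hx y
    rw [sysMatrix_tail, add_assoc, Matrix.add_mulVec]
    have h6 : 2 * K * ‖p‖ * ‖y‖ ≤ 2 * K * 1 * ‖y‖ :=
      mul_le_mul_of_nonneg_right (mul_le_mul_of_nonneg_left hp (by linarith)) (norm_nonneg _)
    calc _ ≤ _ := norm_add_le _ _
      _ ≤ K * ‖y‖ + 2 * K * 1 * ‖y‖ := add_le_add (hK p x hx y).1 ((hLQ x hx y).trans h6)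
      _ = _ := by ring
  have hdiff : ∀ x ∈ Set.Icc 0 X, ‖ω x - g x‖ ≤ C₀ * ε := by
    intro x hx
    refine norm_le_of_perturbation (f := fun x => ω x - g x) (by linarith) hε
      (fun y hy => (hω y).sub (hg y hy)) (by rw [hg0, sub_self]) (fun y hy => ?_) hx
    have h3 : P.sysMatrix ubar (Fin.tail p.1) p.2 y *ᵥ ω y - g' y =
        P.sysMatrix ubar (Fin.tail p.1) p.2 y *ᵥ (ω y - g y) -
          (g' y - P.sysMatrix ubar (Fin.tail p.1) p.2 y *ᵥ g y) := by
      rw [Matrix.mulVec_sub]; abel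
    rw [h3]
    exact (norm_sub_le _ _).trans (add_le_add (hA y hy _) (herr y hy))
  refine ⟨(hdiff X ⟨hX.le, le_rfl⟩).trans (mul_le_mul_of_nonneg_right (le_max_left _ _) hε),
    fun a => ?_⟩
  have hωc : Continuous ω := continuous_iff_continuousAt.2 fun x => (hω x).continuousAt
  have hLQc : Continuous fun x => P.linPart ubar p x + P.quadPart ubar p x :=
    (continuous_linPart hw h0 h1 p).add (continuous_quadPart hw h0 h1 p)
  have hcω : Continuous fun x => (P.linPart ubar p x + P.quadPart ubar p x) *ᵥ ω x :=
    hLQc.matrix_mulVec hωc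
  have hcg : Continuous fun x => (P.linPart ubar p x + P.quadPart ubar p x) *ᵥ g x :=
    hLQc.matrix_mulVec hgc
  have hftc : ω X (Sum.inr a) - ω 0 (Sum.inr a) = ∫ x in (0 : ℝ)..X,
      ((P.linPart ubar p x + P.quadPart ubar p x) *ᵥ ω x) (Sum.inr a) := by
    refine (intervalIntegral.integral_eq_sub_of_hasDerivAt (f := fun x => ω x (Sum.inr a))
      (fun x _ => ?_) ((continuous_pi_iff.1 hcω _).intervalIntegrable _ _)).symm
    have h3 := hasDerivAt_pi.1 (hω x) (Sum.inr a)
    rwa [sysMatrix_tail, add_assoc, Matrix.add_mulVec, Pi.add_apply, sysZero_mulVec_inr,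
      zero_add] at h3
  rw [hftc, integral_apply hcg, ← intervalIntegral.integral_sub
    ((continuous_pi_iff.1 hcω _).intervalIntegrable _ _)
    ((continuous_pi_iff.1 hcg _).intervalIntegrable _ _)]
  have h4 := intervalIntegral.norm_integral_le_of_norm_le_const (a := 0) (b := X)
    (C := 2 * K * ‖p‖ * (C₀ * ε)) (f := fun x =>
      ((P.linPart ubar p x + P.quadPart ubar p x) *ᵥ ω x) (Sum.inr a) -
        ((P.linPart ubar p x + P.quadPart ubar p x) *ᵥ g x) (Sum.inr a)) ?_
  · refine h4.trans ?_
    rw [sub_zero, abs_of_pos hX]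
    calc 2 * K * ‖p‖ * (C₀ * ε) * X = (2 * K * C₀ * X) * ε * ‖p‖ := by ring
      _ ≤ _ := mul_le_mul_of_nonneg_right (mul_le_mul_of_nonneg_right (le_max_right _ _) hε)
        (norm_nonneg _)
  · intro x hx
    rw [Set.uIoc_of_le hX.le] at hx
    have hx' : x ∈ Set.Icc 0 X := ⟨hx.1.le, hx.2⟩
    rw [← Pi.sub_apply, ← Matrix.mulVec_sub]
    refine (norm_le_pi_norm _ _).trans ((hLQ x hx' _).trans ?_)
    exact mul_le_mul_of_nonneg_left (hdiff x hx') (by positivity)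

end System

namespace System

variable {n m : ℕ} {P : System n m} {ubar : ℝ → Fin n → ℝ} {X : ℝ} {q : Fin n → ℝ}

/-- The flux `f^j(ubar) - B^{j1}(ubar) ubar'` of the wave. -/
def waveFlux (P : System n m) (ubar : ℝ → Fin n → ℝ) (j : Fin (m + 1)) (x : ℝ) : Fin n → ℝ :=
  P.f j (ubar x) - P.B j 0 (ubar x) *ᵥ deriv ubar x

theorem fluxDensity_basePoint (hw : P.IsPeriodicWave ubar X q) (h1 : P.H1) (j : Fin (m + 1))
    (x : ℝ) : P.fluxDensity j (ubar x, basePoint m ubar X q) = P.waveFlux ubar j x := by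
  rw [fluxDensity, waveFlux, hw.deriv_eq h1, Fin.sum_univ_succ]
  simp [normal_basePoint]

theorem waveFlux_zero (hw : P.IsPeriodicWave ubar X q) (x : ℝ) :
    P.waveFlux ubar 0 x = q := by
  obtain ⟨-, v', hv', heq⟩ := hw.profile x (Set.mem_univ x)
  have hd : v' = deriv ubar x := (hasDerivWithinAt_univ.1 hv').deriv.symm
  have h2 := viscosity_basePoint (P := P) (ubar := ubar) (X := X) (q := q) (ubar x)
  simp only [viscosity, normal_basePoint] at h2
  rw [h2, hd, Fin.sum_univ_succ] at heq
  simp only [Pi.single_eq_same, one_smul, Pi.single_eq_of_ne (Fin.succ_ne_zero _), zero_smul,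
    Finset.sum_const_zero, add_zero, sub_zero] at heq
  rw [waveFlux, heq]
  abel

theorem continuous_waveFlux (hw : P.IsPeriodicWave ubar X q) (h0 : P.H0) (h1 : P.H1)
    (j : Fin (m + 1)) : Continuous (P.waveFlux ubar j) := by
  have h := continuous_fluxDensity hw h0 h1 j
  simpa only [fluxDensity_basePoint hw h1] using h

theorem X_smul_M_basePoint (hw : P.IsPeriodicWave ubar X q) (h0 : P.H0) (h1 : P.H1) :
    ∫ x in (0 : ℝ)..X, ubar x = X • P.M (basePoint m ubar X q) := by
  rw [M_basePoint hw h0 h1, smul_smul, mul_one_div_cancel hw.period_pos.ne', one_smul]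

theorem X_smul_F_basePoint (hw : P.IsPeriodicWave ubar X q) (h0 : P.H0) (h1 : P.H1)
    (j : Fin (m + 1)) :
    ∫ x in (0 : ℝ)..X, P.waveFlux ubar j x = X • P.F j (basePoint m ubar X q) := by
  rw [F_basePoint hw h0 h1, smul_smul, mul_one_div_cancel hw.period_pos.ne', one_smul]
  simp only [fluxDensity_basePoint hw h1]

theorem F_zero_basePoint (hw : P.IsPeriodicWave ubar X q) (h0 : P.H0) (h1 : P.H1) :
    P.F 0 (basePoint m ubar X q) = q := by
  have h := X_smul_F_basePoint hw h0 h1 0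
  simp only [waveFlux_zero hw, intervalIntegral.integral_const, sub_zero] at h
  exact (smul_right_injective _ hw.period_pos.ne' h).symm

theorem contDiff_deriv_ubar (hw : P.IsPeriodicWave ubar X q) (h0 : P.H0) (h1 : P.H1) :
    ContDiff ℝ 1 (deriv ubar) := by
  have h2 : ContDiff ℝ (1 + 1) ubar := (hw.contDiff h0 h1).of_le (by norm_num)
  exact (contDiff_succ_iff_deriv.1 h2).2.2

theorem hasDerivAt_waveFlux (hw : P.IsPeriodicWave ubar X q) (h0 : P.H0) (h1 : P.H1)
    (j : Fin (m + 1)) (x : ℝ) : HasDerivAt (P.waveFlux ubar j)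
      (P.realA ubar j x *ᵥ deriv ubar x - P.B j 0 (ubar x) *ᵥ deriv (deriv ubar) x) x := by
  have hu : HasDerivAt ubar (deriv ubar x) x := (hw.hasDerivAt h1 x).differentiableAt.hasDerivAt
  have hu' : HasDerivAt (deriv ubar) (deriv (deriv ubar) x) x :=
    ((contDiff_deriv_ubar hw h0 h1).differentiable one_ne_zero x).hasDerivAt
  rw [hasDerivAt_pi]
  intro a
  have hf : HasDerivAt (fun x => P.f j (ubar x) a) (fderiv ℝ (P.f j) (ubar x) (deriv ubar x) a) x :=
    hasDerivAt_pi.1 ((h0.differentiableAt_f j (hw.mem_U x)).hasFDerivAt.comp_hasDerivAt x hu) a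
  have hB : ∀ c, HasDerivAt (fun x => P.B j 0 (ubar x) a c)
      (fderiv ℝ (fun u => P.B j 0 u a c) (ubar x) (deriv ubar x)) x := fun c =>
    (h0.differentiableAt_B j 0 a c (hw.mem_U x)).hasFDerivAt.comp_hasDerivAt x hu
  have h := hf.sub (HasDerivAt.fun_sum (u := Finset.univ) fun c _ =>
    (hB c).mul (hasDerivAt_pi.1 hu' c))
  refine h.congr_deriv ?_
  rw [Pi.sub_apply, realA_mulVec, Finset.sum_add_distrib, ← sub_sub]
  rfl

theorem B_mulVec_deriv_deriv_ubar (hw : P.IsPeriodicWave ubar X q) (h0 : P.H0) (h1 : P.H1) (x : ℝ) :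
    P.B 0 0 (ubar x) *ᵥ deriv (deriv ubar) x = P.realA ubar 0 x *ᵥ deriv ubar x := by
  have h := hasDerivAt_waveFlux hw h0 h1 0 x
  have h2 : P.waveFlux ubar 0 = fun _ => q := funext fun x => waveFlux_zero hw x
  rw [h2] at h
  exact (sub_eq_zero.1 (h.unique (hasDerivAt_const x q))).symm

/-- The variation of the flux `f^j - ∑ B^{jk} ν_k u'` along a variation of the profile. -/
def fluxVariation (P : System n m) (ubar : ℝ → Fin n → ℝ) (η : Params n m) (v v' : ℝ → Fin n → ℝ)
    (j : Fin (m + 1)) (x : ℝ) : Fin n → ℝ :=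
  P.realA ubar j x *ᵥ v x - P.B j 0 (ubar x) *ᵥ v' x -
    ∑ k : Fin m, η.2.2.2.1 k • (P.B j k.succ (ubar x) *ᵥ deriv ubar x)

variable {η : Params n m} {v v' : ℝ → Fin n → ℝ}

theorem continuous_B_ubar (hw : P.IsPeriodicWave ubar X q) (h0 : P.H0) (h1 : P.H1)
    (j k : Fin (m + 1)) : Continuous fun x => P.B j k (ubar x) :=
  continuous_matrix fun a b =>
    (contDiff_comp_ubar hw h0 h1 one_le_two ((h0.2 j k a b).of_le one_le_two)).continuous

theorem continuous_realA (hw : P.IsPeriodicWave ubar X q) (h0 : P.H0) (h1 : P.H1)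
    (j : Fin (m + 1)) : Continuous fun x => P.realA ubar j x :=
  continuous_matrix fun a b => (contDiff_realA hw h0 h1 j a b).continuous

theorem IsVariation.continuous_fluxVariation (hw : P.IsPeriodicWave ubar X q) (h0 : P.H0)
    (h1 : P.H1) (hv : P.IsVariation ubar X q η v v') (j : Fin (m + 1)) :
    Continuous (P.fluxVariation ubar η v v' j) := by
  unfold fluxVariation
  refine (((continuous_realA hw h0 h1 j).matrix_mulVec hv.continuous).sub
    ((continuous_B_ubar hw h0 h1 j 0).matrix_mulVec hv.continuous_deriv)).sub
    (continuous_finsetSum _ fun k _ => ?_)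
  exact ((continuous_B_ubar hw h0 h1 j k.succ).matrix_mulVec
    (contDiff_deriv_ubar hw h0 h1).continuous).const_smul (η.2.2.2.1 k)

theorem IsVariation.fluxVariation_zero (hv : P.IsVariation ubar X q η v v') {x : ℝ}
    (hx : x ∈ Set.Icc 0 X) : P.fluxVariation ubar η v v' 0 x =
      speed η • ubar x + constant η - ∑ k : Fin m, η.2.2.2.1 k • P.waveFlux ubar k.succ x := by
  rw [fluxVariation, hv.equation x hx]
  simp only [waveFlux, smul_sub, Finset.sum_sub_distrib]
  abel

theorem IsVariation.fderiv_F_zero (hw : P.IsPeriodicWave ubar X q) (h0 : P.H0)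
    (h1 : P.H1) (hv : P.IsVariation ubar X q η v v') :
    fderiv ℝ (P.F 0) (basePoint m ubar X q) η = speed η • P.M (basePoint m ubar X q) +
      constant η - ∑ k : Fin m, η.2.2.2.1 k • P.F k.succ (basePoint m ubar X q) := by
  have hX := hw.period_pos
  have hcu := hw.continuous h1
  have hcF := fun k : Fin m => continuous_waveFlux hw h0 h1 k.succ
  apply smul_right_injective _ hX.ne'
  simp only
  rw [hv.fderiv_F 0]
  have h2 : ∫ x in (0 : ℝ)..X, P.fluxVariation ubar η v v' 0 x = ∫ x in (0 : ℝ)..X,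
      (speed η • ubar x + constant η -
        ∑ k : Fin m, η.2.2.2.1 k • P.waveFlux ubar k.succ x) := by
    refine intervalIntegral.integral_congr fun x hx => hv.fluxVariation_zero ?_
    rwa [Set.uIcc_of_le hX.le] at hx
  refine h2.trans ?_
  have hi : ∀ {g : ℝ → Fin n → ℝ}, Continuous g → IntervalIntegrable g MeasureTheory.volume 0 X :=
    fun hg => hg.intervalIntegrable _ _
  rw [intervalIntegral.integral_sub (hi (by fun_prop)) (hi (by fun_prop)),
    intervalIntegral.integral_add (hi (by fun_prop)) (hi (by fun_prop)),
    intervalIntegral.integral_finsetSum fun k _ => hi (by fun_prop)]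
  simp only [intervalIntegral.integral_smul, intervalIntegral.integral_const,
    X_smul_M_basePoint hw h0 h1, X_smul_F_basePoint hw h0 h1, sub_zero, smul_sub, smul_add,
    Finset.smul_sum]
  congr 1
  · rw [smul_comm]
  · exact Finset.sum_congr rfl fun k _ => smul_comm _ _ _

theorem continuous_complexify {g : ℝ → Fin n → ℝ} (hg : Continuous g) :
    Continuous fun x => complexify n (g x) := (complexify n).continuous.comp hg

theorem integral_complexify {g : ℝ → Fin n → ℝ} (hg : Continuous g) :
    ∫ x in (0 : ℝ)..X, complexify n (g x) = complexify n (∫ x in (0 : ℝ)..X, g x) :=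
  (complexify n).intervalIntegral_comp_comm (hg.intervalIntegrable _ _)

theorem complexify_smul (c : ℝ) (u : Fin n → ℝ) :
    complexify n (c • u) = (c : ℂ) • complexify n u := by
  ext a
  simp [complexify_apply]

/-- The part of first order in `(ξ, λ)` of the derivative of the flux variable, along a
variation of the profile. -/
def fluxRate (P : System n m) (ubar : ℝ → Fin n → ℝ) (η : Params n m) (v v' : ℝ → Fin n → ℝ)
    (p : (Fin (m + 1) → ℝ) × ℂ) (x : ℝ) : Fin n → ℂ :=
  p.2 • complexify n (v x) + ∑ k : Fin m, (Complex.I * p.1 k.succ) •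
    complexify n (P.fluxVariation ubar η v v' k.succ x)

theorem IsVariation.continuous_fluxRate (hw : P.IsPeriodicWave ubar X q) (h0 : P.H0)
    (h1 : P.H1) (hv : P.IsVariation ubar X q η v v') (p : (Fin (m + 1) → ℝ) × ℂ) :
    Continuous (P.fluxRate ubar η v v' p) := by
  have h2 := continuous_complexify hv.continuous
  have h3 := fun k : Fin m => continuous_complexify (hv.continuous_fluxVariation hw h0 h1 k.succ)
  unfold fluxRate
  fun_prop

theorem IsVariation.integral_fluxRate (hw : P.IsPeriodicWave ubar X q) (h0 : P.H0)
    (h1 : P.H1) (hv : P.IsVariation ubar X q η v v') (p : (Fin (m + 1) → ℝ) × ℂ) :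
    ∫ x in (0 : ℝ)..X, P.fluxRate ubar η v v' p x =
      (X : ℂ) • (P.whithamFlux (basePoint m ubar X q) p.1 p.2 η -
        (Complex.I * p.1 0) • complexify n (fderiv ℝ (P.F 0) (basePoint m ubar X q) η)) := by
  have h2 := continuous_complexify hv.continuous
  have h3 := fun k : Fin m => continuous_complexify (hv.continuous_fluxVariation hw h0 h1 k.succ)
  have hi : ∀ {g : ℝ → Fin n → ℂ}, Continuous g → IntervalIntegrable g MeasureTheory.volume 0 X :=
    fun hg => hg.intervalIntegrable _ _
  have hF : ∀ j, ∫ x in (0 : ℝ)..X, P.fluxVariation ubar η v v' j x =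
    X • fderiv ℝ (P.F j) (basePoint m ubar X q) η := fun j => (hv.fderiv_F j).symm
  unfold fluxRate
  rw [intervalIntegral.integral_add (hi (by fun_prop)) (hi (by fun_prop)),
    intervalIntegral.integral_finsetSum fun k _ => hi (by fun_prop)]
  simp only [intervalIntegral.integral_smul, integral_complexify hv.continuous,
    integral_complexify (hv.continuous_fluxVariation hw h0 h1 _), ← hv.fderiv_M, hF,
    complexify_smul, whithamFlux_apply, Fin.sum_univ_succ, smul_sub, smul_add, Finset.smul_sum]
  rw [smul_comm p.2]
  simp only [smul_comm (X : ℂ) (Complex.I * _)]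
  abel

end System

namespace System

variable {n m : ℕ} {P : System n m} {ubar : ℝ → Fin n → ℝ} {X : ℝ} {q : Fin n → ℝ}

theorem map_ofReal_mulVec_complexify (A : Matrix (Fin n) (Fin n) ℝ) (u : Fin n → ℝ) :
    A.map Complex.ofReal *ᵥ complexify n u = complexify n (A *ᵥ u) := by
  ext a
  simp [Matrix.mulVec, dotProduct, complexify_apply]

theorem coeffA_mulVec_complexify (j : Fin (m + 1)) (x : ℝ) (u : Fin n → ℝ) :
    P.coeffA ubar j x *ᵥ complexify n u = complexify n (P.realA ubar j x *ᵥ u) :=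
  map_ofReal_mulVec_complexify _ _

theorem coeffB_mulVec_complexify (j k : Fin (m + 1)) (x : ℝ) (u : Fin n → ℝ) :
    P.coeffB ubar j k x *ᵥ complexify n u = complexify n (P.B j k (ubar x) *ᵥ u) :=
  map_ofReal_mulVec_complexify _ _

theorem coeffBinv_mulVec_complexify (hw : P.IsPeriodicWave ubar X q) (h1 : P.H1) {x : ℝ}
    {u u' r : Fin n → ℝ} (h : P.B 0 0 (ubar x) *ᵥ u' = P.realA ubar 0 x *ᵥ u + r) :
    P.coeffBinv ubar x *ᵥ (P.coeffA ubar 0 x *ᵥ complexify n u + complexify n r) =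
      complexify n u' := by
  rw [coeffA_mulVec_complexify, ← map_add, ← h, ← coeffB_mulVec_complexify, Matrix.mulVec_mulVec,
    coeffBinv_mul_coeffB hw h1, Matrix.one_mulVec]

theorem hasDerivAt_elim {u u' : ℝ → Fin n → ℂ} {x : ℝ} {v v' : Fin n → ℂ}
    (hu : HasDerivAt u v x) (hu' : HasDerivAt u' v' x) :
    HasDerivAt (fun x => Sum.elim (u x) (u' x)) (Sum.elim v v') x := by
  rw [hasDerivAt_pi] at hu hu' ⊢
  rintro (a | a)
  · exact hu a
  · exact hu' a

theorem continuous_elim {u u' : ℝ → Fin n → ℂ} (hu : Continuous u) (hu' : Continuous u') :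
    Continuous fun x => Sum.elim (u x) (u' x) := by
  rw [continuous_pi_iff] at hu hu' ⊢
  rintro (a | a)
  · exact hu a
  · exact hu' a

theorem hasDerivAt_complexify {u : ℝ → Fin n → ℝ} {u' : Fin n → ℝ} {x : ℝ}
    (hu : HasDerivAt u u' x) : HasDerivAt (fun x => complexify n (u x)) (complexify n u') x :=
  (complexify n).hasFDerivAt.comp_hasDerivAt x hu

/-- The Floquet factor `e^{i X ξ₁}` near the origin. -/
theorem eventually_floquet (hX : 0 < X) : ∀ᶠ p : (Fin (m + 1) → ℝ) × ℂ in 𝓝 0, ‖p‖ ≤ 1 ∧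
    ‖Complex.exp (Complex.I * X * p.1 0) - 1‖ ≤ 2 * X * ‖p‖ ∧
    ‖Complex.exp (Complex.I * X * p.1 0) - 1 - Complex.I * X * p.1 0‖ ≤ X ^ 2 * ‖p‖ ^ 2 := by
  have hr : 0 < min 1 (1 / X) := lt_min one_pos (by positivity)
  filter_upwards [Metric.ball_mem_nhds (0 : (Fin (m + 1) → ℝ) × ℂ) hr] with p hp
  rw [mem_ball_zero_iff, lt_min_iff] at hp
  have h2 : ‖Complex.I * X * p.1 0‖ ≤ X * ‖p‖ := by
    rw [norm_mul, norm_mul, Complex.norm_I, one_mul, Complex.norm_real, Real.norm_of_nonneg hX.le]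
    exact mul_le_mul_of_nonneg_left (norm_ofReal_apply_le p 0) hX.le
  have h3 : ‖Complex.I * X * p.1 0‖ ≤ 1 := by
    refine h2.trans ?_
    have := mul_le_mul_of_nonneg_left hp.2.le hX.le
    rwa [mul_one_div_cancel hX.ne'] at this
  refine ⟨hp.1.le, ?_, ?_⟩
  · refine (Complex.norm_exp_sub_one_le h3).trans ?_
    linarith
  · refine (Complex.norm_exp_sub_one_sub_id_le h3).trans ?_
    rw [← mul_pow]
    exact pow_le_pow_left₀ (norm_nonneg _) h2 2

theorem norm_integral_apply_sub_le {F : ℝ → Fin n ⊕ Fin n → ℂ} {R : ℝ → Fin n → ℂ}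
    (hF : Continuous F) (hR : Continuous R) (hX : 0 < X) {ε : ℝ} {a : Fin n}
    (h : ∀ x ∈ Set.Icc 0 X, ‖F x (Sum.inr a) - R x a‖ ≤ ε) :
    ‖(∫ x in (0 : ℝ)..X, F x) (Sum.inr a) - (∫ x in (0 : ℝ)..X, R x) a‖ ≤ ε * X := by
  rw [integral_apply hF, integral_apply hR, ← intervalIntegral.integral_sub
    ((continuous_pi_iff.1 hF _).intervalIntegrable _ _)
    ((continuous_pi_iff.1 hR _).intervalIntegrable _ _)]
  refine (intervalIntegral.norm_integral_le_of_norm_le_const (C := ε) fun x hx => ?_).trans ?_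
  · rw [Set.uIoc_of_le hX.le] at hx
    exact h x ⟨hx.1.le, hx.2⟩
  · rw [sub_zero, abs_of_pos hX]

theorem exists_bound_Icc {E : Type*} [NormedAddCommGroup E] {g : ℝ → E} (hg : Continuous g)
    (X : ℝ) : ∃ C : ℝ, 0 ≤ C ∧ ∀ x ∈ Set.Icc 0 X, ‖g x‖ ≤ C := by
  obtain ⟨C, hC⟩ := (isCompact_Icc (a := (0 : ℝ)) (b := X)).exists_bound_of_continuousOn
    hg.continuousOn
  exact ⟨max C 0, le_max_right _ _, fun x hx => (hC x hx).trans (le_max_left _ _)⟩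

/-- The factors of the rows in the comparison of the Evans matrix with `reducedMatrix`. -/
def rowScale (n : ℕ) (X : ℝ) : Fin n ⊕ Fin n → ℂ := Sum.elim (fun _ => 1) (fun _ => X)

theorem dataDir_components (c : Fin n ⊕ Fin n) :
    (dataDir m c).1 = 0 ∧ speed (dataDir m c) = 0 ∧ (dataDir m c).2.2.2.1 = 0 := by
  rcases c with c | c <;> exact ⟨rfl, rfl, rfl⟩

/-- The columns of the Evans matrix along the initial data `a` and `q`. -/
theorem exists_dataDir_error (hw : P.IsPeriodicWave ubar X q) (h0 : P.H0) (h1 : P.H1)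
    (c : Fin n ⊕ Fin n) : ∃ C : ℝ, ∀ᶠ p : (Fin (m + 1) → ℝ) × ℂ in 𝓝 0,
      ∀ ω : ℝ → Fin n ⊕ Fin n → ℂ,
      (∀ x, HasDerivAt ω (P.sysMatrix ubar (Fin.tail p.1) p.2 x *ᵥ ω x) x) →
      ω 0 = Sum.elim (complexify n (start (dataDir m c))) (-complexify n (constant (dataDir m c))) →
      ∀ r, ‖ω X r - Complex.exp (Complex.I * X * p.1 0) * ω 0 r - rowScale n X r *
        P.profileMap (basePoint m ubar X q) p.1 p.2 (dataDir m c) r‖ ≤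
          C * ‖p‖ ^ (rowDegree r + 1) := by
  set η : Params n m := dataDir m c with hη
  obtain ⟨hη1, hηs, hηδ⟩ := dataDir_components (m := m) c
  rw [← hη] at hη1 hηs hηδ
  obtain ⟨v, v', hv⟩ := exists_isVariation hw h0 h1 η hη1
  have hX := hw.period_pos
  obtain ⟨K, hK1, hK⟩ := exists_part_bounds hw h0 h1
  obtain ⟨C, hC0, hC⟩ := exists_flow_error hw h0 h1
  set Q : Fin n → ℂ := complexify n (constant η) with hQ
  set g : ℝ → Fin n ⊕ Fin n → ℂ := fun x => Sum.elim (complexify n (v x)) (-Q) with hg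
  have hgc : Continuous g := continuous_elim (continuous_complexify hv.continuous) continuous_const
  obtain ⟨G, hG0, hG⟩ := exists_bound_Icc hgc X
  have hBinv : ∀ x ∈ Set.Icc 0 X, P.coeffBinv ubar x *ᵥ
      (P.coeffA ubar 0 x *ᵥ complexify n (v x) + -Q) = complexify n (v' x) := by
    intro x hx
    rw [hQ, ← map_neg]
    refine coeffBinv_mulVec_complexify hw h1 ?_
    rw [hv.equation x hx, hηs, hηδ]
    simp [sub_eq_add_neg]
  have hgd : ∀ x ∈ Set.Icc 0 X, HasDerivAt g (Sum.elim (complexify n (v' x)) 0) x := fun x hx =>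
    hasDerivAt_elim (hasDerivAt_complexify (hv.hasDerivAt x hx)) (hasDerivAt_const x _)
  have hZ : ∀ x ∈ Set.Icc 0 X, P.sysZero ubar x *ᵥ g x = Sum.elim (complexify n (v' x)) 0 := by
    intro x hx
    rw [hg, sysZero_mulVec, hBinv x hx]
  have hL : ∀ p, ∀ x ∈ Set.Icc 0 X, ∀ a,
      (P.linPart ubar p x *ᵥ g x) (Sum.inr a) = P.fluxRate ubar η v v' p x a := by
    intro p x hx a
    rw [hg, linPart_mulVec, Sum.elim_inr, hBinv x hx]
    simp only [fluxRate, fluxVariation, hηδ, Pi.zero_apply, zero_smul, Finset.sum_const_zero,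
      sub_zero, map_sub, coeffA_mulVec_complexify, coeffB_mulVec_complexify]
  have hflux := fun p => hv.integral_fluxRate hw h0 h1 p
  have hF0 : fderiv ℝ (P.F 0) (basePoint m ubar X q) η = constant η := by
    rw [hv.fderiv_F_zero hw h0 h1, hηs, hηδ]
    simp
  refine ⟨C * (2 * K * G) + (2 * X) * G + K * G * X + X ^ 2 * G, ?_⟩
  filter_upwards [eventually_floquet (m := m) hX] with p ⟨hp1, hpe1, hpe2⟩ ω hω hω0
  set e := Complex.exp (Complex.I * X * p.1 0) with he
  have hp0 := norm_nonneg p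
  have hp2 : ‖p‖ ^ 2 ≤ ‖p‖ := by nlinarith
  have hQb : ∀ x ∈ Set.Icc 0 X, ‖P.quadPart ubar p x *ᵥ g x‖ ≤ K * ‖p‖ ^ 2 * G := fun x hx =>
    (hK p x hx (g x)).2.2.trans (mul_le_mul_of_nonneg_left (hG x hx) (by positivity))
  have herr : ∀ x ∈ Set.Icc 0 X, ‖Sum.elim (complexify n (v' x)) 0 -
      P.sysMatrix ubar (Fin.tail p.1) p.2 x *ᵥ g x‖ ≤ 2 * K * G * ‖p‖ := by
    intro x hx
    have h3 : Sum.elim (complexify n (v' x)) 0 - P.sysMatrix ubar (Fin.tail p.1) p.2 x *ᵥ g x =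
        -(P.linPart ubar p x *ᵥ g x + P.quadPart ubar p x *ᵥ g x) := by
      rw [sysMatrix_tail, Matrix.add_mulVec, Matrix.add_mulVec, hZ x hx]
      abel
    rw [h3, norm_neg]
    have h4 : ‖P.linPart ubar p x *ᵥ g x‖ ≤ K * ‖p‖ * G :=
      (hK p x hx (g x)).2.1.trans (mul_le_mul_of_nonneg_left (hG x hx) (by positivity))
    have h5 : K * ‖p‖ ^ 2 * G ≤ K * ‖p‖ * G :=
      mul_le_mul_of_nonneg_right (mul_le_mul_of_nonneg_left hp2 (by linarith)) hG0
    calc _ ≤ _ := norm_add_le _ _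
      _ ≤ K * ‖p‖ * G + K * ‖p‖ * G := add_le_add h4 ((hQb x hx).trans h5)
      _ = _ := by ring
  have hg0 : g 0 = ω 0 := by rw [hω0, hg]; simp only [hv.initial]
  obtain ⟨hE1, hE2⟩ := hC p ω g _ (2 * K * G * ‖p‖) hp1 (by positivity) hω hgd hgc hg0 herr
  have h0mem : (0 : ℝ) ∈ Set.Icc 0 X := ⟨le_rfl, hX.le⟩
  have hgr : ∀ r, ‖g 0 r‖ ≤ G := fun r => (norm_le_pi_norm _ r).trans (hG 0 h0mem)
  rintro (a | a)
  · have h3 : ω X (Sum.inl a) - e * ω 0 (Sum.inl a) - rowScale n X (Sum.inl a) *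
        P.profileMap (basePoint m ubar X q) p.1 p.2 η (Sum.inl a) =
        (ω X - g X) (Sum.inl a) - (e - 1) * g 0 (Sum.inl a) := by
      have h4 : P.profileMap (basePoint m ubar X q) p.1 p.2 η (Sum.inl a) =
          g X (Sum.inl a) - g 0 (Sum.inl a) := by
        simp only [profileMap, LinearMap.coe_mk, AddHom.coe_mk, Sum.elim_inl, hv.fderiv_H,
          map_sub, hg, Pi.sub_apply]
      rw [h4, hg0]
      simp only [rowScale, Sum.elim_inl, Pi.sub_apply]
      ring
    rw [h3]
    calc _ ≤ _ := norm_sub_le _ _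
      _ ≤ C * (2 * K * G * ‖p‖) + (2 * X * ‖p‖) * G := by
        refine add_le_add ((norm_le_pi_norm _ _).trans hE1) ?_
        rw [norm_mul]
        exact mul_le_mul hpe1 (hgr _) (norm_nonneg _) (by positivity)
      _ = (C * (2 * K * G) + (2 * X) * G) * ‖p‖ ^ (rowDegree (Sum.inl a : Fin n ⊕ Fin n) + 1) := by
        simp only [rowDegree, Sum.elim_inl, Pi.zero_apply]; ring
      _ ≤ _ := by
        refine mul_le_mul_of_nonneg_right ?_ (by positivity)
        have : 0 ≤ K * G * X := by positivity
        have : 0 ≤ X ^ 2 * G := by positivity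
        linarith
  · set J : ℂ := (∫ x in (0 : ℝ)..X, (P.linPart ubar p x + P.quadPart ubar p x) *ᵥ g x)
      (Sum.inr a) with hJ
    have hJb : ‖J - (∫ x in (0 : ℝ)..X, P.fluxRate ubar η v v' p x) a‖ ≤ K * ‖p‖ ^ 2 * G * X := by
      refine norm_integral_apply_sub_le (((continuous_linPart hw h0 h1 p).add
        (continuous_quadPart hw h0 h1 p)).matrix_mulVec hgc)
        (hv.continuous_fluxRate hw h0 h1 p) hX fun x hx => ?_
      rw [Pi.add_apply, Matrix.add_mulVec, Pi.add_apply, hL p x hx a, add_sub_cancel_left]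
      exact (norm_le_pi_norm _ _).trans (hQb x hx)
    have hg0r : ω 0 (Sum.inr a) = -Q a := by rw [hω0]; rfl
    have h3 : ω X (Sum.inr a) - e * ω 0 (Sum.inr a) - rowScale n X (Sum.inr a) *
        P.profileMap (basePoint m ubar X q) p.1 p.2 η (Sum.inr a) =
        (ω X (Sum.inr a) - ω 0 (Sum.inr a) - J) +
        (J - (∫ x in (0 : ℝ)..X, P.fluxRate ubar η v v' p x) a) +
        (e - 1 - Complex.I * X * p.1 0) * Q a := by
      rw [hflux p, hF0, hg0r]
      simp only [profileMap, rowScale, LinearMap.coe_mk, AddHom.coe_mk, Sum.elim_inr,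
        Pi.smul_apply, Pi.sub_apply, smul_eq_mul, ← hQ]
      ring
    have hQG : ‖Q a‖ ≤ G := by
      have := hgr (Sum.inr a)
      simpa [hg] using this
    rw [h3]
    calc _ ≤ _ := norm_add₃_le
      _ ≤ C * (2 * K * G * ‖p‖) * ‖p‖ + K * ‖p‖ ^ 2 * G * X + (X ^ 2 * ‖p‖ ^ 2) * G := by
        refine add_le_add (add_le_add (hE2 a) hJb) ?_
        rw [norm_mul]
        exact mul_le_mul hpe2 hQG (norm_nonneg _) (by positivity)
      _ = (C * (2 * K * G) + K * G * X + X ^ 2 * G) *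
          ‖p‖ ^ (rowDegree (Sum.inr a : Fin n ⊕ Fin n) + 1) := by
        simp only [rowDegree, Sum.elim_inr, Pi.one_apply]; ring
      _ ≤ _ := by
        refine mul_le_mul_of_nonneg_right ?_ (by positivity)
        have : 0 ≤ 2 * X * G := by positivity
        linarith

end System

namespace System

variable {n m : ℕ} {P : System n m} {ubar : ℝ → Fin n → ℝ} {X : ℝ} {q : Fin n → ℝ}

/-- The combination `c₀ a + ∑ i ξ_k b_k`. -/
def combo (p : (Fin (m + 1) → ℝ) × ℂ) (c₀ : ℂ) (a : Fin n → ℝ) (b : Fin m → Fin n → ℝ) :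
    Fin n → ℂ :=
  c₀ • complexify n a + ∑ k : Fin m, (Complex.I * p.1 k.succ) • complexify n (b k)

theorem norm_combo_le (p : (Fin (m + 1) → ℝ) × ℂ) {c₀ : ℂ} (hc : ‖c₀‖ ≤ ‖p‖) (a : Fin n → ℝ)
    (b : Fin m → Fin n → ℝ) :
    ‖combo p c₀ a b‖ ≤ ‖p‖ * (‖complexify n a‖ + ∑ k, ‖complexify n (b k)‖) := by
  rw [combo, mul_add, Finset.mul_sum]
  refine (norm_add_le _ _).trans (add_le_add ?_ ((norm_sum_le _ _).trans
    (Finset.sum_le_sum fun k _ => ?_)))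
  · rw [norm_smul]
    exact mul_le_mul_of_nonneg_right hc (norm_nonneg _)
  · rw [norm_smul, norm_mul, Complex.norm_I, one_mul]
    exact mul_le_mul_of_nonneg_right (norm_ofReal_apply_le p _) (norm_nonneg _)

theorem continuous_combo (p : (Fin (m + 1) → ℝ) × ℂ) (c₀ : ℂ) {a : ℝ → Fin n → ℝ}
    {b : Fin m → ℝ → Fin n → ℝ} (ha : Continuous a) (hb : ∀ k, Continuous (b k)) :
    Continuous fun x => combo p c₀ (a x) fun k => b k x := by
  have h2 := continuous_complexify ha
  have h3 := fun k => continuous_complexify (hb k)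
  unfold combo
  fun_prop

theorem hasDerivAt_combo (p : (Fin (m + 1) → ℝ) × ℂ) (c₀ : ℂ) {a : ℝ → Fin n → ℝ}
    {b : Fin m → ℝ → Fin n → ℝ} {a' : Fin n → ℝ} {b' : Fin m → Fin n → ℝ} {x : ℝ}
    (ha : HasDerivAt a a' x) (hb : ∀ k, HasDerivAt (b k) (b' k) x) :
    HasDerivAt (fun x => combo p c₀ (a x) fun k => b k x) (combo p c₀ a' b') x :=
  ((hasDerivAt_complexify ha).const_smul c₀).add (HasDerivAt.fun_sum fun k _ =>
    (hasDerivAt_complexify (hb k)).const_smul (Complex.I * p.1 k.succ))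

theorem mulVec_combo (A : Matrix (Fin n) (Fin n) ℝ) (p : (Fin (m + 1) → ℝ) × ℂ) (c₀ : ℂ)
    (a : Fin n → ℝ) (b : Fin m → Fin n → ℝ) :
    A.map Complex.ofReal *ᵥ combo p c₀ a b = combo p c₀ (A *ᵥ a) fun k => A *ᵥ b k := by
  simp only [combo, Matrix.mulVec_add, Matrix.mulVec_smul, Matrix.mulVec_sum,
    map_ofReal_mulVec_complexify]

theorem sub_combo (p : (Fin (m + 1) → ℝ) × ℂ) (c₀ : ℂ) (a a' : Fin n → ℝ)
    (b b' : Fin m → Fin n → ℝ) :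
    combo p c₀ a b - combo p c₀ a' b' = combo p c₀ (a - a') fun k => b k - b' k := by
  simp only [combo, map_sub, smul_sub, Finset.sum_sub_distrib]
  abel

/-- The flux variable `λ ubar + i ∑ ξ_k (f^k - B^{k1} ubar')` of the modulated wave. -/
def waveCombo (P : System n m) (ubar : ℝ → Fin n → ℝ) (p : (Fin (m + 1) → ℝ) × ℂ) (x : ℝ) :
    Fin n → ℂ :=
  combo p p.2 (ubar x) fun k => P.waveFlux ubar k.succ x

variable {vs vs' : ℝ → Fin n → ℝ} {vl vl' : Fin m → ℝ → Fin n → ℝ}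

theorem coeffBinv_mulVec_combo (hw : P.IsPeriodicWave ubar X q) (h1 : P.H1)
    (hs : P.IsVariation ubar X q (speedDir n m) vs vs')
    (hl : ∀ k, P.IsVariation ubar X q (normalDir n k) (vl k) (vl' k))
    (p : (Fin (m + 1) → ℝ) × ℂ) {x : ℝ} (hx : x ∈ Set.Icc 0 X) :
    P.coeffBinv ubar x *ᵥ (P.coeffA ubar 0 x *ᵥ combo p (-p.2) (vs x) (fun k => vl k x) +
      P.waveCombo ubar p x) = combo p (-p.2) (vs' x) (fun k => vl' k x) +
      ∑ k : Fin m, (Complex.I * p.1 k.succ) • (P.coeffBinv ubar x *ᵥ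
        (P.coeffB ubar 0 k.succ x *ᵥ complexify n (deriv ubar x))) := by
  have h2 : P.coeffBinv ubar x *ᵥ (P.coeffA ubar 0 x *ᵥ complexify n (vs x) +
      complexify n (-ubar x)) = complexify n (vs' x) := by
    refine coeffBinv_mulVec_complexify hw h1 ?_
    rw [hs.equation x hx]
    simp [speedDir, speed, constant, sub_eq_add_neg]
  have h3 : ∀ k, P.coeffBinv ubar x *ᵥ (P.coeffA ubar 0 x *ᵥ complexify n (vl k x) +
      complexify n (P.waveFlux ubar k.succ x - P.B 0 k.succ (ubar x) *ᵥ deriv ubar x)) =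
      complexify n (vl' k x) := by
    intro k
    refine coeffBinv_mulVec_complexify hw h1 ?_
    rw [(hl k).equation x hx]
    have h4 : (normalDir n k).2.2.2.1 = Pi.single k 1 := rfl
    have h5 : speed (normalDir n k) = 0 := rfl
    have h6 : constant (normalDir n k) = 0 := rfl
    rw [h4, h5, h6, Finset.sum_eq_single k]
    · simp [waveFlux]
    · intro b _ hb
      simp [Pi.single_eq_of_ne hb]
    · simp
  have h4 : combo p (-p.2) (vs' x) (fun k => vl' k x) = P.coeffBinv ubar x *ᵥ
      (P.coeffA ubar 0 x *ᵥ combo p (-p.2) (vs x) (fun k => vl k x) + P.waveCombo ubar p x -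
        ∑ k : Fin m, (Complex.I * p.1 k.succ) •
          (P.coeffB ubar 0 k.succ x *ᵥ complexify n (deriv ubar x))) := by
    simp only [combo, waveCombo, ← h2, ← h3, map_neg, map_sub, ← coeffB_mulVec_complexify,
      Matrix.mulVec_add, Matrix.mulVec_sub, Matrix.mulVec_smul, Matrix.mulVec_sum,
      Matrix.mulVec_neg, smul_add, smul_sub, smul_neg, neg_smul, neg_neg, Finset.sum_add_distrib,
      Finset.sum_sub_distrib]
    abel
  rw [h4, Matrix.mulVec_sub, Matrix.mulVec_sum]
  simp only [Matrix.mulVec_smul]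
  abel

/-- The first-order corrector of the modulated wave solves the linearized first-order system. -/
theorem corrector_equation (hw : P.IsPeriodicWave ubar X q) (h0 : P.H0) (h1 : P.H1)
    (hs : P.IsVariation ubar X q (speedDir n m) vs vs')
    (hl : ∀ k, P.IsVariation ubar X q (normalDir n k) (vl k) (vl' k))
    (p : (Fin (m + 1) → ℝ) × ℂ) {x : ℝ} (hx : x ∈ Set.Icc 0 X) :
    P.sysZero ubar x *ᵥ Sum.elim (combo p (-p.2) (vs x) (fun k => vl k x))
        (P.waveCombo ubar p x) +
      P.linPart ubar p x *ᵥ Sum.elim (complexify n (deriv ubar x)) 0 =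
    Sum.elim (combo p (-p.2) (vs' x) (fun k => vl' k x))
      (combo p p.2 (deriv ubar x) fun k => P.realA ubar k.succ x *ᵥ deriv ubar x -
        P.B k.succ 0 (ubar x) *ᵥ deriv (deriv ubar) x) := by
  have h2 : P.coeffBinv ubar x *ᵥ (P.coeffA ubar 0 x *ᵥ complexify n (deriv ubar x) + 0) =
      complexify n (deriv (deriv ubar) x) := by
    rw [← map_zero (complexify n)]
    refine coeffBinv_mulVec_complexify hw h1 ?_
    rw [B_mulVec_deriv_deriv_ubar hw h0 h1, add_zero]
  rw [sysZero_mulVec, linPart_mulVec, elim_add_elim, coeffBinv_mulVec_combo hw h1 hs hl p hx, h2,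
    zero_add, add_neg_cancel_right]
  simp only [combo, map_sub, coeffA_mulVec_complexify, coeffB_mulVec_complexify]

theorem sum_smul_sum_comm (x : Fin m → ℂ) (Z : Fin m → Fin m → Fin n → ℂ) :
    ∑ l, x l • ∑ k, x k • Z k l = ∑ k, x k • ∑ l, x l • Z k l := by
  simp only [Finset.smul_sum]
  rw [Finset.sum_comm]
  exact Finset.sum_congr rfl fun k _ => Finset.sum_congr rfl fun l _ => smul_comm _ _ _

/-- The part of second order of the derivative of the flux variable of the modulated wave. -/
theorem second_order_flux (hw : P.IsPeriodicWave ubar X q) (h1 : P.H1)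
    (hs : P.IsVariation ubar X q (speedDir n m) vs vs')
    (hl : ∀ k, P.IsVariation ubar X q (normalDir n k) (vl k) (vl' k))
    (p : (Fin (m + 1) → ℝ) × ℂ) {x : ℝ} (hx : x ∈ Set.Icc 0 X) (a : Fin n) :
    (P.linPart ubar p x *ᵥ Sum.elim (combo p (-p.2) (vs x) (fun k => vl k x))
        (P.waveCombo ubar p x) +
      P.quadPart ubar p x *ᵥ Sum.elim (complexify n (deriv ubar x)) 0) (Sum.inr a) =
    ((-p.2) • P.fluxRate ubar (speedDir n m) vs vs' p x + ∑ l : Fin m,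
      (Complex.I * p.1 l.succ) • P.fluxRate ubar (normalDir n l) (vl l) (vl' l) p x) a := by
  rw [linPart_mulVec, quadPart_mulVec, elim_add_elim, Sum.elim_inr,
    coeffBinv_mulVec_combo hw h1 hs hl p hx]
  refine congrFun ?_ a
  have hFs : ∀ k : Fin m, P.fluxVariation ubar (speedDir n m) vs vs' k.succ x =
      P.realA ubar k.succ x *ᵥ vs x - P.B k.succ 0 (ubar x) *ᵥ vs' x := by
    intro k
    simp [fluxVariation, speedDir]
  have hFl : ∀ k l : Fin m, P.fluxVariation ubar (normalDir n l) (vl l) (vl' l) k.succ x =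
      P.realA ubar k.succ x *ᵥ vl l x - P.B k.succ 0 (ubar x) *ᵥ vl' l x -
        P.B k.succ l.succ (ubar x) *ᵥ deriv ubar x := by
    intro k l
    have h4 : (normalDir n l).2.2.2.1 = Pi.single l 1 := rfl
    rw [fluxVariation, h4, Finset.sum_eq_single l]
    · simp
    · intro b _ hb
      simp [Pi.single_eq_of_ne hb]
    · simp
  set U : Fin n → ℂ := complexify n (deriv ubar x)
  have hsq : ∀ j k : Fin m, (p.1 j.succ : ℂ) * (p.1 k.succ : ℂ) =
      -((Complex.I * p.1 j.succ) * (Complex.I * p.1 k.succ)) := by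
    intro j k
    linear_combination ((p.1 j.succ : ℂ) * (p.1 k.succ : ℂ)) * Complex.I_mul_I
  have hA : ∀ k : Fin m, P.coeffA ubar k.succ x *ᵥ combo p (-p.2) (vs x) (fun l => vl l x) -
      P.coeffB ubar k.succ 0 x *ᵥ combo p (-p.2) (vs' x) (fun l => vl' l x) =
      combo p (-p.2) (P.realA ubar k.succ x *ᵥ vs x - P.B k.succ 0 (ubar x) *ᵥ vs' x)
        (fun l => P.realA ubar k.succ x *ᵥ vl l x - P.B k.succ 0 (ubar x) *ᵥ vl' l x) := by
    intro k
    have h5 : P.coeffA ubar k.succ x = (P.realA ubar k.succ x).map Complex.ofReal := rfl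
    rw [h5, coeffB, mulVec_combo, mulVec_combo, sub_combo]
  have hbr : ∀ k : Fin m, P.coeffA ubar k.succ x *ᵥ combo p (-p.2) (vs x) (fun l => vl l x) -
      P.coeffB ubar k.succ 0 x *ᵥ (combo p (-p.2) (vs' x) (fun l => vl' l x) +
        ∑ l : Fin m, (Complex.I * p.1 l.succ) •
          (P.coeffBinv ubar x *ᵥ (P.coeffB ubar 0 l.succ x *ᵥ U))) =
      (-p.2) • complexify n (P.fluxVariation ubar (speedDir n m) vs vs' k.succ x) +
      ∑ l : Fin m, (Complex.I * p.1 l.succ) •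
        complexify n (P.fluxVariation ubar (normalDir n l) (vl l) (vl' l) k.succ x) +
      ∑ l : Fin m, (Complex.I * p.1 l.succ) •
        (P.coeffB ubar k.succ l.succ x *ᵥ U - P.coeffB ubar k.succ 0 x *ᵥ
        (P.coeffBinv ubar x *ᵥ (P.coeffB ubar 0 l.succ x *ᵥ U))) := by
    intro k
    rw [Matrix.mulVec_add, ← sub_sub, hA]
    simp only [combo, hFs, hFl, map_sub (complexify n) (_ - _), ← coeffB_mulVec_complexify,
      Matrix.mulVec_sum, Matrix.mulVec_smul, smul_sub, Finset.sum_sub_distrib, U]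
    abel
  have hquad : ∑ j : Fin m, ∑ k : Fin m, ((p.1 j.succ : ℂ) * (p.1 k.succ : ℂ)) •
      (P.coeffB ubar j.succ k.succ x *ᵥ U - P.coeffB ubar j.succ 0 x *ᵥ
        (P.coeffBinv ubar x *ᵥ (P.coeffB ubar 0 k.succ x *ᵥ U))) =
      -∑ j : Fin m, (Complex.I * p.1 j.succ) •
        ∑ k : Fin m, (Complex.I * p.1 k.succ) • (P.coeffB ubar j.succ k.succ x *ᵥ U -
          P.coeffB ubar j.succ 0 x *ᵥ
        (P.coeffBinv ubar x *ᵥ (P.coeffB ubar 0 k.succ x *ᵥ U))) := by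
    simp only [Finset.smul_sum, hsq, smul_smul, neg_smul, Finset.sum_neg_distrib]
  rw [hquad]
  simp only [hbr]
  simp only [fluxRate, smul_add, Finset.sum_add_distrib]
  have hcomm := sum_smul_sum_comm (fun k : Fin m => Complex.I * (p.1 k.succ : ℂ)) fun k l =>
    complexify n (P.fluxVariation ubar (normalDir n l) (vl l) (vl' l) k.succ x)
  rw [← hcomm]
  simp only [combo, smul_add, Finset.smul_sum, neg_smul, smul_neg, Finset.sum_neg_distrib,
    smul_comm p.2 (Complex.I * _)]
  abel

/-- The averaged fluxes in the direction of modulation. -/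
theorem modulation_whithamFlux (hw : P.IsPeriodicWave ubar X q) (h0 : P.H0) (h1 : P.H1)
    (hs : P.IsVariation ubar X q (speedDir n m) vs vs')
    (hl : ∀ k, P.IsVariation ubar X q (normalDir n k) (vl k) (vl' k))
    (p : (Fin (m + 1) → ℝ) × ℂ) :
    (X : ℂ) • modulation X p.1 p.2 (P.whithamFlux (basePoint m ubar X q) p.1 p.2) =
      (-p.2) • (∫ x in (0 : ℝ)..X, P.fluxRate ubar (speedDir n m) vs vs' p x) +
      ∑ l : Fin m, (Complex.I * p.1 l.succ) •
        (∫ x in (0 : ℝ)..X, P.fluxRate ubar (normalDir n l) (vl l) (vl' l) p x) -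
      (Complex.I * X * p.1 0) • P.waveCombo ubar p 0 := by
  set b := basePoint m ubar X q with hb
  have hs0 : fderiv ℝ (P.F 0) b (speedDir n m) = P.M b := by
    rw [hs.fderiv_F_zero hw h0 h1]
    simp [speedDir, speed, constant, hb]
  have hl0 : ∀ l : Fin m, fderiv ℝ (P.F 0) b (normalDir n l) = -P.F l.succ b := by
    intro l
    have h4 : (normalDir n l).2.2.2.1 = Pi.single l 1 := rfl
    have h5 : speed (normalDir n l) = 0 := rfl
    have h6 : constant (normalDir n l) = 0 := rfl
    rw [(hl l).fderiv_F_zero hw h0 h1, h4, h5, h6, Finset.sum_eq_single l]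
    · simp [hb]
    · intro b _ hb
      simp [Pi.single_eq_of_ne hb]
    · simp
  obtain ⟨-, hM, hF⟩ := fderiv_periodDir hw h0 h1
  have hP : (X : ℂ) • P.whithamFlux b p.1 p.2 (periodDir n m) =
      P.waveCombo ubar p 0 - combo p p.2 (P.M b) fun k => P.F k.succ b := by
    have hF0 := hF 0
    rw [fluxDensity_basePoint hw h1, waveFlux_zero hw, F_zero_basePoint hw h0 h1, sub_self] at hF0
    rw [waveCombo, sub_combo, whithamFlux_apply, Fin.sum_univ_succ, smul_add, smul_add, combo,
      Finset.smul_sum, smul_comm (X : ℂ), smul_comm (X : ℂ) (Complex.I * _)]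
    simp only [smul_comm (X : ℂ) (Complex.I * _), ← complexify_smul, hb, hM, hF0, hF,
      fluxDensity_basePoint hw h1, map_zero, smul_zero, zero_add]
  set S₁ : Fin n → ℂ :=
    ∑ l : Fin m, (Complex.I * p.1 l.succ) • P.whithamFlux b p.1 p.2 (normalDir n l) with hS₁
  set S₂ : Fin n → ℂ := ∑ l : Fin m, (Complex.I * p.1 l.succ) • complexify n (P.F l.succ b)
  have hsum : ∑ l : Fin m, (Complex.I * p.1 l.succ) •
        (∫ x in (0 : ℝ)..X, P.fluxRate ubar (normalDir n l) (vl l) (vl' l) p x) =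
      (X : ℂ) • S₁ + ((X : ℂ) * (Complex.I * p.1 0)) • S₂ := by
    simp only [fun l => (hl l).integral_fluxRate hw h0 h1 p, ← hb, hl0, S₁, S₂, Finset.smul_sum,
      ← Finset.sum_add_distrib, map_neg, smul_neg, sub_neg_eq_add, smul_add]
    refine Finset.sum_congr rfl fun l _ => ?_
    ext a
    simp only [Pi.add_apply, Pi.smul_apply, smul_eq_mul]
    ring
  rw [hsum, hs.integral_fluxRate hw h0 h1 p, ← hb, hs0, modulation, ← hS₁]
  ext a
  have hPa := congrFun hP a
  simp only [combo, Pi.sub_apply, Pi.add_apply, Pi.smul_apply, smul_eq_mul] at hPa ⊢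
  change (X : ℂ) * _ = _ - (p.2 * _ + S₂ a) at hPa
  linear_combination (-(Complex.I * X * p.1 0)) * hPa

end System

namespace System

variable {n m : ℕ} {P : System n m} {ubar : ℝ → Fin n → ℝ} {X : ℝ} {q : Fin n → ℝ}

theorem deriv_ubar_period (hw : P.IsPeriodicWave ubar X q) (h1 : P.H1) :
    deriv ubar X = deriv ubar 0 := by
  have huX : ubar X = ubar 0 := by simpa using hw.periodic 0
  rw [hw.deriv_eq h1, hw.deriv_eq h1, huX]

theorem waveCombo_period (hw : P.IsPeriodicWave ubar X q) (h1 : P.H1)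
    (p : (Fin (m + 1) → ℝ) × ℂ) : P.waveCombo ubar p X = P.waveCombo ubar p 0 := by
  have huX : ubar X = ubar 0 := by simpa using hw.periodic 0
  simp only [waveCombo, waveFlux, huX, deriv_ubar_period hw h1]

theorem norm_elim_le (u v : Fin n → ℂ) : ‖Sum.elim u v‖ ≤ ‖u‖ + ‖v‖ := by
  rw [pi_norm_le_iff_of_nonneg (by positivity)]
  rintro (a | a)
  · exact (norm_le_pi_norm u a).trans (le_add_of_nonneg_right (norm_nonneg _))
  · exact (norm_le_pi_norm v a).trans (le_add_of_nonneg_left (norm_nonneg _))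

theorem modulation_profileMap_inl (b : Params n m) (p : (Fin (m + 1) → ℝ) × ℂ) (a : Fin n) :
    modulation X p.1 p.2 (P.profileMap b p.1 p.2) (Sum.inl a) =
      -(Complex.I * X * p.1 0) * complexify n (fderiv ℝ P.H b (periodDir n m)) a +
      combo p (-p.2) (fderiv ℝ P.H b (speedDir n m))
        (fun k => fderiv ℝ P.H b (normalDir n k)) a := by
  simp only [modulation, profileMap, combo, LinearMap.coe_mk, AddHom.coe_mk, Pi.add_apply,
    Pi.smul_apply, Finset.sum_apply, Sum.elim_inl, smul_eq_mul]
  ring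

theorem modulation_profileMap_inr (b : Params n m) (p : (Fin (m + 1) → ℝ) × ℂ) (a : Fin n) :
    modulation X p.1 p.2 (P.profileMap b p.1 p.2) (Sum.inr a) =
      modulation X p.1 p.2 (P.whithamFlux b p.1 p.2) a := by
  simp only [modulation, profileMap, LinearMap.coe_mk, AddHom.coe_mk, Pi.add_apply,
    Pi.smul_apply, Finset.sum_apply, Sum.elim_inr, smul_eq_mul]

/-- The column of the Evans matrix along the modulated wave. -/
theorem exists_modulation_error (hw : P.IsPeriodicWave ubar X q) (h0 : P.H0) (h1 : P.H1) :
    ∃ C : ℝ, ∀ᶠ p : (Fin (m + 1) → ℝ) × ℂ in 𝓝 0,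
      ∀ ω : ℝ → Fin n ⊕ Fin n → ℂ,
      (∀ x, HasDerivAt ω (P.sysMatrix ubar (Fin.tail p.1) p.2 x *ᵥ ω x) x) →
      ω 0 = Sum.elim (complexify n (deriv ubar 0)) (P.waveCombo ubar p 0) →
      ∀ r, ‖ω X r - Complex.exp (Complex.I * X * p.1 0) * ω 0 r - rowScale n X r *
        modulation X p.1 p.2 (P.profileMap (basePoint m ubar X q) p.1 p.2) r‖ ≤
          C * ‖p‖ ^ (rowDegree r + 2) := by
  obtain ⟨vs, vs', hs⟩ := exists_isVariation hw h0 h1 (speedDir n m) rfl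
  choose vl vl' hl using fun k : Fin m => exists_isVariation hw h0 h1 (normalDir n k) rfl
  have hX := hw.period_pos
  obtain ⟨K, hK1, hK⟩ := exists_part_bounds hw h0 h1
  obtain ⟨C, hC0, hC⟩ := exists_flow_error hw h0 h1
  have hu' := contDiff_deriv_ubar hw h0 h1
  have hu'' : Continuous (deriv (deriv ubar)) := (contDiff_one_iff_deriv.1 hu').2
  have hud : ∀ x, HasDerivAt (deriv ubar) (deriv (deriv ubar) x) x := fun x =>
    (hu'.differentiable one_ne_zero x).hasDerivAt
  have huc := hw.continuous h1
  set y₀ : ℝ → Fin n ⊕ Fin n → ℂ := fun x => Sum.elim (complexify n (deriv ubar x)) 0 with hy₀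
  set y₁ : (Fin (m + 1) → ℝ) × ℂ → ℝ → Fin n ⊕ Fin n → ℂ := fun p x =>
    Sum.elim (combo p (-p.2) (vs x) (fun k => vl k x)) (P.waveCombo ubar p x) with hy₁
  have hy₀c : Continuous y₀ := continuous_elim (continuous_complexify hu'.continuous)
    continuous_const
  have hwc : ∀ p, Continuous (P.waveCombo ubar p) := fun p =>
    continuous_combo p p.2 huc fun k => continuous_waveFlux hw h0 h1 k.succ
  have hy₁c : ∀ p, Continuous (y₁ p) := fun p =>
    continuous_elim (continuous_combo p _ hs.continuous fun k => (hl k).continuous) (hwc p)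
  obtain ⟨G₀, hG₀0, hG₀⟩ := exists_bound_Icc hy₀c X
  obtain ⟨G₁, hG₁0, hG₁⟩ : ∃ G₁ : ℝ, 0 ≤ G₁ ∧ ∀ p, ∀ x ∈ Set.Icc 0 X, ‖y₁ p x‖ ≤ G₁ * ‖p‖ := by
    have hcN : Continuous fun x => (‖complexify n (vs x)‖ + ∑ k, ‖complexify n (vl k x)‖) +
        (‖complexify n (ubar x)‖ + ∑ k : Fin m, ‖complexify n (P.waveFlux ubar k.succ x)‖) := by
      have h2 := continuous_complexify hs.continuous
      have h3 := fun k => continuous_complexify (hl k).continuous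
      have h4 := continuous_complexify huc
      have h5 := fun k : Fin m => continuous_complexify (continuous_waveFlux hw h0 h1 k.succ)
      fun_prop
    obtain ⟨G, hG0, hG⟩ := exists_bound_Icc hcN X
    refine ⟨G, hG0, fun p x hx => ?_⟩
    refine (norm_elim_le _ _).trans ((add_le_add (norm_combo_le p (c₀ := -p.2) ?_ _ _)
      (norm_combo_le p (c₀ := p.2) (norm_snd_le p) _ _)).trans ?_)
    · rw [norm_neg]; exact norm_snd_le p
    · rw [← mul_add, mul_comm]
      exact mul_le_mul_of_nonneg_right ((le_abs_self _).trans (hG x hx)) (norm_nonneg _)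
  have hZ₀ : ∀ x, P.sysZero ubar x *ᵥ y₀ x =
      Sum.elim (complexify n (deriv (deriv ubar) x)) 0 := by
    intro x
    rw [hy₀, sysZero_mulVec]
    congr 1
    rw [← map_zero (complexify n)]
    refine coeffBinv_mulVec_complexify hw h1 ?_
    rw [B_mulVec_deriv_deriv_ubar hw h0 h1, add_zero]
  set Y' : (Fin (m + 1) → ℝ) × ℂ → ℝ → Fin n → ℂ := fun p x =>
    combo p p.2 (deriv ubar x) fun k => P.realA ubar k.succ x *ᵥ deriv ubar x -
        P.B k.succ 0 (ubar x) *ᵥ deriv (deriv ubar) x with hY'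
  have hY'c : ∀ p, Continuous (Y' p) := fun p =>
    continuous_combo p p.2 hu'.continuous fun k =>
      ((continuous_realA hw h0 h1 k.succ).matrix_mulVec hu'.continuous).sub
        ((continuous_B_ubar hw h0 h1 k.succ 0).matrix_mulVec hu'')
  have hYd : ∀ p x, HasDerivAt (P.waveCombo ubar p) (Y' p x) x := fun p x =>
    hasDerivAt_combo p p.2 (hw.hasDerivAt h1 x).differentiableAt.hasDerivAt
      fun k => hasDerivAt_waveFlux hw h0 h1 k.succ x
  have hcorr : ∀ p, ∀ x ∈ Set.Icc 0 X, P.sysZero ubar x *ᵥ y₁ p x + P.linPart ubar p x *ᵥ y₀ x =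
      Sum.elim (combo p (-p.2) (vs' x) (fun k => vl' k x)) (Y' p x) := fun p x hx =>
    corrector_equation hw h0 h1 hs hl p hx
  have hY'int : ∀ p, ∫ x in (0 : ℝ)..X, Y' p x = 0 := by
    intro p
    rw [intervalIntegral.integral_eq_sub_of_hasDerivAt (fun x _ => hYd p x)
      ((hY'c p).intervalIntegrable _ _), waveCombo_period hw h1, sub_self]
  have hfs := fun p => hs.continuous_fluxRate hw h0 h1 p
  have hfl := fun p k => (hl k).continuous_fluxRate hw h0 h1 p
  refine ⟨C * (2 * K * G₁ + K * G₀) + X ^ 2 * G₀ + K * G₁ * X + X ^ 2 * G₁, ?_⟩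
  filter_upwards [eventually_floquet (m := m) hX] with p ⟨hp1, hpe1, hpe2⟩ ω hω hω0
  set e := Complex.exp (Complex.I * X * p.1 0) with he
  have hp0 := norm_nonneg p
  set g : ℝ → Fin n ⊕ Fin n → ℂ := fun x => y₀ x + y₁ p x with hg
  set g' : ℝ → Fin n ⊕ Fin n → ℂ := fun x => Sum.elim (complexify n (deriv (deriv ubar) x)) 0 +
    Sum.elim (combo p (-p.2) (vs' x) (fun k => vl' k x)) (Y' p x) with hg'
  have hgc : Continuous g := hy₀c.add (hy₁c p)
  have hgd : ∀ x ∈ Set.Icc 0 X, HasDerivAt g (g' x) x := fun x hx =>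
    (hasDerivAt_elim (hasDerivAt_complexify (hud x)) (hasDerivAt_const x _)).add
      (hasDerivAt_elim (hasDerivAt_combo p _ (hs.hasDerivAt x hx) fun k => (hl k).hasDerivAt x hx)
        (hYd p x))
  have hLb : ∀ x ∈ Set.Icc 0 X, ‖P.linPart ubar p x *ᵥ y₁ p x‖ ≤ K * G₁ * ‖p‖ ^ 2 := by
    intro x hx
    calc _ ≤ K * ‖p‖ * ‖y₁ p x‖ := (hK p x hx _).2.1
      _ ≤ K * ‖p‖ * (G₁ * ‖p‖) := mul_le_mul_of_nonneg_left (hG₁ p x hx) (by positivity)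
      _ = _ := by ring
  have hQ₀b : ∀ x ∈ Set.Icc 0 X, ‖P.quadPart ubar p x *ᵥ y₀ x‖ ≤ K * G₀ * ‖p‖ ^ 2 := by
    intro x hx
    calc _ ≤ K * ‖p‖ ^ 2 * ‖y₀ x‖ := (hK p x hx _).2.2
      _ ≤ K * ‖p‖ ^ 2 * G₀ := mul_le_mul_of_nonneg_left (hG₀ x hx) (by positivity)
      _ = _ := by ring
  have hQ₁b : ∀ x ∈ Set.Icc 0 X, ‖P.quadPart ubar p x *ᵥ y₁ p x‖ ≤ K * G₁ * ‖p‖ ^ 3 := by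
    intro x hx
    calc _ ≤ K * ‖p‖ ^ 2 * ‖y₁ p x‖ := (hK p x hx _).2.2
      _ ≤ K * ‖p‖ ^ 2 * (G₁ * ‖p‖) := mul_le_mul_of_nonneg_left (hG₁ p x hx) (by positivity)
      _ = _ := by ring
  have hp32 : ‖p‖ ^ 3 ≤ ‖p‖ ^ 2 := pow_le_pow_of_le_one hp0 hp1 (by norm_num)
  have herr : ∀ x ∈ Set.Icc 0 X,
      ‖g' x - P.sysMatrix ubar (Fin.tail p.1) p.2 x *ᵥ g x‖ ≤ (2 * K * G₁ + K * G₀) * ‖p‖ ^ 2 := by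
    intro x hx
    have h3 : g' x - P.sysMatrix ubar (Fin.tail p.1) p.2 x *ᵥ g x =
        -(P.linPart ubar p x *ᵥ y₁ p x + P.quadPart ubar p x *ᵥ y₀ x +
          P.quadPart ubar p x *ᵥ y₁ p x) := by
      simp only [hg, hg', ← hZ₀, ← hcorr p x hx, sysMatrix_tail, Matrix.add_mulVec,
        Matrix.mulVec_add]
      abel
    rw [h3, norm_neg]
    have h4 : K * G₁ * ‖p‖ ^ 3 ≤ K * G₁ * ‖p‖ ^ 2 :=
      mul_le_mul_of_nonneg_left hp32 (by positivity)
    calc _ ≤ _ := norm_add₃_le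
      _ ≤ K * G₁ * ‖p‖ ^ 2 + K * G₀ * ‖p‖ ^ 2 + K * G₁ * ‖p‖ ^ 2 :=
        add_le_add (add_le_add (hLb x hx) (hQ₀b x hx)) ((hQ₁b x hx).trans h4)
      _ = _ := by ring
  have hvs0 : vs 0 = 0 := hs.initial
  have hvl0 : ∀ k, vl k 0 = 0 := fun k => (hl k).initial
  have hg0 : g 0 = ω 0 := by
    rw [hω0]
    simp only [hg, hy₀, hy₁, elim_add_elim, zero_add, hvs0, hvl0]
    simp [combo]
  obtain ⟨hE1, hE2⟩ := hC p ω g g' _ hp1 (by positivity) hω hgd hgc hg0 herr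
  have h0mem : (0 : ℝ) ∈ Set.Icc 0 X := ⟨le_rfl, hX.le⟩
  rintro (a | a)
  · have hU : ‖complexify n (deriv ubar 0) a‖ ≤ G₀ :=
      (norm_le_pi_norm (y₀ 0) (Sum.inl a)).trans (hG₀ 0 h0mem)
    have h3 : ω X (Sum.inl a) - e * ω 0 (Sum.inl a) - rowScale n X (Sum.inl a) *
        modulation X p.1 p.2 (P.profileMap (basePoint m ubar X q) p.1 p.2) (Sum.inl a) =
        (ω X - g X) (Sum.inl a) -
          (e - 1 - Complex.I * X * p.1 0) * complexify n (deriv ubar 0) a := by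
      have h4 : g X (Sum.inl a) = complexify n (deriv ubar 0) a +
          combo p (-p.2) (vs X) (fun k => vl k X) a := by
        simp only [hg, hy₀, hy₁, Pi.add_apply, Sum.elim_inl, deriv_ubar_period hw h1]
      rw [modulation_profileMap_inl, (fderiv_periodDir hw h0 h1).1, hs.fderiv_H, hvs0, sub_zero]
      simp only [fun k => (hl k).fderiv_H, hvl0, sub_zero, Pi.sub_apply, h4, hω0, rowScale,
        Sum.elim_inl]
      ring
    rw [h3]
    calc _ ≤ _ := norm_sub_le _ _
      _ ≤ C * ((2 * K * G₁ + K * G₀) * ‖p‖ ^ 2) + (X ^ 2 * ‖p‖ ^ 2) * G₀ := by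
        refine add_le_add ((norm_le_pi_norm _ _).trans hE1) ?_
        rw [norm_mul]
        exact mul_le_mul hpe2 hU (norm_nonneg _) (by positivity)
      _ = (C * (2 * K * G₁ + K * G₀) + X ^ 2 * G₀) *
          ‖p‖ ^ (rowDegree (Sum.inl a : Fin n ⊕ Fin n) + 2) := by
        simp only [rowDegree, Sum.elim_inl, Pi.zero_apply]; ring
      _ ≤ _ := by
        refine mul_le_mul_of_nonneg_right ?_ (by positivity)
        have : 0 ≤ K * G₁ * X := by positivity
        have : 0 ≤ X ^ 2 * G₁ := by positivity
        linarith
  · set J : ℂ := (∫ x in (0 : ℝ)..X, (P.linPart ubar p x + P.quadPart ubar p x) *ᵥ g x)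
      (Sum.inr a) with hJ
    set fs := P.fluxRate ubar (speedDir n m) vs vs' p with hfsd
    set fl := fun l => P.fluxRate ubar (normalDir n l) (vl l) (vl' l) p with hfld
    have hfs := hfs p
    have hfl : ∀ l, Continuous (fl l) := hfl p
    set R : ℝ → Fin n → ℂ := fun x => Y' p x +
      ((-p.2) • fs x + ∑ l : Fin m, (Complex.I * p.1 l.succ) • fl l x) with hR
    have hY'cp := hY'c p
    have hRc : Continuous R := by
      rw [hR]
      fun_prop
    have hi : ∀ {g : ℝ → Fin n → ℂ}, Continuous g →
        IntervalIntegrable g MeasureTheory.volume 0 X := fun hg => hg.intervalIntegrable _ _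
    have hRint : ∫ x in (0 : ℝ)..X, R x = (-p.2) • (∫ x in (0 : ℝ)..X, fs x) +
        ∑ l : Fin m, (Complex.I * p.1 l.succ) • ∫ x in (0 : ℝ)..X, fl l x := by
      rw [hR, intervalIntegral.integral_add (hi hY'cp) (hi (by fun_prop)), hY'int, zero_add,
        intervalIntegral.integral_add (hi (by fun_prop)) (hi (by fun_prop)),
        intervalIntegral.integral_finsetSum fun k _ => hi (by fun_prop)]
      simp only [intervalIntegral.integral_smul]
    have hJb : ‖J - (∫ x in (0 : ℝ)..X, R x) a‖ ≤ K * G₁ * ‖p‖ ^ 3 * X := by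
      refine norm_integral_apply_sub_le (((continuous_linPart hw h0 h1 p).add
        (continuous_quadPart hw h0 h1 p)).matrix_mulVec hgc) hRc hX fun x hx => ?_
      have h4 := congrFun (hcorr p x hx) (Sum.inr a)
      rw [Pi.add_apply, sysZero_mulVec_inr, zero_add, Sum.elim_inr] at h4
      have h5 := second_order_flux hw h1 hs hl p hx a
      have h6 : ((P.linPart ubar p + P.quadPart ubar p) x *ᵥ g x) (Sum.inr a) - R x a =
          (P.quadPart ubar p x *ᵥ y₁ p x) (Sum.inr a) := by
        simp only [hR, Pi.add_apply] at h5 ⊢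
        rw [← h4, ← h5]
        simp only [hg, Pi.add_apply, Matrix.add_mulVec, Matrix.mulVec_add]
        ring
      rw [h6]
      exact (norm_le_pi_norm _ _).trans (hQ₁b x hx)
    have hmod := congrFun (modulation_whithamFlux hw h0 h1 hs hl p) a
    have hY0 : ‖P.waveCombo ubar p 0 a‖ ≤ G₁ * ‖p‖ :=
      (norm_le_pi_norm (y₁ p 0) (Sum.inr a)).trans (hG₁ p 0 h0mem)
    have h3 : ω X (Sum.inr a) - e * ω 0 (Sum.inr a) - rowScale n X (Sum.inr a) *
        modulation X p.1 p.2 (P.profileMap (basePoint m ubar X q) p.1 p.2) (Sum.inr a) =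
        (ω X (Sum.inr a) - ω 0 (Sum.inr a) - J) + (J - (∫ x in (0 : ℝ)..X, R x) a) +
        -((e - 1 - Complex.I * X * p.1 0) * P.waveCombo ubar p 0 a) := by
      rw [modulation_profileMap_inr, hRint]
      simp only [Pi.sub_apply, Pi.smul_apply, smul_eq_mul] at hmod
      simp only [rowScale, Sum.elim_inr, hmod, hω0, ← hfsd]
      ring
    rw [h3]
    calc _ ≤ _ := norm_add₃_le
      _ ≤ C * ((2 * K * G₁ + K * G₀) * ‖p‖ ^ 2) * ‖p‖ + K * G₁ * ‖p‖ ^ 3 * X +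
          (X ^ 2 * ‖p‖ ^ 2) * (G₁ * ‖p‖) := by
        refine add_le_add (add_le_add (hE2 a) hJb) ?_
        rw [norm_neg, norm_mul]
        exact mul_le_mul hpe2 hY0 (norm_nonneg _) (by positivity)
      _ = (C * (2 * K * G₁ + K * G₀) + K * G₁ * X + X ^ 2 * G₁) *
          ‖p‖ ^ (rowDegree (Sum.inr a : Fin n ⊕ Fin n) + 2) := by
        simp only [rowDegree, Sum.elim_inr, Pi.one_apply]; ring
      _ ≤ _ := by
        refine mul_le_mul_of_nonneg_right ?_ (by positivity)
        have : 0 ≤ X ^ 2 * G₀ := by positivity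
        linarith

end System

section Asymptotics

variable {α : Type*} {l : Filter α} {φ : α → ℝ}

theorem isBigO_pow_succ_self (hφ : φ =O[l] fun _ => (1 : ℝ)) (k : ℕ) :
    (fun x => φ x ^ (k + 1)) =O[l] fun x => φ x ^ k := by
  have h := (Asymptotics.isBigO_refl (fun x => φ x ^ k) l).mul hφ
  simpa only [pow_succ, mul_one] using h

theorem isBigO_prod_sub_prod {κ : Type*} (s : Finset κ) {f g : κ → α → ℂ} {k : κ → ℕ}
    (hφ : φ =O[l] fun _ => (1 : ℝ)) (hg : ∀ i ∈ s, g i =O[l] fun x => φ x ^ k i)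
    (hf : ∀ i ∈ s, (fun x => f i x - g i x) =O[l] fun x => φ x ^ (k i + 1)) :
    (fun x => ∏ i ∈ s, g i x) =O[l] (fun x => φ x ^ ∑ i ∈ s, k i) ∧
      (fun x => ∏ i ∈ s, f i x - ∏ i ∈ s, g i x) =O[l] fun x => φ x ^ (∑ i ∈ s, k i + 1) := by
  classical
  induction s using Finset.induction_on with
  | empty =>
    simp only [Finset.prod_empty, Finset.sum_empty, pow_zero, sub_self]
    exact ⟨Asymptotics.isBigO_const_const _ one_ne_zero _, Asymptotics.isBigO_zero _ _⟩
  | insert a s ha ih =>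
    obtain ⟨ih1, ih2⟩ := ih (fun i hi => hg i (Finset.mem_insert_of_mem hi))
      fun i hi => hf i (Finset.mem_insert_of_mem hi)
    have hga := hg a (Finset.mem_insert_self a s)
    have hfa := hf a (Finset.mem_insert_self a s)
    simp only [Finset.prod_insert ha, Finset.sum_insert ha]
    refine ⟨(hga.mul ih1).congr_right fun x => (pow_add _ _ _).symm, ?_⟩
    have hprod : (fun x => ∏ i ∈ s, f i x) =O[l] fun x => φ x ^ ∑ i ∈ s, k i := by
      have := (ih2.trans (isBigO_pow_succ_self hφ _)).add ih1
      simpa using this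
    have h3 := (hfa.mul hprod).add ((hga.mul ih2).congr_right fun x => by ring)
    refine (h3.congr_left fun x => ?_).congr_right fun x => ?_
    · ring
    · ring

/-- A perturbation of a determinant whose entries have orders `α r + β c`. -/
theorem isBigO_det_sub_det {ι : Type*} [Fintype ι] [DecidableEq ι] {A B : α → Matrix ι ι ℂ}
    {k k' : ι → ℕ} (hφ : φ =O[l] fun _ => (1 : ℝ))
    (hB : ∀ r c, (fun x => B x r c) =O[l] fun x => φ x ^ (k r + k' c))
    (hA : ∀ r c, (fun x => A x r c - B x r c) =O[l] fun x => φ x ^ (k r + k' c + 1)) :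
    (fun x => (A x).det - (B x).det) =O[l] fun x => φ x ^ (∑ r, k r + ∑ c, k' c + 1) := by
  simp only [Matrix.det_apply', ← Finset.sum_sub_distrib, ← mul_sub]
  refine Asymptotics.IsBigO.fun_sum fun e _ => ?_
  have h := (isBigO_prod_sub_prod Finset.univ (f := fun i x => A x (e i) i)
    (g := fun i x => B x (e i) i) (k := fun i => k (e i) + k' i) hφ (fun i _ => hB _ _)
    fun i _ => hA _ _).2
  rw [Finset.sum_add_distrib, Equiv.sum_comp e k] at h
  exact h.const_mul_left _

theorem norm_eval_le {τ : Type*} {f : MvPolynomial τ ℂ} {k : ℕ} (hf : f.IsHomogeneous k)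
    {x : τ → ℂ} {t : ℝ} (hx : ∀ i, ‖x i‖ ≤ t) :
    ‖MvPolynomial.eval x f‖ ≤ (∑ d ∈ f.support, ‖f.coeff d‖) * t ^ k := by
  rw [MvPolynomial.eval_eq, Finset.sum_mul]
  refine (norm_sum_le _ _).trans (Finset.sum_le_sum fun d hd => ?_)
  rw [norm_mul, norm_prod]
  refine mul_le_mul_of_nonneg_left ?_ (norm_nonneg _)
  have hdeg : ∑ i ∈ d.support, d i = k := by
    have := hf (MvPolynomial.mem_support_iff.1 hd)
    simpa [Finsupp.weight_apply, Finsupp.sum] using this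
  rw [← hdeg, ← Finset.prod_pow_eq_pow_sum]
  refine Finset.prod_le_prod (fun i _ => norm_nonneg _) fun i _ => ?_
  rw [norm_pow]
  exact pow_le_pow_left₀ (norm_nonneg _) (hx i) _

theorem isBigO_eval {m : ℕ} {f : MvPolynomial (Fin (m + 1) ⊕ Unit) ℂ} {k : ℕ}
    (hf : f.IsHomogeneous k) (l : Filter ((Fin (m + 1) → ℝ) × ℂ)) :
    (fun p : (Fin (m + 1) → ℝ) × ℂ =>
      MvPolynomial.eval (Sum.elim (fun j => (p.1 j : ℂ)) (fun _ => p.2)) f) =O[l]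
      fun p => ‖p‖ ^ k := by
  refine Asymptotics.IsBigO.of_bound (∑ d ∈ f.support, ‖f.coeff d‖) (Eventually.of_forall
    fun p => ?_)
  rw [norm_pow, norm_norm]
  refine norm_eval_le hf ?_
  rintro (j | j)
  · exact System.norm_ofReal_apply_le p j
  · exact norm_snd_le p

end Asymptotics

namespace System

variable {n m : ℕ} {P : System n m} {ubar : ℝ → Fin n → ℝ} {X : ℝ} {q : Fin n → ℝ}

/-- The solution of the first-order system with initial value `y`. -/
def sysFlow (hw : P.IsPeriodicWave ubar X q) (h0 : P.H0) (h1 : P.H1)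
    (p : (Fin m → ℝ) × ℂ) (y : Fin n ⊕ Fin n → ℂ) (x : ℝ) : Fin n ⊕ Fin n → ℂ :=
  linearFlow (P.sysCLM ubar p) (continuous_sysCLM hw h0 h1 p) y x

/-- The monodromy matrix of the first-order system. -/
def monodromy (hw : P.IsPeriodicWave ubar X q) (h0 : P.H0) (h1 : P.H1)
    (p : (Fin m → ℝ) × ℂ) : Matrix (Fin n ⊕ Fin n) (Fin n ⊕ Fin n) ℂ :=
  Matrix.of fun r c => sysFlow hw h0 h1 p (Pi.single c 1) X r

theorem hasDerivAt_sysFlow (hw : P.IsPeriodicWave ubar X q) (h0 : P.H0) (h1 : P.H1)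
    (p : (Fin m → ℝ) × ℂ) (y : Fin n ⊕ Fin n → ℂ) (x : ℝ) :
    HasDerivAt (sysFlow hw h0 h1 p y) (P.sysMatrix ubar p.1 p.2 x *ᵥ sysFlow hw h0 h1 p y x) x :=
  hasDerivAt_linearFlow _ _ _ x

theorem sysFlow_zero (hw : P.IsPeriodicWave ubar X q) (h0 : P.H0) (h1 : P.H1)
    (p : (Fin m → ℝ) × ℂ) (y : Fin n ⊕ Fin n → ℂ) : sysFlow hw h0 h1 p y 0 = y :=
  linearFlow_zero _ _ _

theorem eq_of_hasDerivAt (hw : P.IsPeriodicWave ubar X q) (h0 : P.H0) (h1 : P.H1)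
    {p : (Fin m → ℝ) × ℂ} {y z : ℝ → Fin n ⊕ Fin n → ℂ}
    (hy : ∀ x, HasDerivAt y (P.sysMatrix ubar p.1 p.2 x *ᵥ y x) x)
    (hz : ∀ x, HasDerivAt z (P.sysMatrix ubar p.1 p.2 x *ᵥ z x) x) (h : y 0 = z 0) (x : ℝ) :
    y x = z x := by
  have h2 := eq_linearFlow (P.sysCLM ubar p) (continuous_sysCLM hw h0 h1 p) (y := y) hy x
  have h3 := eq_linearFlow (P.sysCLM ubar p) (continuous_sysCLM hw h0 h1 p) (y := z) hz x
  rw [h2, h3, h]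

theorem hasDerivAt_sum_smul {κ : Type*} [Fintype κ] {p : (Fin m → ℝ) × ℂ} (c : κ → ℂ)
    {y : κ → ℝ → Fin n ⊕ Fin n → ℂ}
    (hy : ∀ l x, HasDerivAt (y l) (P.sysMatrix ubar p.1 p.2 x *ᵥ y l x) x) (x : ℝ) :
    HasDerivAt (fun x => ∑ l, c l • y l x)
      (P.sysMatrix ubar p.1 p.2 x *ᵥ ∑ l, c l • y l x) x := by
  rw [Matrix.mulVec_sum]
  simp only [Matrix.mulVec_smul]
  exact HasDerivAt.fun_sum fun l _ => (hy l x).const_smul (c l)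

theorem monodromy_mulVec (hw : P.IsPeriodicWave ubar X q) (h0 : P.H0) (h1 : P.H1)
    {p : (Fin m → ℝ) × ℂ} {y : ℝ → Fin n ⊕ Fin n → ℂ}
    (hy : ∀ x, HasDerivAt y (P.sysMatrix ubar p.1 p.2 x *ᵥ y x) x) :
    monodromy hw h0 h1 p *ᵥ y 0 = y X := by
  have hz := hasDerivAt_sum_smul (P := P) (ubar := ubar) (p := p) (y 0)
    fun l x => hasDerivAt_sysFlow hw h0 h1 p (Pi.single l 1) x
  have h2 := eq_of_hasDerivAt hw h0 h1 hz hy (by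
    simp only [sysFlow_zero]
    exact (pi_eq_sum_univ' (y 0)).symm) X
  rw [← h2]
  ext r
  simp only [monodromy, Matrix.mulVec, dotProduct, Matrix.of_apply, Finset.sum_apply,
    Pi.smul_apply, smul_eq_mul]
  exact Finset.sum_congr rfl fun c _ => mul_comm _ _

/-- The matrix of the change of variables `(w, w') ↦ (w, z)` at `x = 0`. -/
def fluxMatrix (P : System n m) (ubar : ℝ → Fin n → ℝ) (ξt : Fin m → ℝ) :
    Matrix (Fin n ⊕ Fin n) (Fin n ⊕ Fin n) ℂ :=
  Matrix.fromBlocks 1 0 (-P.coeffA ubar 0 0 + Complex.I • ∑ k : Fin m,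
    (ξt k : ℂ) • P.coeffB ubar 0 k.succ 0) (P.coeffB ubar 0 0 0)

theorem fluxMatrix_mulVec (ξt : Fin m → ℝ) (w w' : Fin n → ℂ) :
    P.fluxMatrix ubar ξt *ᵥ Sum.elim w w' = Sum.elim w (P.fluxVar ubar ξt 0 w w') := by
  simp only [fluxMatrix, Matrix.fromBlocks_mulVec, Sum.elim_comp_inl, Sum.elim_comp_inr,
    Matrix.one_mulVec, Matrix.zero_mulVec, add_zero, Matrix.add_mulVec, Matrix.neg_mulVec,
    Matrix.smul_mulVec, Matrix.sum_mulVec, fluxVar]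
  congr 1
  abel

theorem det_fluxMatrix_ne_zero (hw : P.IsPeriodicWave ubar X q) (h1 : P.H1) (ξt : Fin m → ℝ) :
    (P.fluxMatrix ubar ξt).det ≠ 0 := by
  rw [fluxMatrix, Matrix.det_fromBlocks_zero₁₂, Matrix.det_one, one_mul]
  intro h
  have h2 := congrArg Matrix.det (coeffB_mul_coeffBinv hw h1 0)
  rw [Matrix.det_mul, h, zero_mul, Matrix.det_one] at h2
  exact zero_ne_one h2

theorem fluxVar_period (hw : P.IsPeriodicWave ubar X q) (h1 : P.H1) (ξt : Fin m → ℝ)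
    (w w' : Fin n → ℂ) : P.fluxVar ubar ξt X w w' = P.fluxVar ubar ξt 0 w w' := by
  have huX : ubar X = ubar 0 := by simpa using hw.periodic 0
  simp only [fluxVar, coeffA, coeffB, huX, deriv_ubar_period hw h1]

/-- The matrix of the initial data of a kernel basis. -/
def dataMatrix (w : Fin n ⊕ Fin n → (Fin m → ℝ) → ℂ → ℝ → Fin n → ℂ) (p : (Fin m → ℝ) × ℂ) :
    Matrix (Fin n ⊕ Fin n) (Fin n ⊕ Fin n) ℂ :=
  Matrix.of fun r l => Sum.elim (w l p.1 p.2 0) (deriv (w l p.1 p.2) 0) r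

variable {w : Fin n ⊕ Fin n → (Fin m → ℝ) → ℂ → ℝ → Fin n → ℂ}

theorem evans_eq (hw : P.IsPeriodicWave ubar X q) (h0 : P.H0) (h1 : P.H1)
    (hk : P.IsKernelBasis ubar w) (p : (Fin (m + 1) → ℝ) × ℂ) :
    evans w X p.1 p.2 = (monodromy hw h0 h1 (Fin.tail p.1, p.2) -
      Complex.exp (Complex.I * X * p.1 0) • 1).det * (dataMatrix w (Fin.tail p.1, p.2)).det := by
  set ξt := Fin.tail p.1 with hξt
  set e := Complex.exp (Complex.I * X * p.1 0) with he
  set T := P.fluxMatrix ubar ξt with hT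
  set D := dataMatrix w (ξt, p.2) with hD
  have hcol : ∀ x l, Matrix.of (fun r l => Sum.elim (w l ξt p.2 x) (deriv (w l ξt p.2) x) r) *ᵥ
      Pi.single l 1 = Sum.elim (w l ξt p.2 x) (deriv (w l ξt p.2) x) := by
    intro x l
    ext r
    rw [Matrix.mulVec_single_one]
    rfl
  set E : Matrix (Fin n ⊕ Fin n) (Fin n ⊕ Fin n) ℂ :=
    Matrix.of (fun r l => Sum.elim (w l ξt p.2 X) (deriv (w l ξt p.2) X) r) - e • D with hE
  have hev : evans w X p.1 p.2 = E.det := by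
    rw [evans]
    congr 1
    ext (r | r) l <;> rfl
  have hmul : T * E = (monodromy hw h0 h1 (ξt, p.2) - e • 1) * (T * D) := by
    refine Matrix.ext_of_mulVec_single fun l => ?_
    have hsol := fun x => (hk.solution l ξt p.2).hasDerivAt hw h0 h1 x
    have h2 := monodromy_mulVec hw h0 h1 (p := (ξt, p.2)) hsol
    have hD0 : D *ᵥ Pi.single l 1 = Sum.elim (w l ξt p.2 0) (deriv (w l ξt p.2) 0) := hcol 0 l
    rw [← Matrix.mulVec_mulVec, ← Matrix.mulVec_mulVec, ← Matrix.mulVec_mulVec, hE,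
      Matrix.sub_mulVec, Matrix.smul_mulVec, hD0, hcol, Matrix.mulVec_sub, Matrix.mulVec_smul, hT,
      fluxMatrix_mulVec, fluxMatrix_mulVec, Matrix.sub_mulVec, Matrix.smul_mulVec,
      Matrix.one_mulVec, h2, fluxVar_period hw h1]
  have hdet := congrArg Matrix.det hmul
  rw [Matrix.det_mul, Matrix.det_mul, Matrix.det_mul] at hdet
  rw [hev]
  apply mul_left_cancel₀ (det_fluxMatrix_ne_zero hw h1 ξt)
  rw [hdet]
  ring

theorem det_dataMatrix_ne_zero (hw : P.IsPeriodicWave ubar X q) (h0 : P.H0) (h1 : P.H1)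
    (hk : P.IsKernelBasis ubar w) (p : (Fin m → ℝ) × ℂ) : (dataMatrix w p).det ≠ 0 := by
  intro hdet
  obtain ⟨c, hc0, hc⟩ := Matrix.exists_mulVec_eq_zero_iff.2 hdet
  apply hc0
  have hsol := fun l x => (hk.solution l p.1 p.2).hasDerivAt hw h0 h1 x
  have hsum := hasDerivAt_sum_smul (P := P) (ubar := ubar) (p := p) c hsol
  have hzero : ∀ x : ℝ, HasDerivAt (fun _ : ℝ => (0 : Fin n ⊕ Fin n → ℂ))
      (P.sysMatrix ubar p.1 p.2 x *ᵥ 0) x := by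
    intro x
    rw [Matrix.mulVec_zero]
    exact hasDerivAt_const x _
  have hdata : ∑ l, c l • Sum.elim (w l p.1 p.2 0) (deriv (w l p.1 p.2) 0) = 0 := by
    rw [← hc]
    ext r
    simp only [dataMatrix, Matrix.mulVec, dotProduct, Matrix.of_apply, Finset.sum_apply,
      Pi.smul_apply, smul_eq_mul]
    exact Finset.sum_congr rfl fun l _ => mul_comm _ _
  have hstart : ∑ l, c l • Sum.elim (w l p.1 p.2 0)
      (P.fluxVar ubar p.1 0 (w l p.1 p.2 0) (deriv (w l p.1 p.2) 0)) = 0 := by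
    simp only [← fluxMatrix_mulVec, ← Matrix.mulVec_smul, ← Matrix.mulVec_sum]
    rw [hdata, Matrix.mulVec_zero]
  have hall := eq_of_hasDerivAt hw h0 h1 hsum hzero hstart
  have hlin := Fintype.linearIndependent_iff.1 (hk.linearIndependent p.1 p.2) c ?_
  · ext l; exact hlin l
  · ext x a
    have h2 := congrFun (hall x) (Sum.inl a)
    simpa using h2

theorem isBigO_det_dataMatrix_sub (hk : P.IsKernelBasis ubar w) :
    (fun p : (Fin (m + 1) → ℝ) × ℂ => (dataMatrix w (Fin.tail p.1, p.2)).det -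
      (dataMatrix w 0).det) =O[𝓝 0] fun p => ‖p‖ := by
  have hdiff : DifferentiableAt ℝ (fun p => (dataMatrix w p).det) 0 := by
    have hentry : ∀ r l, DifferentiableAt ℝ (fun p => dataMatrix w p r l) 0 := by
      intro r l
      rcases r with r | r
      · exact differentiableAt_pi.1 (hk.analytic l 0 0 (Set.mem_univ _)).differentiableAt r
      · exact differentiableAt_pi.1 (hk.analytic_deriv l 0 0 (Set.mem_univ _)).differentiableAt r
    simp only [Matrix.det_apply']
    fun_prop
  have h2 := hdiff.hasFDerivAt.isBigO_sub
  have htail : Tendsto (fun p : (Fin (m + 1) → ℝ) × ℂ => (Fin.tail p.1, p.2)) (𝓝 0) (𝓝 0) := by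
    have hc : Continuous fun p : (Fin (m + 1) → ℝ) × ℂ => (Fin.tail p.1, p.2) :=
      (continuous_pi fun k => (continuous_apply k.succ).comp continuous_fst).prodMk continuous_snd
    exact hc.tendsto' 0 0 rfl
  refine (h2.comp_tendsto htail).trans (Asymptotics.IsBigO.of_bound 1 (Eventually.of_forall
    fun p => ?_))
  simp only [Function.comp_apply, sub_zero, norm_norm, one_mul]
  refine max_le ?_ (norm_snd_le p)
  exact (pi_norm_le_iff_of_nonneg (norm_nonneg p)).2 fun k =>
    (norm_le_pi_norm p.1 k.succ).trans (norm_fst_le p)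

/-- The initial data of the columns of the Evans matrix. -/
def startMatrix (P : System n m) (ubar : ℝ → Fin n → ℝ) (i₀ : Fin n)
    (p : (Fin (m + 1) → ℝ) × ℂ) : Matrix (Fin n ⊕ Fin n) (Fin n ⊕ Fin n) ℂ :=
  (Matrix.diagonal (Sum.elim 1 (-1))).updateCol (Sum.inl i₀)
    (Sum.elim (complexify n (deriv ubar 0)) (P.waveCombo ubar p 0))

theorem det_startMatrix (i₀ : Fin n) (p : (Fin (m + 1) → ℝ) × ℂ) :
    (P.startMatrix ubar i₀ p).det = deriv ubar 0 i₀ *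
      (Matrix.diagonal (Sum.elim 1 (-1) : Fin n ⊕ Fin n → ℂ)).det := by
  have h := Matrix.det_updateCol_sum (Matrix.diagonal (Sum.elim 1 (-1) : Fin n ⊕ Fin n → ℂ))
    (Sum.inl i₀) (Sum.elim (complexify n (deriv ubar 0)) (-P.waveCombo ubar p 0))
  rw [Sum.elim_inl, complexify_apply, smul_eq_mul] at h
  rw [← h, startMatrix]
  congr 2
  ext r
  simp only [Matrix.diagonal_apply, smul_eq_mul, mul_ite, mul_zero, Finset.sum_ite_eq,
    Finset.mem_univ, if_true]
  rcases r with r | r <;> simp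

/-- The Evans matrix in the columns `startMatrix`. -/
def evansMatrix (hw : P.IsPeriodicWave ubar X q) (h0 : P.H0) (h1 : P.H1) (i₀ : Fin n)
    (p : (Fin (m + 1) → ℝ) × ℂ) : Matrix (Fin n ⊕ Fin n) (Fin n ⊕ Fin n) ℂ :=
  (monodromy hw h0 h1 (Fin.tail p.1, p.2) - Complex.exp (Complex.I * X * p.1 0) • 1) *
    P.startMatrix ubar i₀ p

theorem evansMatrix_apply (hw : P.IsPeriodicWave ubar X q) (h0 : P.H0) (h1 : P.H1) (i₀ : Fin n)
    (p : (Fin (m + 1) → ℝ) × ℂ) (r c : Fin n ⊕ Fin n) {y : Fin n ⊕ Fin n → ℂ}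
    (hy : ∀ r, P.startMatrix ubar i₀ p r c = y r) :
    evansMatrix hw h0 h1 i₀ p r c = sysFlow hw h0 h1 (Fin.tail p.1, p.2) y X r -
      Complex.exp (Complex.I * X * p.1 0) * sysFlow hw h0 h1 (Fin.tail p.1, p.2) y 0 r := by
  have h2 := monodromy_mulVec hw h0 h1 (hasDerivAt_sysFlow hw h0 h1 (Fin.tail p.1, p.2) y)
  rw [← h2, sysFlow_zero, evansMatrix, Matrix.sub_mul, Matrix.smul_mul, Matrix.one_mul,
    Matrix.sub_apply, Matrix.smul_apply, hy, smul_eq_mul, Matrix.mul_apply]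
  simp only [hy]
  rfl

/-- The entries of the Evans matrix to leading order. -/
theorem isBigO_evansMatrix_sub (hw : P.IsPeriodicWave ubar X q) (h0 : P.H0) (h1 : P.H1)
    (i₀ : Fin n) (r c : Fin n ⊕ Fin n) :
    (fun p : (Fin (m + 1) → ℝ) × ℂ => evansMatrix hw h0 h1 i₀ p r c - rowScale n X r *
      P.reducedMatrix (basePoint m ubar X q) X i₀ p.1 p.2 r c) =O[𝓝 0]
      fun p => ‖p‖ ^ (rowDegree r + colDegree i₀ c + 1) := by
  by_cases hc : c = Sum.inl i₀
  · subst hc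
    obtain ⟨C, hC⟩ := exists_modulation_error hw h0 h1
    refine Asymptotics.IsBigO.of_bound C ?_
    filter_upwards [hC] with p hp
    have h2 := hp (sysFlow hw h0 h1 (Fin.tail p.1, p.2) (Sum.elim (complexify n (deriv ubar 0))
      (P.waveCombo ubar p 0))) (hasDerivAt_sysFlow hw h0 h1 _ _) (sysFlow_zero hw h0 h1 _ _) r
    have h3 := evansMatrix_apply hw h0 h1 i₀ p r (Sum.inl i₀)
      (y := Sum.elim (complexify n (deriv ubar 0)) (P.waveCombo ubar p 0))
      fun r => by rw [startMatrix, Matrix.updateCol_self]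
    have h4 : P.reducedMatrix (basePoint m ubar X q) X i₀ p.1 p.2 r (Sum.inl i₀) =
        modulation X p.1 p.2 (P.profileMap (basePoint m ubar X q) p.1 p.2) r := by
      rw [reducedMatrix, Matrix.updateCol_self]
    rw [h3, h4, norm_pow, norm_norm, colDegree, Pi.single_eq_same]
    exact h2
  · obtain ⟨C, hC⟩ := exists_dataDir_error hw h0 h1 c
    refine Asymptotics.IsBigO.of_bound C ?_
    filter_upwards [hC] with p hp
    have h2 := hp (sysFlow hw h0 h1 (Fin.tail p.1, p.2) (Sum.elim
      (complexify n (start (dataDir m c))) (-complexify n (constant (dataDir m c)))))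
      (hasDerivAt_sysFlow hw h0 h1 _ _) (sysFlow_zero hw h0 h1 _ _) r
    have h3 := evansMatrix_apply hw h0 h1 i₀ p r c
      (y := Sum.elim (complexify n (start (dataDir m c))) (-complexify n (constant (dataDir m c))))
      fun r => by
        rw [startMatrix, Matrix.updateCol_ne hc, Matrix.diagonal_apply]
        rcases c with c | c <;> rcases r with r | r <;>
        simp only [dataDir, start, constant, complexify_apply, Pi.single_apply, Sum.elim_inl,
          Sum.elim_inr, Pi.neg_apply, Pi.zero_apply, reduceCtorEq, Sum.inl.injEq, Sum.inr.injEq,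
          Pi.one_apply] <;>
        split_ifs <;> simp_all
    rw [h3, reducedMatrix, Matrix.updateCol_ne hc, norm_pow, norm_norm, colDegree,
      Pi.single_eq_of_ne hc, add_zero]
    exact h2

theorem isBigO_det_evansMatrix_sub (hw : P.IsPeriodicWave ubar X q) (h0 : P.H0) (h1 : P.H1)
    (i₀ : Fin n) :
    (fun p : (Fin (m + 1) → ℝ) × ℂ => (evansMatrix hw h0 h1 i₀ p).det -
      X ^ n * (P.reducedMatrix (basePoint m ubar X q) X i₀ p.1 p.2).det) =O[𝓝 0]
      fun p => ‖p‖ ^ (n + 2) := by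
  have hφ : (fun p : (Fin (m + 1) → ℝ) × ℂ => ‖p‖) =O[𝓝 0] fun _ => (1 : ℝ) :=
    (continuous_norm.continuousAt (x := (0 : (Fin (m + 1) → ℝ) × ℂ))).isBigO_one ℝ
  have h2 := isBigO_det_sub_det (A := evansMatrix hw h0 h1 i₀)
    (B := fun p : (Fin (m + 1) → ℝ) × ℂ => Matrix.of fun r c => rowScale n X r *
      P.reducedMatrix (basePoint m ubar X q) X i₀ p.1 p.2 r c) (k := rowDegree)
      (k' := colDegree i₀) hφ (fun r c => ?_) (isBigO_evansMatrix_sub hw h0 h1 i₀)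
  · rw [sum_rowDegree_add_sum_colDegree] at h2
    simpa [Matrix.det_mul_column, rowScale] using h2
  · simp only [Matrix.of_apply, ← eval_polyMatrix]
    exact (isBigO_eval (isHomogeneous_polyMatrix X i₀ r c) _).const_mul_left _

/-- The Evans function to leading order. -/
theorem exists_evans_asymptotics (hw : P.IsPeriodicWave ubar X q) (h0 : P.H0) (h1 : P.H1)
    {i₀ : Fin n} (hi₀ : deriv ubar 0 i₀ ≠ 0) (hk : P.IsKernelBasis ubar w) :
    ∃ c : ℂ, c ≠ 0 ∧ (fun p : (Fin (m + 1) → ℝ) × ℂ => evans w X p.1 p.2 -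
      c * (P.reducedMatrix (basePoint m ubar X q) X i₀ p.1 p.2).det) =O[𝓝 0]
      fun p => ‖p‖ ^ (n + 2) := by
  set κ : ℂ := deriv ubar 0 i₀ *
    (Matrix.diagonal (Sum.elim 1 (-1) : Fin n ⊕ Fin n → ℂ)).det with hκ
  have hκ0 : κ ≠ 0 := by
    refine mul_ne_zero (by exact_mod_cast hi₀) ?_
    rw [Matrix.det_diagonal, Finset.prod_ne_zero_iff]
    rintro (a | a) - <;> simp
  have hX : (X : ℂ) ≠ 0 := by exact_mod_cast hw.period_pos.ne'
  set W := (dataMatrix w 0).det with hW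
  have hW0 : W ≠ 0 := det_dataMatrix_ne_zero hw h0 h1 hk 0
  refine ⟨κ⁻¹ * W * X ^ n, mul_ne_zero (mul_ne_zero (inv_ne_zero hκ0) hW0) (pow_ne_zero _ hX), ?_⟩
  have hev : ∀ p : (Fin (m + 1) → ℝ) × ℂ, evans w X p.1 p.2 =
      κ⁻¹ * (evansMatrix hw h0 h1 i₀ p).det * (dataMatrix w (Fin.tail p.1, p.2)).det := by
    intro p
    rw [evans_eq hw h0 h1 hk, evansMatrix, Matrix.det_mul, det_startMatrix, ← hκ]
    field_simp
  have hE := isBigO_det_evansMatrix_sub hw h0 h1 i₀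
  have hR : (fun p : (Fin (m + 1) → ℝ) × ℂ =>
      (P.reducedMatrix (basePoint m ubar X q) X i₀ p.1 p.2).det) =O[𝓝 0]
      fun p => ‖p‖ ^ (n + 1) := by
    simp only [← eval_det_polyMatrix]
    exact isBigO_eval (isHomogeneous_det_polyMatrix X i₀) _
  have hφ : (fun p : (Fin (m + 1) → ℝ) × ℂ => ‖p‖) =O[𝓝 0] fun _ => (1 : ℝ) :=
    (continuous_norm.continuousAt (x := (0 : (Fin (m + 1) → ℝ) × ℂ))).isBigO_one ℝ
  have hE' : (fun p : (Fin (m + 1) → ℝ) × ℂ => (evansMatrix hw h0 h1 i₀ p).det) =O[𝓝 0]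
      fun p => ‖p‖ ^ (n + 1) := by
    have := (hE.trans (isBigO_pow_succ_self hφ (n + 1))).add (hR.const_mul_left (X ^ n : ℂ))
    simpa using this
  have h3 := ((hE'.mul (isBigO_det_dataMatrix_sub hk)).congr_right
    fun p => (pow_succ ‖p‖ (n + 1)).symm).const_mul_left κ⁻¹
  have h4 := (h3.add (hE.const_mul_left (κ⁻¹ * W)))
  refine h4.congr_left fun p => ?_
  rw [hev p]
  ring

end System

end PeriodicWave

end

theorem theorem1 {n m : ℕ} (hm : 1 ≤ m) (P : PeriodicWave.System n m)
    (ubar : ℝ → Fin n → ℝ) (X : ℝ) (q : Fin n → ℝ)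
    (hwave : P.IsPeriodicWave ubar X q)
    (h0 : P.H0) (h1 : P.H1) (h2 : P.H2 ubar X q) :
    (∃ ψ, P.IsLocalParametrization ubar X q ψ) ∧
    (∃ w, P.IsKernelBasis ubar w) ∧
    ∀ ψ, P.IsLocalParametrization ubar X q ψ →
      ∃ Δ : MvPolynomial (Fin (m + 1) ⊕ Unit) ℂ,
        Δ.IsHomogeneous (n + 1) ∧
        (∀ (ξ : Fin (m + 1) → ℝ) (lam : ℂ),
          lam ^ m * MvPolynomial.eval (Sum.elim (fun j => (ξ j : ℂ)) (fun _ => lam)) Δ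
            = P.deltaHat ψ ξ lam) ∧
        ∀ w, P.IsKernelBasis ubar w →
          ∃ Γ₀ : ℂ, Γ₀ ≠ 0 ∧
            (fun p : (Fin (m + 1) → ℝ) × ℂ =>
              PeriodicWave.evans w X p.1 p.2 -
                Γ₀ * MvPolynomial.eval (Sum.elim (fun j => (p.1 j : ℂ)) (fun _ => p.2)) Δ)
              =O[𝓝 0] (fun p : (Fin (m + 1) → ℝ) × ℂ => ‖p‖ ^ (n + 2)) := by
  obtain ⟨i₀, hi₀⟩ := Function.ne_iff.1
    (PeriodicWave.System.deriv_ubar_ne_zero hwave h0 h1)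
  refine ⟨PeriodicWave.System.exists_isLocalParametrization hwave h0 h1 h2,
    PeriodicWave.System.exists_isKernelBasis hwave h0 h1, fun ψ hψ => ?_⟩
  obtain ⟨c, hc, hdelta⟩ :=
    PeriodicWave.System.exists_deltaHat_eq hwave h0 h1 h2 hψ hi₀
  have heval : ∀ (ξ : Fin (m + 1) → ℝ) (lam : ℂ),
      MvPolynomial.eval (Sum.elim (fun j => (ξ j : ℂ)) (fun _ => lam)) (MvPolynomial.C c *
        (P.polyMatrix (PeriodicWave.basePoint m ubar X q) X i₀).det) =
      c * (P.reducedMatrix (PeriodicWave.basePoint m ubar X q) X i₀ ξ lam).det := fun ξ lam => by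
    rw [map_mul, MvPolynomial.eval_C, PeriodicWave.System.eval_det_polyMatrix]
  refine ⟨MvPolynomial.C c * (P.polyMatrix (PeriodicWave.basePoint m ubar X q) X i₀).det,
    (PeriodicWave.System.isHomogeneous_det_polyMatrix X i₀).C_mul c, fun ξ lam => ?_,
    fun w hk => ?_⟩
  · rw [heval, hdelta]
  · obtain ⟨c', hc', hevans⟩ :=
      PeriodicWave.System.exists_evans_asymptotics hwave h0 h1 hi₀ hk
    refine ⟨c' / c, div_ne_zero hc' hc, hevans.congr_left fun p => ?_⟩
    rw [heval, ← mul_assoc, div_mul_cancel₀ c' hc]
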